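/- Let $k$ be a field and let $H=(H,\Delta,\varepsilon,\Phi,S,\alpha,\beta)$ be a quasi-Hopf algebra over $k$, with $S$ an anti-automorphism of the algebra $H$. Write $\Delta(h)=h_1\otimes h_2$, $\Phi=X^1\otimes X^2\otimes X^3=Y^1\otimes Y^2\otimes Y^3=T^1\otimes T^2\otimes T^3$, $\Phi^{-1}=x^1\otimes x^2\otimes x^3=t^1\otimes t^2\otimes t^3$ (summation understood), with the convention $(\mathrm{id}\otimes\Delta)\Delta(h)=\Phi\,(\Delta\otimes\mathrm{id})\Delta(h)\,\Phi^{-1}$. Put $q_R=q^1\otimes q^2=X^1\otimes S^{-1}(\alpha X^3)X^2$, and let $$f^{-1}=g^1\otimes g^2=\Delta(S(x^1)\alpha x^2)\,\delta\,(S\otimes S)(\Delta^{cop}(x^3)),\qquad \delta=B^1\beta S(B^4)\otimes B^2\beta S(B^3),$$ where $B^1\otimes B^2\otimes B^3\otimes B^4=(\Delta\otimes \mathrm{id}\otimes \mathrm{id})(\Phi)(\Phi^{-1}\otimes 1)$. Let ${}_H^H\mathcal{YD}$ be the category of left Yetter–Drinfeld modules over $H$: left $H$-modules $M$ with a linear map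 $\lambda_M(m)=m_{(-1)}\otimes m_{(0)}\in H\otimes M$ such that, for all $m\in M$ and $h\in H$, \begin{align*} X^1m_{(-1)}\otimes (X^2\cdot m_{(0)})_{(-1)}X^3\otimes (X^2\cdot m_{(0)})_{(0)}&=X^1(Y^1\cdot m)_{(-1)_1}Y^2\otimes X^2(Y^1\cdot m)_{(-1)_2}Y^3\otimes X^3\cdot (Y^1\cdot m)_{(0)},\\ \varepsilon(m_{(-1)})m_{(0)}&=m,\\ h_1m_{(-1)}\otimes h_2\cdot m_{(0)}&=(h_1\cdot m)_{(-1)}h_2\otimes (h_1\cdot m)_{(0)}. \end{align*} It is monoidal with action $h\cdot(m\otimes n)=h_1\cdot m\otimes h_2\cdot n$, coaction $$\lambda_{M\otimes N}(m\otimes n)=X^1(x^1Y^1\cdot m)_{(-1)}x^2(Y^2\cdot n)_{(-1)}Y^3\otimes X^2\cdot (x^1Y^1\cdot m)_{(0)}\otimes X^3x^3\cdot (Y^2\cdot n)_{(0)},$$ associativity constraints $a_{M,N,P}((m\otimes n)\otimes p)=X^1\cdot m\otimes(X^2\cdot n\otimes X^3\cdot p)$, and (pre)braiding $c_{M,N}(m\otimes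 n)=m_{(-1)}\cdot n\otimes m_{(0)}$. For algebras $A,C$ in ${}_H^H\mathcal{YD}$ with multiplications $\mu_A,\mu_C$, the braided tensor product $A\underline{\otimes}C$ is the object $A\otimes C$ with unit $1_A\otimes 1_C$ and multiplication $$(\mu_A\otimes\mu_C)\circ a^{-1}_{A,A,C\otimes C}\circ(\mathrm{id}\otimes a_{A,C,C})\circ(\mathrm{id}\otimes c_{C,A}\otimes \mathrm{id})\circ(\mathrm{id}\otimes a^{-1}_{C,A,C})\circ a_{A,C,A\otimes C}.$$ For an associative algebra $B$ with a left $H$-coaction $b\mapsto b_{[-1]}\otimes b_{[0]}$ (a left $H$-comodule algebra) and an algebra map $v:H\to B$ that is a morphism of comodule algebras, let $B^v$ be the space $B$ with unit $v(\beta)$, action $h\triangleright b=v(h_1)\,b\,v(S(h_2))$, multiplication $$b\star b'=v(X^1)\,b\,v(S(x^1X^2)\alpha x^2X^3_1)\,b'\,v(S(x^3X^3_2)),$$ and coaction $$b\mapsto X^1Y^1_1\,b_{[-1]}\,g^1S(q^2Y^2_2)Y^3\otimes v(X^2Y^1_2)\,b_{[0]}\,v(g^2S(X^3q^1Y^2_1)).$$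 Let $H_0=H^{\mathrm{id}}$, where $H$ has the coaction $\Delta$. Let $A$ be an algebra in ${}_H^H\mathcal{YD}$. The smash product $A\#H$ is the space $A\otimes H$ with multiplication $(a\#h)(a'\#h')=(x^1\cdot a)(x^2h_1\cdot a')\#x^3h_2h'$; it has the left $H$-coaction $$a\#h\mapsto T^1(t^1\cdot a)_{(-1)}t^2h_1\otimes\big(T^2\cdot(t^1\cdot a)_{(0)}\#T^3t^3h_2\big),$$ and $j:H\to A\#H$ is $j(h)=1_A\#h$. Then $H_0$, $A\underline{\otimes}H_0$ and $(A\#H)^j$, with the structures above, are algebras in ${}_H^H\mathcal{YD}$, and the map $$\Pi:A\underline{\otimes}H_0\to (A\#H)^j,\qquad \Pi(a\otimes h)=x^1\cdot a\#x^2hS(x^3),$$ is an isomorphism of algebras in ${}_H^H\mathcal{YD}$: it is bijective, $H$-linear, $H$-colinear, multiplicative and unital. -/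

import Mathlib

open scoped TensorProduct

noncomputable section

/-! Sweedler-type conventions used in the comments: `Δ(h) = h₁ ⊗ h₂`,
`Φ = X¹ ⊗ X² ⊗ X³ = Y¹ ⊗ Y² ⊗ Y³ = …`, `Φ⁻¹ = x¹ ⊗ x² ⊗ x³ = t¹ ⊗ t² ⊗ t³ = …`, summation
understood.  Triple tensor products are bracketed to the right, `H ⊗ (H ⊗ H)`. -/

/-- A quasi-bialgebra structure `(Δ, ε, Φ)` on the associative unital `k`-algebra `H`. -/
structure QuasiBialgebra (k H : Type*) [Field k] [Ring H] [Algebra k H] where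
  /-- the comultiplication -/
  Δ : H →ₐ[k] H ⊗[k] H
  /-- the counit -/
  ε : H →ₐ[k] k
  /-- the reassociator, an invertible element of `H ⊗ H ⊗ H` -/
  Φ : (H ⊗[k] (H ⊗[k] H))ˣ
  /-- `(id ⊗ Δ)(Δ(h)) = Φ (Δ ⊗ id)(Δ(h)) Φ⁻¹` -/
  quasi_coassoc : ∀ h : H,
    Algebra.TensorProduct.map (AlgHom.id k H) Δ (Δ h) =
      (Φ : H ⊗[k] (H ⊗[k] H)) *
        Algebra.TensorProduct.assoc k k k H H H
          (Algebra.TensorProduct.map Δ (AlgHom.id k H) (Δ h)) *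
        ((Φ⁻¹ : (H ⊗[k] (H ⊗[k] H))ˣ) : H ⊗[k] (H ⊗[k] H))
  /-- `(id ⊗ ε)(Δ(h)) = h ⊗ 1` -/
  counit_right : ∀ h : H,
    Algebra.TensorProduct.map (AlgHom.id k H) ε (Δ h) = h ⊗ₜ[k] (1 : k)
  /-- `(ε ⊗ id)(Δ(h)) = 1 ⊗ h` -/
  counit_left : ∀ h : H,
    Algebra.TensorProduct.map ε (AlgHom.id k H) (Δ h) = (1 : k) ⊗ₜ[k] h
  /-- `(1 ⊗ Φ)(id ⊗ Δ ⊗ id)(Φ)(Φ ⊗ 1) = (id ⊗ id ⊗ Δ)(Φ)(Δ ⊗ id ⊗ id)(Φ)` -/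
  pentagon :
    ((1 : H) ⊗ₜ[k] (Φ : H ⊗[k] (H ⊗[k] H))) *
        Algebra.TensorProduct.map (AlgHom.id k H)
          ((Algebra.TensorProduct.assoc k k k H H H).toAlgHom.comp
            (Algebra.TensorProduct.map Δ (AlgHom.id k H))) (Φ : H ⊗[k] (H ⊗[k] H)) *
        Algebra.TensorProduct.map (AlgHom.id k H)
          (Algebra.TensorProduct.map (AlgHom.id k H)
            (Algebra.TensorProduct.includeLeft : H →ₐ[k] H ⊗[k] H))
          (Φ : H ⊗[k] (H ⊗[k] H)) =
      Algebra.TensorProduct.map (AlgHom.id k H)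
          (Algebra.TensorProduct.map (AlgHom.id k H) Δ) (Φ : H ⊗[k] (H ⊗[k] H)) *
        Algebra.TensorProduct.assoc k k k H H (H ⊗[k] H)
          (Algebra.TensorProduct.map Δ (AlgHom.id k (H ⊗[k] H)) (Φ : H ⊗[k] (H ⊗[k] H)))
  /-- `(ε ⊗ id ⊗ id)(Φ) = 1` -/
  counit_Φ_left :
    Algebra.TensorProduct.map ε (AlgHom.id k (H ⊗[k] H)) (Φ : H ⊗[k] (H ⊗[k] H)) = 1
  /-- `(id ⊗ ε ⊗ id)(Φ) = 1` -/
  counit_Φ_mid :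
    Algebra.TensorProduct.map (AlgHom.id k H)
      (Algebra.TensorProduct.map ε (AlgHom.id k H)) (Φ : H ⊗[k] (H ⊗[k] H)) = 1
  /-- `(id ⊗ id ⊗ ε)(Φ) = 1` -/
  counit_Φ_right :
    Algebra.TensorProduct.map (AlgHom.id k H)
      (Algebra.TensorProduct.map (AlgHom.id k H) ε) (Φ : H ⊗[k] (H ⊗[k] H)) = 1

/-- A quasi-Hopf algebra structure on `H`: a quasi-bialgebra with an anti-automorphism `S` of
the algebra `H` and elements `α, β`. -/
structure QuasiHopfAlgebra (k H : Type*) [Field k] [Ring H] [Algebra k H] extends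
    QuasiBialgebra k H where
  /-- the antipode, a linear bijection … -/
  S : H ≃ₗ[k] H
  /-- … that reverses products (so `S(1) = 1`) -/
  S_mul : ∀ g h : H, S (g * h) = S h * S g
  α : H
  β : H
  /-- `S(h₁) α h₂ = ε(h) α` -/
  antipode_left : ∀ h : H,
    LinearMap.mul' k H (TensorProduct.map S.toLinearMap (LinearMap.mulLeft k α) (Δ h)) = ε h • α
  /-- `h₁ β S(h₂) = ε(h) β` -/
  antipode_right : ∀ h : H,
    LinearMap.mul' k H (TensorProduct.map (LinearMap.mulRight k β) S.toLinearMap (Δ h)) = ε h • β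
  /-- `X¹ β S(X²) α X³ = 1` -/
  antipode_Φ :
    LinearMap.mul' k H
      (TensorProduct.map (LinearMap.mulRight k β)
        (LinearMap.mul' k H ∘ₗ TensorProduct.map S.toLinearMap (LinearMap.mulLeft k α))
        (Φ : H ⊗[k] (H ⊗[k] H))) = 1
  /-- `S(x¹) α x² β S(x³) = 1` -/
  antipode_Φinv :
    LinearMap.mul' k H
      (TensorProduct.map S.toLinearMap
        (LinearMap.mul' k H ∘ₗ
          TensorProduct.map (LinearMap.mulLeft k α ∘ₗ LinearMap.mulRight k β) S.toLinearMap)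
        ((Φ⁻¹ : (H ⊗[k] (H ⊗[k] H))ˣ) : H ⊗[k] (H ⊗[k] H))) = 1

/-- The data of an algebra in the category of left Yetter–Drinfeld modules over `H` on a vector
space `M`: action, coaction, multiplication and unit.  The axioms are `YDAlgebraData.IsYDAlgebra`
below. -/
structure YDAlgebraData (k H M : Type*) [Field k] [Ring H] [Algebra k H]
    [AddCommGroup M] [Module k M] where
  /-- the action `h · m` -/
  act : H →ₗ[k] M →ₗ[k] M
  /-- the coaction `m ↦ m₍₋₁₎ ⊗ m₍₀₎` -/
  coact : M →ₗ[k] H ⊗[k] M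
  mul : M ⊗[k] M →ₗ[k] M
  one : M

namespace QuasiBialgebra

variable {k H : Type*} [Field k] [Ring H] [Algebra k H] (Q : QuasiBialgebra k H)
variable {M N P : Type*} [AddCommGroup M] [Module k M] [AddCommGroup N] [Module k N]
  [AddCommGroup P] [Module k P]

/-- The element `Φ⁻¹`. -/
def Φinv : H ⊗[k] (H ⊗[k] H) := ((Q.Φ⁻¹ : (H ⊗[k] (H ⊗[k] H))ˣ) : H ⊗[k] (H ⊗[k] H))

/-- The action on a tensor product of `H`-modules: `h · (m ⊗ n) = h₁ · m ⊗ h₂ · n`. -/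
def tensorAct (ρM : H →ₗ[k] M →ₗ[k] M) (ρN : H →ₗ[k] N →ₗ[k] N) :
    H →ₗ[k] M ⊗[k] N →ₗ[k] M ⊗[k] N :=
  TensorProduct.map₂ ρM ρN ∘ₗ Q.Δ.toLinearMap

/-- The associativity constraint
`(m ⊗ n) ⊗ p ↦ X¹ · m ⊗ (X² · n ⊗ X³ · p)` of the category of left `H`-modules. -/
def assocHom (ρM : H →ₗ[k] M →ₗ[k] M) (ρN : H →ₗ[k] N →ₗ[k] N) (ρP : H →ₗ[k] P →ₗ[k] P) :
    (M ⊗[k] N) ⊗[k] P →ₗ[k] M ⊗[k] (N ⊗[k] P) :=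
  TensorProduct.map₂ ρM (TensorProduct.map₂ ρN ρP) (Q.Φ : H ⊗[k] (H ⊗[k] H)) ∘ₗ
    (TensorProduct.assoc k M N P).toLinearMap

/-- The inverse associativity constraint `m ⊗ (n ⊗ p) ↦ (x¹ · m ⊗ x² · n) ⊗ x³ · p`. -/
def assocInv (ρM : H →ₗ[k] M →ₗ[k] M) (ρN : H →ₗ[k] N →ₗ[k] N) (ρP : H →ₗ[k] P →ₗ[k] P) :
    M ⊗[k] (N ⊗[k] P) →ₗ[k] (M ⊗[k] N) ⊗[k] P :=
  (TensorProduct.assoc k M N P).symm.toLinearMap ∘ₗ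
    TensorProduct.map₂ ρM (TensorProduct.map₂ ρN ρP) Q.Φinv

end QuasiBialgebra

section YetterDrinfeld

variable {k H : Type*} [Field k] [Ring H] [Algebra k H]
variable {M N : Type*} [AddCommGroup M] [Module k M] [AddCommGroup N] [Module k N]

/-- The braiding `c_{M,N} : M ⊗ N → N ⊗ M`, `m ⊗ n ↦ m₍₋₁₎ · n ⊗ m₍₀₎`.  It uses only the coaction
of `M` and the action on `N`; for `N = H` with left multiplication it is
`m ⊗ h ↦ m₍₋₁₎ h ⊗ m₍₀₎`. -/
def ydBraid (lM : M →ₗ[k] H ⊗[k] M) (ρN : H →ₗ[k] N →ₗ[k] N) : M ⊗[k] N →ₗ[k] N ⊗[k] M :=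
  LinearMap.rTensor M (TensorProduct.lift ρN) ∘ₗ
    (TensorProduct.rightComm k H M N).toLinearMap ∘ₗ LinearMap.rTensor N lM

variable (Q : QuasiBialgebra k H)

/-- The coaction on a tensor product of Yetter–Drinfeld modules,
`λ(m ⊗ n) = X¹ (x¹Y¹·m)₍₋₁₎ x² (Y²·n)₍₋₁₎ Y³ ⊗ X²·(x¹Y¹·m)₍₀₎ ⊗ X³x³·(Y²·n)₍₀₎`,
obtained by applying to `(m ⊗ n) ⊗ 1`, in this order,
* `(m ⊗ n) ⊗ h ↦ Y¹·m ⊗ (Y²·n ⊗ Y³h)`,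
* `m ⊗ (n ⊗ h) ↦ m ⊗ (n₍₋₁₎h ⊗ n₍₀₎)`,
* `m ⊗ (h ⊗ n) ↦ (x¹·m ⊗ x²h) ⊗ x³·n`,
* `(m ⊗ h) ⊗ n ↦ (m₍₋₁₎h ⊗ m₍₀₎) ⊗ n`,
* `(h ⊗ m) ⊗ n ↦ X¹h ⊗ (X²·m ⊗ X³·n)`. -/
def tensorCoact (ρM : H →ₗ[k] M →ₗ[k] M) (lM : M →ₗ[k] H ⊗[k] M)
    (ρN : H →ₗ[k] N →ₗ[k] N) (lN : N →ₗ[k] H ⊗[k] N) :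
    M ⊗[k] N →ₗ[k] H ⊗[k] (M ⊗[k] N) :=
  Q.assocHom (LinearMap.mul k H) ρM ρN ∘ₗ
    LinearMap.rTensor N (ydBraid lM (LinearMap.mul k H)) ∘ₗ
    Q.assocInv ρM (LinearMap.mul k H) ρN ∘ₗ
    LinearMap.lTensor M (ydBraid lN (LinearMap.mul k H)) ∘ₗ
    Q.assocHom ρM ρN (LinearMap.mul k H) ∘ₗ
    (TensorProduct.mk k (M ⊗[k] N) H).flip 1

/-- `M` with the action `ρ` and the coaction `l` is a left Yetter–Drinfeld module over `H`. -/
structure IsYDModule (ρ : H →ₗ[k] M →ₗ[k] M) (l : M →ₗ[k] H ⊗[k] M) : Prop where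
  one_act : ∀ m : M, ρ 1 m = m
  mul_act : ∀ (g h : H) (m : M), ρ (g * h) m = ρ g (ρ h m)
  /-- `X¹m₍₋₁₎ ⊗ (X²·m₍₀₎)₍₋₁₎X³ ⊗ (X²·m₍₀₎)₍₀₎`
  `= X¹(Y¹·m)₍₋₁₎₁Y² ⊗ X²(Y¹·m)₍₋₁₎₂Y³ ⊗ X³·(Y¹·m)₍₀₎` -/
  quasi_coassoc : ∀ m : M,
    LinearMap.lTensor H (ydBraid l (LinearMap.mul k H))
        (Q.assocHom (LinearMap.mul k H) ρ (LinearMap.mul k H) (l m ⊗ₜ[k] (1 : H))) =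
      Q.assocHom (LinearMap.mul k H) (LinearMap.mul k H) ρ
        (ydBraid l (Q.tensorAct (LinearMap.mul k H) (LinearMap.mul k H))
          (Q.assocHom ρ (LinearMap.mul k H) (LinearMap.mul k H)
            ((m ⊗ₜ[k] (1 : H)) ⊗ₜ[k] (1 : H))))
  /-- `ε(m₍₋₁₎) m₍₀₎ = m` -/
  counit_coact : ∀ m : M,
    TensorProduct.lid k M (LinearMap.rTensor M Q.ε.toLinearMap (l m)) = m
  /-- `h₁m₍₋₁₎ ⊗ h₂·m₍₀₎ = (h₁·m)₍₋₁₎h₂ ⊗ (h₁·m)₍₀₎` -/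
  compat : ∀ (h : H) (m : M),
    Q.tensorAct (LinearMap.mul k H) ρ h (l m) =
      ydBraid l (LinearMap.mul k H) (Q.tensorAct ρ (LinearMap.mul k H) h (m ⊗ₜ[k] (1 : H)))

namespace YDAlgebraData

/-- `D` is an algebra in the category of left Yetter–Drinfeld modules: a Yetter–Drinfeld module
which is a left `H`-module algebra and whose multiplication and unit respect the coactions. -/
structure IsYDAlgebra (D : YDAlgebraData k H M) : Prop where
  isYDModule : IsYDModule Q D.act D.coact
  one_mul : ∀ a : M, D.mul (D.one ⊗ₜ[k] a) = a
  mul_one : ∀ a : M, D.mul (a ⊗ₜ[k] D.one) = a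
  /-- `(aa')a'' = (X¹·a)[(X²·a')(X³·a'')]` -/
  mul_assoc : ∀ a a' a'' : M,
    D.mul (D.mul (a ⊗ₜ[k] a') ⊗ₜ[k] a'') =
      D.mul (LinearMap.lTensor M D.mul
        (Q.assocHom D.act D.act D.act ((a ⊗ₜ[k] a') ⊗ₜ[k] a'')))
  /-- `h·(aa') = (h₁·a)(h₂·a')` -/
  act_mul : ∀ (h : H) (a a' : M),
    D.act h (D.mul (a ⊗ₜ[k] a')) = D.mul (Q.tensorAct D.act D.act h (a ⊗ₜ[k] a'))
  /-- `h·1 = ε(h)1` -/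
  act_one : ∀ h : H, D.act h D.one = Q.ε h • D.one
  /-- `λ(1) = 1 ⊗ 1` -/
  coact_one : D.coact D.one = (1 : H) ⊗ₜ[k] D.one
  /-- `λ(aa') = (id ⊗ mul)(λ(a ⊗ a'))` -/
  coact_mul : ∀ a a' : M,
    D.coact (D.mul (a ⊗ₜ[k] a')) =
      LinearMap.lTensor H D.mul (tensorCoact Q D.act D.coact D.act D.coact (a ⊗ₜ[k] a'))

/-- `f` is an isomorphism of algebras in the category of Yetter–Drinfeld modules: a bijective,
`H`-linear, `H`-colinear, multiplicative and unital map. -/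
structure IsYDAlgebraIso (D : YDAlgebraData k H M) (E : YDAlgebraData k H N)
    (f : M →ₗ[k] N) : Prop where
  bijective : Function.Bijective f
  map_act : ∀ (h : H) (m : M), f (D.act h m) = E.act h (f m)
  map_coact : ∀ m : M, E.coact (f m) = LinearMap.lTensor H f (D.coact m)
  map_mul : ∀ m m' : M, f (D.mul (m ⊗ₜ[k] m')) = E.mul (f m ⊗ₜ[k] f m')
  map_one : f D.one = E.one

/-- The braided tensor product of `A` and `B`: the tensor product Yetter–Drinfeld module with
unit `1 ⊗ 1` and multiplication
`(μ_A ⊗ μ_B) ∘ a⁻¹_{A,A,B⊗B} ∘ (id ⊗ a_{A,B,B}) ∘ (id ⊗ (c_{B,A} ⊗ id)) ∘ (id ⊗ a⁻¹_{B,A,B}) ∘`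
`a_{A,B,A⊗B}`. -/
def braidedTensor (A : YDAlgebraData k H M) (B : YDAlgebraData k H N) :
    YDAlgebraData k H (M ⊗[k] N) where
  act := Q.tensorAct A.act B.act
  coact := tensorCoact Q A.act A.coact B.act B.coact
  mul :=
    TensorProduct.map A.mul B.mul ∘ₗ
      Q.assocInv A.act A.act (Q.tensorAct B.act B.act) ∘ₗ
      LinearMap.lTensor M (Q.assocHom A.act B.act B.act) ∘ₗ
      LinearMap.lTensor M (LinearMap.rTensor N (ydBraid B.coact A.act)) ∘ₗ
      LinearMap.lTensor M (Q.assocInv B.act A.act B.act) ∘ₗ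
      Q.assocHom A.act B.act (Q.tensorAct A.act B.act)
  one := A.one ⊗ₜ[k] B.one

/-- The multiplication of the smash product `A # H` on the space `A ⊗ H`:
`(a # h)(a' # h') = (x¹·a)(x²h₁·a') # x³h₂h'`.  First `h` acts on `a' ⊗ h'`, giving
`a ⊗ (h₁·a' ⊗ h₂h')`, then `Φ⁻¹` acts. -/
def smashMul (A : YDAlgebraData k H M) : (M ⊗[k] H) ⊗[k] (M ⊗[k] H) →ₗ[k] M ⊗[k] H :=
  LinearMap.rTensor H A.mul ∘ₗ
    Q.assocInv A.act A.act (LinearMap.mul k H) ∘ₗ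
    LinearMap.lTensor M (TensorProduct.lift (Q.tensorAct A.act (LinearMap.mul k H))) ∘ₗ
    (TensorProduct.assoc k M H (M ⊗[k] H)).toLinearMap

/-- The map `j : H → A # H`, `j(h) = 1 # h`. -/
def smashJ (A : YDAlgebraData k H M) : H →ₗ[k] M ⊗[k] H := TensorProduct.mk k M H A.one

/-- The left `H`-coaction on the smash product,
`a # h ↦ T¹(t¹·a)₍₋₁₎t²h₁ ⊗ (T²·(t¹·a)₍₀₎ # T³t³h₂)`. -/
def smashCoact (A : YDAlgebraData k H M) : M ⊗[k] H →ₗ[k] H ⊗[k] (M ⊗[k] H) :=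
  Q.assocHom (LinearMap.mul k H) A.act (LinearMap.mul k H) ∘ₗ
    LinearMap.rTensor H (ydBraid A.coact (LinearMap.mul k H)) ∘ₗ
    Q.assocInv A.act (LinearMap.mul k H) (LinearMap.mul k H) ∘ₗ
    LinearMap.lTensor M Q.Δ.toLinearMap

end YDAlgebraData

end YetterDrinfeld

namespace QuasiHopfAlgebra

variable {k H : Type*} [Field k] [Ring H] [Algebra k H] (Q : QuasiHopfAlgebra k H)
variable {M B : Type*} [AddCommGroup M] [Module k M] [AddCommGroup B] [Module k B]

/-- `(id ⊗ Δ ⊗ id)` applied to an element of `H ⊗ (H ⊗ H)`, read in `H ⊗ (H ⊗ (H ⊗ H))`. -/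
def midΔ : H ⊗[k] (H ⊗[k] H) →ₐ[k] H ⊗[k] (H ⊗[k] (H ⊗[k] H)) :=
  Algebra.TensorProduct.map (AlgHom.id k H)
    ((Algebra.TensorProduct.assoc k k k H H H).toAlgHom.comp
      (Algebra.TensorProduct.map Q.Δ (AlgHom.id k H)))

/-- `(Δ ⊗ id ⊗ id)(Φ)(Φ⁻¹ ⊗ 1) = B¹ ⊗ B² ⊗ B³ ⊗ B⁴`. -/
def elemB : H ⊗[k] (H ⊗[k] (H ⊗[k] H)) :=
  Algebra.TensorProduct.assoc k k k H H (H ⊗[k] H)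
      (Algebra.TensorProduct.map Q.Δ (AlgHom.id k (H ⊗[k] H)) (Q.Φ : H ⊗[k] (H ⊗[k] H))) *
    Algebra.TensorProduct.map (AlgHom.id k H)
      (Algebra.TensorProduct.map (AlgHom.id k H)
        (Algebra.TensorProduct.includeLeft : H →ₐ[k] H ⊗[k] H)) Q.Φinv

/-- `δ = B¹βS(B⁴) ⊗ B²βS(B³)`: permute to `(B¹ ⊗ B⁴) ⊗ (B² ⊗ B³)`, then apply
`g ⊗ h ↦ gβS(h)` to both factors. -/
def elemδ : H ⊗[k] H :=
  TensorProduct.map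
    (LinearMap.mul' k H ∘ₗ TensorProduct.map (LinearMap.mulRight k Q.β) Q.S.toLinearMap)
    (LinearMap.mul' k H ∘ₗ TensorProduct.map (LinearMap.mulRight k Q.β) Q.S.toLinearMap)
    ((TensorProduct.assoc k H H (H ⊗[k] H)).symm
      (LinearMap.lTensor H (TensorProduct.comm k (H ⊗[k] H) H).toLinearMap
        (LinearMap.lTensor H (TensorProduct.assoc k H H H).symm.toLinearMap Q.elemB)))

/-- The inverse `f⁻¹ = g¹ ⊗ g²` of the Drinfeld twist,
`f⁻¹ = Δ(S(x¹)αx²) δ (S ⊗ S)(Δᶜᵒᵖ(x³))`. -/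
def fInv : H ⊗[k] H :=
  LinearMap.mul' k (H ⊗[k] H)
    (TensorProduct.map
      (LinearMap.mulRight k Q.elemδ ∘ₗ Q.Δ.toLinearMap ∘ₗ LinearMap.mul' k H ∘ₗ
        TensorProduct.map Q.S.toLinearMap (LinearMap.mulLeft k Q.α))
      (TensorProduct.map Q.S.toLinearMap Q.S.toLinearMap ∘ₗ
        (TensorProduct.comm k H H).toLinearMap ∘ₗ Q.Δ.toLinearMap)
      ((TensorProduct.assoc k H H H).symm Q.Φinv))

/-- `q_R = q¹ ⊗ q² = X¹ ⊗ S⁻¹(αX³)X²`. -/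
def qR : H ⊗[k] H :=
  LinearMap.lTensor H
    (LinearMap.mul' k H ∘ₗ
      LinearMap.rTensor H (Q.S.symm.toLinearMap ∘ₗ LinearMap.mulLeft k Q.α) ∘ₗ
      (TensorProduct.comm k H H).toLinearMap)
    (Q.Φ : H ⊗[k] (H ⊗[k] H))

/-- `X¹ ⊗ S(x¹X²)αx²X³₁ ⊗ S(x³X³₂)`. -/
def elemMul : H ⊗[k] (H ⊗[k] H) :=
  LinearMap.lTensor H
    (TensorProduct.map
        (LinearMap.mul' k H ∘ₗ TensorProduct.map Q.S.toLinearMap (LinearMap.mulLeft k Q.α))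
        Q.S.toLinearMap ∘ₗ
      (TensorProduct.assoc k H H H).symm.toLinearMap)
    (((1 : H) ⊗ₜ[k] Q.Φinv) *
      Algebra.TensorProduct.map (AlgHom.id k H)
        (Algebra.TensorProduct.map (AlgHom.id k H) Q.Δ) (Q.Φ : H ⊗[k] (H ⊗[k] H)))

/-- `(X¹Y¹₁ ⊗ X²Y¹₂) ⊗ (X³q¹Y²₁ ⊗ (q²Y²₂ ⊗ Y³))`. -/
def elemCoact : (H ⊗[k] H) ⊗[k] (H ⊗[k] (H ⊗[k] H)) :=
  LinearMap.lTensor (H ⊗[k] H) ((TensorProduct.mk k H (H ⊗[k] H)).flip 1)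
      ((TensorProduct.assoc k H H H).symm (Q.Φ : H ⊗[k] (H ⊗[k] H))) *
    Algebra.TensorProduct.map Q.Δ (AlgHom.id k (H ⊗[k] (H ⊗[k] H)))
      (((1 : H) ⊗ₜ[k] LinearMap.lTensor H ((TensorProduct.mk k H H).flip 1) Q.qR) *
        Q.midΔ (Q.Φ : H ⊗[k] (H ⊗[k] H)))

/-- `c ⊗ (d ⊗ e) ↦ S(d)e ⊗ S(c)`. -/
def coactAux : H ⊗[k] (H ⊗[k] H) →ₗ[k] H ⊗[k] H :=
  (TensorProduct.comm k H H).toLinearMap ∘ₗ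
    TensorProduct.map Q.S.toLinearMap (LinearMap.mul' k H ∘ₗ LinearMap.rTensor H Q.S.toLinearMap)

/-- The product `(p ⊗ b)(q ⊗ b') = pq ⊗ bb'` of `H ⊗ B`, where `mB` is the product of `B`. -/
def mulTensor (mB : B ⊗[k] B →ₗ[k] B) : H ⊗[k] B →ₗ[k] H ⊗[k] B →ₗ[k] H ⊗[k] B :=
  TensorProduct.map₂ (LinearMap.mul k H) (TensorProduct.curry mB)

/-- The algebra `B^v` associated with an associative algebra `B` (unital, with multiplication
`mB`), an algebra map `v : H → B` and a left `H`-coaction `lB(b) = b₍₋₁₎ ⊗ b₍₀₎` making `B` a left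
`H`-comodule algebra and `v` a morphism of comodule algebras.
* action: `h ▷ b = v(h₁) b v(S(h₂))`;
* multiplication: `b ⋆ b' = v(X¹) b v(S(x¹X²)αx²X³₁) b' v(S(x³X³₂))`;
* unit: `v(β)`;
* coaction: `b ↦ X¹Y¹₁ b₍₋₁₎ g¹ S(q²Y²₂) Y³ ⊗ v(X²Y¹₂) b₍₀₎ v(g² S(X³q¹Y²₁))`, that is,
  `(id ⊗ v)(L) (b₍₋₁₎ ⊗ b₍₀₎) (id ⊗ v)(f⁻¹ R)` in `H ⊗ B`, where
  `L ⊗ R = (X¹Y¹₁ ⊗ X²Y¹₂) ⊗ (S(q²Y²₂)Y³ ⊗ S(X³q¹Y²₁))`.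

Products of several factors are bracketed from the left; the definition itself uses only the maps
`mB`, `v`, `lB`. -/
def twistedAlgebra (mB : B ⊗[k] B →ₗ[k] B) (v : H →ₗ[k] B) (lB : B →ₗ[k] H ⊗[k] B) :
    YDAlgebraData k H B where
  act := LinearMap.mk₂ k
    (fun h b => mB (TensorProduct.map (mB ∘ₗ (TensorProduct.mk k B B).flip b ∘ₗ v)
      (v ∘ₗ Q.S.toLinearMap) (Q.Δ h)))
    (by intros; simp) (by intros; simp)
    (by intros; simp [LinearMap.comp_add, LinearMap.add_comp, TensorProduct.map_add_left])
    (by intros; simp [LinearMap.comp_smul, LinearMap.smul_comp, TensorProduct.map_smul_left])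
  coact :=
    { toFun := fun b =>
        TensorProduct.lift (mulTensor mB)
          (TensorProduct.map
            ((mulTensor mB).flip (lB b) ∘ₗ LinearMap.lTensor H v)
            (LinearMap.lTensor H v ∘ₗ LinearMap.mulLeft k Q.fInv ∘ₗ Q.coactAux) Q.elemCoact)
      map_add' := by
        intros; simp [LinearMap.add_comp, TensorProduct.map_add_left]
      map_smul' := by
        intros; simp [LinearMap.smul_comp, TensorProduct.map_smul_left] }
  mul := TensorProduct.lift (LinearMap.mk₂ k
    (fun b b' => mB (TensorProduct.map
      (mB ∘ₗ (TensorProduct.mk k B B).flip b' ∘ₗ mB ∘ₗ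
        TensorProduct.map (mB ∘ₗ (TensorProduct.mk k B B).flip b ∘ₗ v) v) v
      ((TensorProduct.assoc k H H H).symm Q.elemMul)))
    (by intros; simp [LinearMap.comp_add, LinearMap.add_comp, TensorProduct.map_add_left])
    (by intros; simp [LinearMap.comp_smul, LinearMap.smul_comp, TensorProduct.map_smul_left])
    (by intros; simp [LinearMap.comp_add, LinearMap.add_comp, TensorProduct.map_add_left])
    (by intros; simp [LinearMap.comp_smul, LinearMap.smul_comp, TensorProduct.map_smul_left]))
  one := v Q.β

/-- The Yetter–Drinfeld algebra `H₀ = H^v` for `v = id`, with the coaction `Δ` of `H`. -/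
def H₀ : YDAlgebraData k H H :=
  Q.twistedAlgebra (LinearMap.mul' k H) LinearMap.id Q.Δ.toLinearMap

/-- `(A # H)^j`, on the space `A ⊗ H`. -/
def smashTwisted (A : YDAlgebraData k H M) : YDAlgebraData k H (M ⊗[k] H) :=
  Q.twistedAlgebra (A.smashMul Q.toQuasiBialgebra) A.smashJ (A.smashCoact Q.toQuasiBialgebra)

/-- `p ⊗ q ↦ (h ↦ p h S(q))`. -/
def sandwich : H ⊗[k] H →ₗ[k] H →ₗ[k] H :=
  TensorProduct.lift (LinearMap.mk₂ k
    (fun p q => LinearMap.mulRight k (Q.S q) ∘ₗ LinearMap.mulLeft k p)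
    (by intros; ext; simp [add_mul]) (by intros; ext; simp)
    (by intros; ext; simp [mul_add]) (by intros; ext; simp))

/-- The map `Π(a ⊗ h) = x¹·a # x²hS(x³)`. -/
def mapPi (A : YDAlgebraData k H M) : M ⊗[k] H →ₗ[k] M ⊗[k] H :=
  TensorProduct.map₂ A.act Q.sandwich Q.Φinv

end QuasiHopfAlgebra

end

/-! # The braided tensor product of an algebra with `H₀` is a twisted smash product

The algebra `B^v` is an algebra of natural endomorphisms, and both its axioms and the properties of
`Π` become transparent when its elements are evaluated as such.  Let `v : H → B` be a morphism of
comodule algebras.  An element `b` of `B^v` acts on every `B`-module through its evaluation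
`E(b) = v(X¹) b v(S(X²)αX³)`, and

* `E` is an intertwiner, `v(h) E(b) = E(h₁ ▷ b) v(h₂)`, and the evaluations of all `h ▷ b`
  determine `b`, because `b = E(p¹ ▷ b) v(p²)` for `p = x¹ ⊗ x²βS(x³)`;
* `E(b ⋆ b')` is the convolution `E(X¹ ▷ b) E(X² ▷ b') v(X³)`, and `E` of the unit is `1`;
* acting by `b` on the `B`-module `X ⊗ M`, for an `H`-module `X`, is moving `b` past `X` by the
  half-braiding given by the coaction, and then acting on `M`.

`IsEndAlgebra` collects these properties.  They characterize the structure maps, and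
`IsEndAlgebra.isYDAlgebra` deduces all axioms of a Yetter–Drinfeld algebra from them: both sides of
an axiom are `H`-linear, so it suffices to compare their evaluations, and there the axiom is the
pentagon, the hexagon or the multiplicativity of the coaction of `B`.  The antipode does not occur
in this deduction.  It enters in `isEndAlgebra_twisted`, which says that `B^v` has these properties.
The identities needed there are contractions of the pentagon by the antipode axioms (`eMap_pElem`,
`elemMul_eq`, `contractα_leg12_3_4_mul_leg123`, `twistMap_kMap_Φ`), together with
`Δ(S(h)) f⁻¹ = f⁻¹ (S ⊗ S)(Δᶜᵒᵖ(h))` (`Δ_S_mul_fInv`).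

Both `H₀` and `(A # H)^j` are instances of `B^v`; for the second, `isComoduleAlgebra_smash` has to
be shown, which follows from the hexagon identity for `A`.  For an `H`-module `X` and an
`H`-bimodule `N`, the map `adTensor`, `x ⊗ n ↦ x¹ · x ⊗ x² n S(x³)`, is an `H`-linear bijection from
`X ⊗ Nᵃᵈ` to `(X ⊗ N)ᵃᵈ`.  The map `Π` is the case `X = A`, `N = H`, so it is bijective and
`H`-linear.  Moreover `E(Π(a ⊗ h))` is the convolution of `a ↦ a # 1` and `j ∘ E`
(`twistedEval_mapPi`).  These two maps are multiplicative braided intertwiners, and since the second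
takes values in the image of `j`, they commute with each other up to the half-braiding.  Hence
their convolution is multiplicative on the braided tensor product
(`evalMap_braidedTensor_mul`) and compatible with the half-braiding of a tensor product
(`evalMap_convMap_tensorBraid`), and comparing evaluations shows that `Π` is multiplicative and
colinear.  Finally the axioms for the braided tensor product itself are transported along `Π`
(`IsYDAlgebraIso.isYDAlgebra`). -/

noncomputable section

/-! ### Representations and associativity constraints -/

section Representations

variable {k R R' H : Type*} [Field k] [Ring R] [Algebra k R] [Ring R'] [Algebra k R']
  [Ring H] [Algebra k H]
variable {M N P M' N' P' V X Y : Type*} [AddCommGroup M] [Module k M] [AddCommGroup N] [Module k N]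
  [AddCommGroup P] [Module k P] [AddCommGroup M'] [Module k M'] [AddCommGroup N'] [Module k N']
  [AddCommGroup P'] [Module k P'] [AddCommGroup V] [Module k V]
  [AddCommGroup X] [Module k X] [AddCommGroup Y] [Module k Y]

/-- The bilinear map `ρ` makes `M` a left module over the algebra `R`. -/
structure IsRep (ρ : R →ₗ[k] M →ₗ[k] M) : Prop where
  one : ∀ m, ρ 1 m = m
  mul : ∀ a b m, ρ (a * b) m = ρ a (ρ b m)

/-- `f` is linear over `R` for the actions `ρM` and `ρN`. -/
def IsRepHom (ρM : R →ₗ[k] M →ₗ[k] M) (ρN : R →ₗ[k] N →ₗ[k] N) (f : M →ₗ[k] N) : Prop :=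
  ∀ r m, f (ρM r m) = ρN r (f m)

theorem IsRep.mulLeft : IsRep (LinearMap.mul k R) :=
  ⟨fun m => by simp, fun a b m => by simp [mul_assoc]⟩

theorem IsRep.map₂ {ρM : R →ₗ[k] M →ₗ[k] M} {ρN : R' →ₗ[k] N →ₗ[k] N} (hM : IsRep ρM)
    (hN : IsRep ρN) : IsRep (TensorProduct.map₂ ρM ρN) where
  one m := by
    rw [Algebra.TensorProduct.one_def, TensorProduct.map₂_apply_tmul]
    have h1 : ρM 1 = LinearMap.id := LinearMap.ext hM.one
    have h2 : ρN 1 = LinearMap.id := LinearMap.ext hN.one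
    rw [h1, h2, TensorProduct.map_id, LinearMap.id_apply]
  mul a b m := by
    refine TensorProduct.induction_on a (by simp) (fun r s => ?_) (fun x y hx hy => by
      simp only [add_mul, map_add, LinearMap.add_apply, hx, hy])
    refine TensorProduct.induction_on b (by simp) (fun r' s' => ?_) (fun x y hx hy => by
      simp only [mul_add, map_add, LinearMap.add_apply, hx, hy])
    have h1 : ρM (r * r') = ρM r ∘ₗ ρM r' := LinearMap.ext (hM.mul r r')
    have h2 : ρN (s * s') = ρN s ∘ₗ ρN s' := LinearMap.ext (hN.mul s s')
    rw [Algebra.TensorProduct.tmul_mul_tmul, TensorProduct.map₂_apply_tmul, h1, h2,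
      TensorProduct.map_comp]
    rfl

theorem IsRep.comp {ρ : R →ₗ[k] M →ₗ[k] M} (h : IsRep ρ) (f : R' →ₐ[k] R) :
    IsRep (ρ ∘ₗ f.toLinearMap) :=
  ⟨fun m => by simp [h.one], fun a b m => by simp [h.mul]⟩

theorem IsRepHom.id (ρ : R →ₗ[k] M →ₗ[k] M) : IsRepHom ρ ρ LinearMap.id :=
  fun _ _ => rfl

theorem IsRepHom.comp {ρM : R →ₗ[k] M →ₗ[k] M} {ρN : R →ₗ[k] N →ₗ[k] N} {ρP : R →ₗ[k] P →ₗ[k] P}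
    {g : N →ₗ[k] P} {f : M →ₗ[k] N} (hg : IsRepHom ρN ρP g) (hf : IsRepHom ρM ρN f) :
    IsRepHom ρM ρP (g ∘ₗ f) := fun r m => by
  rw [LinearMap.comp_apply, LinearMap.comp_apply, hf, hg]

theorem IsRepHom.map {ρM : R →ₗ[k] M →ₗ[k] M} {ρM' : R →ₗ[k] M' →ₗ[k] M'}
    {ρN : R' →ₗ[k] N →ₗ[k] N} {ρN' : R' →ₗ[k] N' →ₗ[k] N'} {f : M →ₗ[k] M'} {g : N →ₗ[k] N'}
    (hf : IsRepHom ρM ρM' f) (hg : IsRepHom ρN ρN' g) :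
    IsRepHom (TensorProduct.map₂ ρM ρN) (TensorProduct.map₂ ρM' ρN') (TensorProduct.map f g) := by
  intro t u
  refine TensorProduct.induction_on t (by simp) (fun r s => ?_) (fun x y hx hy => by
    simp only [map_add, LinearMap.add_apply, hx, hy])
  refine TensorProduct.induction_on u (by simp) (fun m n => ?_) (fun x y hx hy => by
    simp only [map_add, hx, hy])
  simp only [TensorProduct.map₂_apply_tmul, TensorProduct.map_tmul, hf r m, hg s n]

theorem IsRepHom.restrict {ρM : R →ₗ[k] M →ₗ[k] M} {ρN : R →ₗ[k] N →ₗ[k] N} {f : M →ₗ[k] N}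
    (hf : IsRepHom ρM ρN f) (φ : R' →ₐ[k] R) :
    IsRepHom (ρM ∘ₗ φ.toLinearMap) (ρN ∘ₗ φ.toLinearMap) f := fun _ m => hf _ m

/-- The orbit map `r ↦ r · m` is linear. -/
theorem isRepHom_apply_right {ρ : R →ₗ[k] M →ₗ[k] M} (h : IsRep ρ) (m : M) :
    IsRepHom (LinearMap.mul k R) ρ (ρ.flip m) := fun r s => by
  simp [h.mul]

namespace QuasiBialgebra

variable (Q : QuasiBialgebra k H)
variable {ρM : H →ₗ[k] M →ₗ[k] M} {ρN : H →ₗ[k] N →ₗ[k] N} {ρP : H →ₗ[k] P →ₗ[k] P}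
  {ρV : H →ₗ[k] V →ₗ[k] V} {ρM' : H →ₗ[k] M' →ₗ[k] M'} {ρN' : H →ₗ[k] N' →ₗ[k] N'}
  {ρP' : H →ₗ[k] P' →ₗ[k] P'}

theorem Φinv_mul_Φ : Q.Φinv * (Q.Φ : H ⊗[k] (H ⊗[k] H)) = 1 := Q.Φ.inv_mul

theorem Φ_mul_Φinv : (Q.Φ : H ⊗[k] (H ⊗[k] H)) * Q.Φinv = 1 := Q.Φ.mul_inv

/-- `Δ(h₁) ⊗ h₂`, read in `H ⊗ (H ⊗ H)`. -/
def ΔL : H →ₐ[k] H ⊗[k] (H ⊗[k] H) :=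
  ((Algebra.TensorProduct.assoc k k k H H H).toAlgHom.comp
    (Algebra.TensorProduct.map Q.Δ (AlgHom.id k H))).comp Q.Δ

/-- `h₁ ⊗ Δ(h₂)`. -/
def ΔR : H →ₐ[k] H ⊗[k] (H ⊗[k] H) :=
  (Algebra.TensorProduct.map (AlgHom.id k H) Q.Δ).comp Q.Δ

theorem ΔR_mul_Φ (h : H) : Q.ΔR h * Q.Φ = Q.Φ * Q.ΔL h := by
  have := Q.quasi_coassoc h
  have h2 : Q.ΔR h = Q.Φ * Q.ΔL h * Q.Φinv := this
  rw [h2, mul_assoc, Q.Φinv_mul_Φ, mul_one]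

theorem Φinv_mul_ΔR (h : H) : Q.Φinv * Q.ΔR h = Q.ΔL h * Q.Φinv := by
  have := Q.quasi_coassoc h
  have h2 : Q.ΔR h = Q.Φ * Q.ΔL h * Q.Φinv := this
  rw [h2, ← mul_assoc, ← mul_assoc, Q.Φinv_mul_Φ, one_mul]

theorem isRep_tensorAct (hM : IsRep ρM) (hN : IsRep ρN) : IsRep (Q.tensorAct ρM ρN) :=
  (hM.map₂ hN).comp Q.Δ

theorem isRepHom_map {f : M →ₗ[k] M'} {g : N →ₗ[k] N'} (hf : IsRepHom ρM ρM' f)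
    (hg : IsRepHom ρN ρN' g) :
    IsRepHom (Q.tensorAct ρM ρN) (Q.tensorAct ρM' ρN') (TensorProduct.map f g) :=
  (hf.map hg).restrict Q.Δ

theorem isRepHom_lTensor {g : N →ₗ[k] N'} (hg : IsRepHom ρN ρN' g) :
    IsRepHom (Q.tensorAct ρM ρN) (Q.tensorAct ρM ρN') (g.lTensor M) :=
  Q.isRepHom_map (IsRepHom.id ρM) hg

theorem isRepHom_rTensor {f : M →ₗ[k] M'} (hf : IsRepHom ρM ρM' f) :
    IsRepHom (Q.tensorAct ρM ρN) (Q.tensorAct ρM' ρN) (f.rTensor N) :=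
  Q.isRepHom_map hf (IsRepHom.id ρN)

/-! Actions of elements of `H ⊗ H ⊗ H` obtained by comultiplying one leg. -/

theorem map₂_map_Δ_id (τ : R →ₗ[k] P →ₗ[k] P) (t : H ⊗[k] R) (u : (M ⊗[k] N) ⊗[k] P) :
    TensorProduct.assoc k M N P (TensorProduct.map₂ (Q.tensorAct ρM ρN) τ t u) =
      TensorProduct.map₂ ρM (TensorProduct.map₂ ρN τ)
        (Algebra.TensorProduct.assoc k k k H H R
          (Algebra.TensorProduct.map Q.Δ (AlgHom.id k R) t))
        (TensorProduct.assoc k M N P u) := by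
  refine TensorProduct.induction_on t (by simp) (fun a b => ?_) (fun x y hx hy => by
    simp only [map_add, LinearMap.add_apply, hx, hy])
  simp only [TensorProduct.map₂_apply_tmul, Algebra.TensorProduct.map_tmul, AlgHom.id_apply,
    tensorAct, LinearMap.comp_apply, AlgHom.toLinearMap_apply]
  refine TensorProduct.induction_on (Q.Δ a) (by simp) (fun a₁ a₂ => ?_) (fun x y hx hy => by
    simp only [map_add, LinearMap.add_apply, TensorProduct.add_tmul, TensorProduct.map_add_left,
      hx, hy])
  simp only [Algebra.TensorProduct.assoc_tmul, TensorProduct.map₂_apply_tmul]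
  exact TensorProduct.map_map_assoc _ _ _ u |>.symm

theorem assoc_tensorAct (h : H) (u : (M ⊗[k] N) ⊗[k] P) :
    TensorProduct.assoc k M N P (Q.tensorAct (Q.tensorAct ρM ρN) ρP h u) =
      TensorProduct.map₂ ρM (TensorProduct.map₂ ρN ρP) (Q.ΔL h)
        (TensorProduct.assoc k M N P u) :=
  Q.map₂_map_Δ_id ρP (Q.Δ h) u

theorem map₂_comp_algHom_right {L : Type*} [Ring L] [Algebra k L] (φ : R →ₐ[k] L)
    (σ : L →ₗ[k] N →ₗ[k] N) (τ : R' →ₗ[k] M →ₗ[k] M) (t : R' ⊗[k] R) :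
    TensorProduct.map₂ τ (σ ∘ₗ φ.toLinearMap) t =
      TensorProduct.map₂ τ σ (Algebra.TensorProduct.map (AlgHom.id k R') φ t) := by
  refine TensorProduct.induction_on t (by simp) (fun a b => ?_) (fun x y hx hy => by
    simp only [map_add, hx, hy])
  simp [TensorProduct.map₂_apply_tmul]

theorem tensorAct_right (h : H) :
    Q.tensorAct ρM (Q.tensorAct ρN ρP) h =
      TensorProduct.map₂ ρM (TensorProduct.map₂ ρN ρP) (Q.ΔR h) :=
  map₂_comp_algHom_right Q.Δ _ ρM (Q.Δ h)

/-- The associativity constraint is `H`-linear. -/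
theorem isRepHom_assocHom (hM : IsRep ρM) (hN : IsRep ρN) (hP : IsRep ρP) :
    IsRepHom (Q.tensorAct (Q.tensorAct ρM ρN) ρP) (Q.tensorAct ρM (Q.tensorAct ρN ρP))
      (Q.assocHom ρM ρN ρP) := fun h u => by
  simp only [assocHom, LinearMap.comp_apply, LinearEquiv.coe_coe, assoc_tensorAct, tensorAct_right,
    ← (hM.map₂ (hN.map₂ hP)).mul, ΔR_mul_Φ]

theorem assocHom_assocInv (hM : IsRep ρM) (hN : IsRep ρN) (hP : IsRep ρP)
    (u : M ⊗[k] (N ⊗[k] P)) : Q.assocHom ρM ρN ρP (Q.assocInv ρM ρN ρP u) = u := by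
  simp only [assocHom, assocInv, LinearMap.comp_apply, LinearEquiv.coe_coe,
    LinearEquiv.apply_symm_apply, ← (hM.map₂ (hN.map₂ hP)).mul, Φ_mul_Φinv,
    (hM.map₂ (hN.map₂ hP)).one]

theorem assocInv_assocHom (hM : IsRep ρM) (hN : IsRep ρN) (hP : IsRep ρP)
    (u : (M ⊗[k] N) ⊗[k] P) : Q.assocInv ρM ρN ρP (Q.assocHom ρM ρN ρP u) = u := by
  simp only [assocHom, assocInv, LinearMap.comp_apply, LinearEquiv.coe_coe,
    ← (hM.map₂ (hN.map₂ hP)).mul, Φinv_mul_Φ,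
    (hM.map₂ (hN.map₂ hP)).one, LinearEquiv.symm_apply_apply]

theorem isRepHom_assocInv (hM : IsRep ρM) (hN : IsRep ρN) (hP : IsRep ρP) :
    IsRepHom (Q.tensorAct ρM (Q.tensorAct ρN ρP)) (Q.tensorAct (Q.tensorAct ρM ρN) ρP)
      (Q.assocInv ρM ρN ρP) := fun h u => by
  conv_lhs => rw [← Q.assocHom_assocInv hM hN hP u]
  rw [← Q.isRepHom_assocHom hM hN hP, Q.assocInv_assocHom hM hN hP]

theorem assocHom_map {f : M →ₗ[k] M'} {g : N →ₗ[k] N'} {h : P →ₗ[k] P'}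
    (hf : IsRepHom ρM ρM' f) (hg : IsRepHom ρN ρN' g) (hh : IsRepHom ρP ρP' h)
    (u : (M ⊗[k] N) ⊗[k] P) :
    Q.assocHom ρM' ρN' ρP' (TensorProduct.map (TensorProduct.map f g) h u) =
      TensorProduct.map f (TensorProduct.map g h) (Q.assocHom ρM ρN ρP u) := by
  simp only [assocHom, LinearMap.comp_apply, LinearEquiv.coe_coe]
  rw [(hf.map (hg.map hh)) _ _, TensorProduct.map_map_assoc]

theorem assocHom_rr {f : M →ₗ[k] M'} (hf : IsRepHom ρM ρM' f) (u : (M ⊗[k] N) ⊗[k] P) :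
    Q.assocHom ρM' ρN ρP ((f.rTensor N).rTensor P u) =
      f.rTensor (N ⊗[k] P) (Q.assocHom ρM ρN ρP u) := by
  have := Q.assocHom_map hf (IsRepHom.id ρN) (IsRepHom.id ρP) u
  simp only [TensorProduct.map_id] at this
  exact this

theorem assocHom_rl {f : N →ₗ[k] N'} (hf : IsRepHom ρN ρN' f) (u : (M ⊗[k] N) ⊗[k] P) :
    Q.assocHom ρM ρN' ρP ((f.lTensor M).rTensor P u) =
      (f.rTensor P).lTensor M (Q.assocHom ρM ρN ρP u) :=
  Q.assocHom_map (IsRepHom.id ρM) hf (IsRepHom.id ρP) u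

theorem assocHom_l {f : P →ₗ[k] P'} (hf : IsRepHom ρP ρP' f) (u : (M ⊗[k] N) ⊗[k] P) :
    Q.assocHom ρM ρN ρP' (f.lTensor (M ⊗[k] N) u) =
      (f.lTensor N).lTensor M (Q.assocHom ρM ρN ρP u) := by
  have := Q.assocHom_map (IsRepHom.id ρM) (IsRepHom.id ρN) hf u
  simp only [TensorProduct.map_id] at this
  exact this

/-! The five images of `H ⊗ H ⊗ H` in `H ⊗ H ⊗ H ⊗ H` that occur in the pentagon.  The name
lists the legs of the target; legs written together are hit by `Δ` of one leg of the source. -/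

/-- `1 ⊗ t` -/
def leg234 : H ⊗[k] (H ⊗[k] H) →ₐ[k] H ⊗[k] (H ⊗[k] (H ⊗[k] H)) :=
  Algebra.TensorProduct.includeRight

/-- `(id ⊗ Δ ⊗ id)(t)` -/
def leg1_23_4 : H ⊗[k] (H ⊗[k] H) →ₐ[k] H ⊗[k] (H ⊗[k] (H ⊗[k] H)) :=
  Algebra.TensorProduct.map (AlgHom.id k H)
    ((Algebra.TensorProduct.assoc k k k H H H).toAlgHom.comp
      (Algebra.TensorProduct.map Q.Δ (AlgHom.id k H)))

/-- `t ⊗ 1` -/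
def leg123 : H ⊗[k] (H ⊗[k] H) →ₐ[k] H ⊗[k] (H ⊗[k] (H ⊗[k] H)) :=
  Algebra.TensorProduct.map (AlgHom.id k H)
    (Algebra.TensorProduct.map (AlgHom.id k H)
      (Algebra.TensorProduct.includeLeft : H →ₐ[k] H ⊗[k] H))

/-- `(id ⊗ id ⊗ Δ)(t)` -/
def leg1_2_34 : H ⊗[k] (H ⊗[k] H) →ₐ[k] H ⊗[k] (H ⊗[k] (H ⊗[k] H)) :=
  Algebra.TensorProduct.map (AlgHom.id k H) (Algebra.TensorProduct.map (AlgHom.id k H) Q.Δ)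

/-- `(Δ ⊗ id ⊗ id)(t)` -/
def leg12_3_4 : H ⊗[k] (H ⊗[k] H) →ₐ[k] H ⊗[k] (H ⊗[k] (H ⊗[k] H)) :=
  (Algebra.TensorProduct.assoc k k k H H (H ⊗[k] H)).toAlgHom.comp
    (Algebra.TensorProduct.map Q.Δ (AlgHom.id k (H ⊗[k] H)))

theorem pentagon_legs :
    leg234 Q.Φ * Q.leg1_23_4 Q.Φ * leg123 (k := k) (H := H) Q.Φ =
      Q.leg1_2_34 Q.Φ * Q.leg12_3_4 Q.Φ := Q.pentagon

variable {ρR : H →ₗ[k] V →ₗ[k] V}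

theorem map₂_leg123 (t : H ⊗[k] (H ⊗[k] H)) (u : ((M ⊗[k] N) ⊗[k] P) ⊗[k] V)
    (hV : IsRep ρV) :
    TensorProduct.assoc k M N (P ⊗[k] V) (TensorProduct.assoc k (M ⊗[k] N) P V
      (LinearMap.rTensor V ((TensorProduct.assoc k M N P).symm.toLinearMap ∘ₗ
        TensorProduct.map₂ ρM (TensorProduct.map₂ ρN ρP) t ∘ₗ
          (TensorProduct.assoc k M N P).toLinearMap) u)) =
      TensorProduct.map₂ ρM (TensorProduct.map₂ ρN (TensorProduct.map₂ ρP ρV)) (leg123 t)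
        (TensorProduct.assoc k M N (P ⊗[k] V) (TensorProduct.assoc k (M ⊗[k] N) P V u)) := by
  have h1 : ρV 1 = LinearMap.id := LinearMap.ext hV.one
  refine TensorProduct.induction_on t (by simp) (fun a t => ?_) (fun x y hx hy => by
    simp only [map_add, LinearMap.add_apply, LinearMap.add_comp, LinearMap.comp_add,
      LinearMap.rTensor_add, hx, hy])
  refine TensorProduct.induction_on t (by simp) (fun b c => ?_) (fun x y hx hy => by
    simp only [TensorProduct.tmul_add, map_add, LinearMap.add_apply, LinearMap.add_comp,
      LinearMap.comp_add, LinearMap.rTensor_add, hx, hy])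
  refine TensorProduct.induction_on u (by simp) (fun u r => ?_) (fun x y hx hy => by
    simp only [map_add, hx, hy])
  refine TensorProduct.induction_on u (by simp) (fun u p => ?_) (fun x y hx hy => by
    simp only [TensorProduct.add_tmul, map_add, hx, hy])
  refine TensorProduct.induction_on u (by simp) (fun m n => ?_) (fun x y hx hy => by
    simp only [TensorProduct.add_tmul, map_add, hx, hy])
  simp [leg123, TensorProduct.map₂_apply_tmul, h1]

theorem lTensor_map₂_leg234 (hM : IsRep ρM) (t : H ⊗[k] (H ⊗[k] H))
    (u : M ⊗[k] (N ⊗[k] (P ⊗[k] V))) :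
    LinearMap.lTensor M (TensorProduct.map₂ ρN (TensorProduct.map₂ ρP ρV) t) u =
      TensorProduct.map₂ ρM (TensorProduct.map₂ ρN (TensorProduct.map₂ ρP ρV)) (leg234 t) u := by
  have h1 : ρM 1 = LinearMap.id := LinearMap.ext hM.one
  simp [leg234, TensorProduct.map₂_apply_tmul, h1, LinearMap.lTensor]

theorem map₂_leg1_23_4 (t : H ⊗[k] (H ⊗[k] H)) (u : M ⊗[k] ((N ⊗[k] P) ⊗[k] V)) :
    LinearMap.lTensor M (TensorProduct.assoc k N P V).toLinearMap
      (TensorProduct.map₂ ρM (TensorProduct.map₂ (Q.tensorAct ρN ρP) ρV) t u) =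
    TensorProduct.map₂ ρM (TensorProduct.map₂ ρN (TensorProduct.map₂ ρP ρV)) (Q.leg1_23_4 t)
      (LinearMap.lTensor M (TensorProduct.assoc k N P V).toLinearMap u) := by
  refine TensorProduct.induction_on t (by simp) (fun a t => ?_) (fun x y hx hy => by
    simp only [map_add, LinearMap.add_apply, hx, hy])
  refine TensorProduct.induction_on u (by simp) (fun m u => ?_) (fun x y hx hy => by
    simp only [map_add, hx, hy])
  have := Q.map₂_map_Δ_id (ρM := ρN) (ρN := ρP) ρV t u
  simp only [leg1_23_4, Algebra.TensorProduct.map_tmul, TensorProduct.map₂_apply_tmul,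
    TensorProduct.map_tmul, LinearMap.lTensor_tmul, AlgHom.id_apply, LinearEquiv.coe_coe, this,
    AlgHom.comp_apply]
  rfl

/-- The pentagon identity for the associativity constraints. -/
theorem assocHom_pentagon (hM : IsRep ρM) (hN : IsRep ρN) (hP : IsRep ρP) (hV : IsRep ρV)
    (u : ((M ⊗[k] N) ⊗[k] P) ⊗[k] V) :
    (Q.assocHom ρN ρP ρV).lTensor M (Q.assocHom ρM (Q.tensorAct ρN ρP) ρV
      ((Q.assocHom ρM ρN ρP).rTensor V u)) =
    Q.assocHom ρM ρN (Q.tensorAct ρP ρV) (Q.assocHom (Q.tensorAct ρM ρN) ρP ρV u) := by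
  have key : ∀ w : ((M ⊗[k] N) ⊗[k] P) ⊗[k] V, (TensorProduct.assoc k N P V).toLinearMap.lTensor M
      (TensorProduct.assoc k M (N ⊗[k] P) V
        ((TensorProduct.assoc k M N P).toLinearMap.rTensor V w)) =
      TensorProduct.assoc k M N (P ⊗[k] V) (TensorProduct.assoc k (M ⊗[k] N) P V w) := by
    intro w
    refine TensorProduct.induction_on w (by simp) (fun w r => ?_) (fun x y hx hy => by
      simp only [map_add, hx, hy])
    refine TensorProduct.induction_on w (by simp) (fun w p => ?_) (fun x y hx hy => by
      simp only [TensorProduct.add_tmul, map_add, hx, hy])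
    refine TensorProduct.induction_on w (by simp) (fun m n => ?_) (fun x y hx hy => by
      simp only [TensorProduct.add_tmul, map_add, hx, hy])
    simp
  have h4 := hM.map₂ (hN.map₂ (hP.map₂ hV))
  have hr : Q.assocHom ρM ρN (Q.tensorAct ρP ρV) (Q.assocHom (Q.tensorAct ρM ρN) ρP ρV u) =
      TensorProduct.map₂ ρM (TensorProduct.map₂ ρN (TensorProduct.map₂ ρP ρV))
        (Q.leg1_2_34 Q.Φ * Q.leg12_3_4 Q.Φ)
        (TensorProduct.assoc k M N (P ⊗[k] V) (TensorProduct.assoc k (M ⊗[k] N) P V u)) := by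
    rw [h4.mul]
    have e1 := Q.map₂_map_Δ_id (ρM := ρM) (ρN := ρN) (TensorProduct.map₂ ρP ρV) Q.Φ
      (TensorProduct.assoc k (M ⊗[k] N) P V u)
    have e2 : TensorProduct.map₂ ρM (TensorProduct.map₂ ρN (Q.tensorAct ρP ρV)) Q.Φ =
        TensorProduct.map₂ ρM (TensorProduct.map₂ ρN (TensorProduct.map₂ ρP ρV))
          (Q.leg1_2_34 Q.Φ) := by
      have : TensorProduct.map₂ ρN (Q.tensorAct ρP ρV) =
          TensorProduct.map₂ ρN (TensorProduct.map₂ ρP ρV) ∘ₗ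
            (Algebra.TensorProduct.map (AlgHom.id k H) Q.Δ).toLinearMap :=
        LinearMap.ext fun t => map₂_comp_algHom_right Q.Δ _ ρN t
      rw [this, map₂_comp_algHom_right]
      rfl
    simp only [assocHom, LinearMap.comp_apply, LinearEquiv.coe_coe, e1, e2]
    rfl
  rw [hr, ← pentagon_legs, h4.mul, h4.mul, ← map₂_leg123 Q.Φ u hV, ← key, ← map₂_leg1_23_4,
    ← lTensor_map₂_leg234 hM]
  simp only [assocHom, LinearMap.lTensor_comp, LinearMap.rTensor_comp, LinearMap.comp_apply,
    LinearEquiv.coe_coe]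
  congr 4
  simp only [← LinearMap.comp_apply, ← LinearMap.rTensor_comp]
  congr 2
  ext; simp

/-! If `H` acts on one factor through the counit, the associativity constraint is trivial. -/

theorem map₂_counit_left (φ : H →ₐ[k] k) {m : M} (hm : ∀ h, ρM h m = φ h • m)
    (σ : R →ₗ[k] N →ₗ[k] N) (t : H ⊗[k] R) (n : N) :
    TensorProduct.map₂ ρM σ t (m ⊗ₜ n) =
      m ⊗ₜ σ (TensorProduct.lid k R (Algebra.TensorProduct.map φ (AlgHom.id k R) t)) n := by
  refine TensorProduct.induction_on t (by simp) (fun a b => ?_) (fun x y hx hy => by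
    simp only [map_add, LinearMap.add_apply, TensorProduct.tmul_add, hx, hy])
  simp [TensorProduct.map₂_apply_tmul, hm, TensorProduct.smul_tmul]

theorem map₂_counit_right (φ : H →ₐ[k] k) {m : M} (hm : ∀ h, ρM h m = φ h • m)
    (σ : R →ₗ[k] N →ₗ[k] N) (t : R ⊗[k] H) (n : N) :
    TensorProduct.map₂ σ ρM t (n ⊗ₜ m) =
      σ (TensorProduct.rid k R (Algebra.TensorProduct.map (AlgHom.id k R) φ t)) n ⊗ₜ m := by
  refine TensorProduct.induction_on t (by simp) (fun a b => ?_) (fun x y hx hy => by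
    simp only [map_add, LinearMap.add_apply, TensorProduct.add_tmul, hx, hy])
  simp [TensorProduct.map₂_apply_tmul, hm, TensorProduct.smul_tmul]

theorem assocHom_counit_left (hN : IsRep ρN) (hP : IsRep ρP) {m : M}
    (hm : ∀ h, ρM h m = Q.ε h • m) (n : N) (p : P) :
    Q.assocHom ρM ρN ρP ((m ⊗ₜ n) ⊗ₜ p) = m ⊗ₜ (n ⊗ₜ p) := by
  simp only [assocHom, LinearMap.comp_apply, LinearEquiv.coe_coe, TensorProduct.assoc_tmul]
  rw [map₂_counit_left Q.ε hm, Q.counit_Φ_left, Algebra.TensorProduct.one_def,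
    TensorProduct.lid_tmul, one_smul, (hN.map₂ hP).one]

theorem map₂_counit_mid {n : N} (hn : ∀ h, ρN h n = Q.ε h • n) (hP : IsRep ρP)
    {t : H ⊗[k] (H ⊗[k] H)} (m : M) (p : P) (hM : IsRep ρM)
    (ht : Algebra.TensorProduct.map (AlgHom.id k H)
      (Algebra.TensorProduct.map Q.ε (AlgHom.id k H)) t = 1) :
    TensorProduct.map₂ ρM (TensorProduct.map₂ ρN ρP) t (m ⊗ₜ (n ⊗ₜ p)) = m ⊗ₜ (n ⊗ₜ p) := by
  have key : ∀ t : H ⊗[k] (H ⊗[k] H),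
      TensorProduct.map₂ ρM (TensorProduct.map₂ ρN ρP) t (m ⊗ₜ (n ⊗ₜ p)) =
      TensorProduct.leftComm k N M P (n ⊗ₜ TensorProduct.map₂ ρM ρP
        (LinearMap.lTensor H (TensorProduct.lid k H).toLinearMap
          (Algebra.TensorProduct.map (AlgHom.id k H)
      (Algebra.TensorProduct.map Q.ε (AlgHom.id k H)) t)) (m ⊗ₜ p)) := by
    intro t
    refine TensorProduct.induction_on t (by simp) (fun a t => ?_) (fun x y hx hy => by
      simp only [map_add, LinearMap.add_apply, TensorProduct.tmul_add, hx, hy])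
    refine TensorProduct.induction_on t (by simp) (fun b c => ?_) (fun x y hx hy => by
      simp only [map_add, LinearMap.add_apply, TensorProduct.tmul_add, hx, hy])
    simp [TensorProduct.map₂_apply_tmul, hn, TensorProduct.smul_tmul]
  rw [key, ht, Algebra.TensorProduct.one_def, LinearMap.lTensor_tmul,
    Algebra.TensorProduct.one_def]
  simp [TensorProduct.map₂_apply_tmul, hM.one, hP.one]

theorem assocHom_counit_mid (hM : IsRep ρM) (hP : IsRep ρP) {n : N}
    (hn : ∀ h, ρN h n = Q.ε h • n) (m : M) (p : P) :
    Q.assocHom ρM ρN ρP ((m ⊗ₜ n) ⊗ₜ p) = m ⊗ₜ (n ⊗ₜ p) := by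
  simp only [assocHom, LinearMap.comp_apply, LinearEquiv.coe_coe, TensorProduct.assoc_tmul]
  exact Q.map₂_counit_mid hn hP m p hM Q.counit_Φ_mid

theorem tensorAct_counit_left {m : M} (hm : ∀ h, ρM h m = Q.ε h • m) (h : H)
    (n : N) : Q.tensorAct ρM ρN h (m ⊗ₜ n) = m ⊗ₜ ρN h n := by
  rw [tensorAct, LinearMap.comp_apply, AlgHom.toLinearMap_apply, map₂_counit_left Q.ε hm,
    Q.counit_left, TensorProduct.lid_tmul, one_smul]

theorem tensorAct_counit_right {m : M} (hm : ∀ h, ρM h m = Q.ε h • m) (h : H)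
    (n : N) : Q.tensorAct ρN ρM h (n ⊗ₜ m) = ρN h n ⊗ₜ m := by
  rw [tensorAct, LinearMap.comp_apply, AlgHom.toLinearMap_apply, map₂_counit_right Q.ε hm,
    Q.counit_right, TensorProduct.rid_tmul, one_smul]

end QuasiBialgebra

end Representations

/-! ### Half-braidings of Yetter–Drinfeld modules -/

section HalfBraiding

variable {k H : Type*} [Field k] [Ring H] [Algebra k H]
variable {V W X Y M X' Y' M' : Type*} [AddCommGroup V] [Module k V] [AddCommGroup W] [Module k W]
  [AddCommGroup X] [Module k X] [AddCommGroup Y] [Module k Y] [AddCommGroup M] [Module k M]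
  [AddCommGroup X'] [Module k X'] [AddCommGroup Y'] [Module k Y'] [AddCommGroup M'] [Module k M']

variable {lV : V →ₗ[k] H ⊗[k] V} {lW : W →ₗ[k] H ⊗[k] W} {ρX : H →ₗ[k] X →ₗ[k] X}
  {ρY : H →ₗ[k] Y →ₗ[k] Y} {ρV : H →ₗ[k] V →ₗ[k] V} {ρW : H →ₗ[k] W →ₗ[k] W}
  {ρM : H →ₗ[k] M →ₗ[k] M} {ρX' : H →ₗ[k] X' →ₗ[k] X'} {ρM' : H →ₗ[k] M' →ₗ[k] M'}

theorem ydBraid_tmul (v : V) (x : X) :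
    ydBraid lV ρX (v ⊗ₜ x) = (ρX.flip x).rTensor V (lV v) := by
  simp only [ydBraid, LinearMap.comp_apply, LinearMap.rTensor_tmul, LinearEquiv.coe_coe]
  refine TensorProduct.induction_on (lV v) (by simp) (fun a b => by simp) (fun x y hx hy => by
    simp only [map_add, TensorProduct.add_tmul, hx, hy])

theorem ydBraid_tmul_one (v : V) : ydBraid lV (LinearMap.mul k H) (v ⊗ₜ 1) = lV v := by
  have : (LinearMap.mul k H).flip 1 = LinearMap.id := by ext; simp
  rw [ydBraid_tmul, this, LinearMap.rTensor_id, LinearMap.id_apply]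

theorem ydBraid_lTensor {f : X →ₗ[k] X'} (hf : IsRepHom ρX ρX' f) (u : V ⊗[k] X) :
    ydBraid lV ρX' (f.lTensor V u) = f.rTensor V (ydBraid lV ρX u) := by
  refine TensorProduct.induction_on u (by simp) (fun v x => ?_) (fun x y hx hy => by
    simp only [map_add, hx, hy])
  rw [LinearMap.lTensor_tmul, ydBraid_tmul, ydBraid_tmul, ← LinearMap.rTensor_comp_apply]
  congr 2
  ext h
  simp [hf h x]

theorem ydBraid_rTensor {g : V →ₗ[k] W} (hg : ∀ v, lW (g v) = g.lTensor H (lV v)) (u : V ⊗[k] X) :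
    ydBraid lW ρX (g.rTensor X u) = g.lTensor X (ydBraid lV ρX u) := by
  refine TensorProduct.induction_on u (by simp) (fun v x => ?_) (fun x y hx hy => by
    simp only [map_add, hx, hy])
  rw [LinearMap.rTensor_tmul, ydBraid_tmul, ydBraid_tmul, hg]
  refine TensorProduct.induction_on (lV v) (by simp) (fun a b => by simp) (fun x y hx hy => by
    simp only [map_add, hx, hy])

/-- Elements of `V ⊗ X` come from `V ⊗ H`: a statement about `V ⊗ X` natural in `X` needs to be
checked on the elements `v ⊗ 1` of `V ⊗ H` only. -/
theorem tmul_eq_lTensor_flip (hX : IsRep ρX) (v : V) (x : X) :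
    v ⊗ₜ[k] x = (ρX.flip x).lTensor V (v ⊗ₜ (1 : H)) := by
  simp [hX.one]

variable (Q : QuasiBialgebra k H)

/-- The compatibility of action and coaction says that the half-braiding is `H`-linear on every
module. -/
theorem isRepHom_ydBraid_of_compat (hX : IsRep ρX)
    (h : ∀ (h : H) (v : V), Q.tensorAct (LinearMap.mul k H) ρV h (lV v) =
      ydBraid lV (LinearMap.mul k H) (Q.tensorAct ρV (LinearMap.mul k H) h (v ⊗ₜ[k] (1 : H)))) :
    IsRepHom (Q.tensorAct ρV ρX) (Q.tensorAct ρX ρV) (ydBraid lV ρX) := by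
  intro g u
  refine TensorProduct.induction_on u (by simp) (fun v x => ?_) (fun x y hx hy => by
    simp only [map_add, hx, hy])
  have hx := isRepHom_apply_right hX x
  rw [tmul_eq_lTensor_flip hX v x, ← Q.isRepHom_lTensor hx, ydBraid_lTensor hx, ydBraid_lTensor hx,
    ← Q.isRepHom_rTensor hx, ydBraid_tmul_one, h]

theorem isRepHom_ydBraid (hX : IsRep ρX) (hV : IsYDModule Q ρV lV) :
    IsRepHom (Q.tensorAct ρV ρX) (Q.tensorAct ρX ρV) (ydBraid lV ρX) :=
  isRepHom_ydBraid_of_compat Q hX hV.compat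

theorem IsYDModule.isRep {Q : QuasiBialgebra k H} (hV : IsYDModule Q ρV lV) : IsRep ρV :=
  ⟨hV.one_act, hV.mul_act⟩

/-- The hexagon identity for the half-braiding of a Yetter–Drinfeld module with a tensor
product. -/
theorem ydBraid_hexagon (hX : IsRep ρX) (hY : IsRep ρY) (hV : IsYDModule Q ρV lV)
    (z : (V ⊗[k] X) ⊗[k] Y) :
    (ydBraid lV ρY).lTensor X (Q.assocHom ρX ρV ρY ((ydBraid lV ρX).rTensor Y z)) =
      Q.assocHom ρX ρY ρV (ydBraid lV (Q.tensorAct ρX ρY) (Q.assocHom ρV ρX ρY z)) := by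
  refine TensorProduct.induction_on z (by simp) (fun z y => ?_) (fun x y hx hy => by
    simp only [map_add, hx, hy])
  refine TensorProduct.induction_on z (by simp) (fun v x => ?_) (fun x y hx hy => by
    simp only [TensorProduct.add_tmul, map_add, hx, hy])
  have hy := isRepHom_apply_right hY y
  have hx := isRepHom_apply_right hX x
  have hV' := hV.isRep
  have e : (v ⊗ₜ[k] x) ⊗ₜ[k] y = (ρY.flip y).lTensor (V ⊗[k] X)
      (((ρX.flip x).lTensor V).rTensor H ((v ⊗ₜ (1 : H)) ⊗ₜ (1 : H))) := by
    simp [hX.one, hY.one]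
  have e1 : ∀ u : (V ⊗[k] X) ⊗[k] H, (ydBraid lV ρX).rTensor Y ((ρY.flip y).lTensor (V ⊗[k] X) u) =
      (ρY.flip y).lTensor (X ⊗[k] V) ((ydBraid lV ρX).rTensor H u) := fun u => by
    rw [← LinearMap.comp_apply, ← LinearMap.comp_apply, LinearMap.rTensor_comp_lTensor,
      LinearMap.lTensor_comp_rTensor]
  have e2 : ∀ u : (V ⊗[k] H) ⊗[k] H, (ydBraid lV ρX).rTensor H
      (((ρX.flip x).lTensor V).rTensor H u) = ((ρX.flip x).rTensor V).rTensor H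
        ((ydBraid lV (LinearMap.mul k H)).rTensor H u) := fun u => by
    rw [← LinearMap.comp_apply, ← LinearMap.comp_apply, ← LinearMap.rTensor_comp,
      ← LinearMap.rTensor_comp]
    congr 2
    exact LinearMap.ext (ydBraid_lTensor hx)
  have e3 : ∀ u : H ⊗[k] (V ⊗[k] H), (ydBraid lV ρY).lTensor X
      (((ρY.flip y).lTensor V).lTensor X ((ρX.flip x).rTensor (V ⊗[k] H) u)) =
      TensorProduct.map (ρX.flip x) (TensorProduct.map (ρY.flip y) LinearMap.id)
        ((ydBraid lV (LinearMap.mul k H)).lTensor H u) := fun u => by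
    refine TensorProduct.induction_on u (by simp) (fun h u => ?_) (fun x y hx hy => by
      simp only [map_add, hx, hy])
    simp only [LinearMap.lTensor_tmul, LinearMap.rTensor_tmul, TensorProduct.map_tmul,
      ydBraid_lTensor hy]
    rfl
  have hxy : IsRepHom (Q.tensorAct (LinearMap.mul k H) (LinearMap.mul k H)) (Q.tensorAct ρX ρY)
    (TensorProduct.map (ρX.flip x) (ρY.flip y)) := Q.isRepHom_map hx hy
  have e4 : ∀ u : V ⊗[k] (H ⊗[k] H), ((ρY.flip y).lTensor X).lTensor V
      (((ρX.flip x).rTensor H).lTensor V u) =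
      (TensorProduct.map (ρX.flip x) (ρY.flip y)).lTensor V u := fun u => by
    rw [← LinearMap.comp_apply, ← LinearMap.lTensor_comp, LinearMap.lTensor_comp_rTensor]
  rw [e, e1, e2, Q.assocHom_l hy, Q.assocHom_rr hx, LinearMap.rTensor_tmul, ydBraid_tmul_one,
    Q.assocHom_l hy, Q.assocHom_rl hx, e4, ydBraid_lTensor hxy]
  have e5 := Q.assocHom_map hx hy (IsRepHom.id ρV) (ydBraid lV (Q.tensorAct (LinearMap.mul k H)
    (LinearMap.mul k H)) (Q.assocHom ρV (LinearMap.mul k H) (LinearMap.mul k H)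
      ((v ⊗ₜ[k] (1 : H)) ⊗ₜ[k] (1 : H))))
  have e6 := hV.quasi_coassoc v
  have e7 := e3 (Q.assocHom (LinearMap.mul k H) ρV (LinearMap.mul k H) (lV v ⊗ₜ[k] (1 : H)))
  rw [e7, e6, ← e5]
  rfl

/-- `V ⊗ (X ⊗ M) → X ⊗ (V ⊗ M)`: moving `V` past `X` by the half-braiding. -/
def ydSlide (lV : V →ₗ[k] H ⊗[k] V) (ρV : H →ₗ[k] V →ₗ[k] V) (ρX : H →ₗ[k] X →ₗ[k] X)
    (ρM : H →ₗ[k] M →ₗ[k] M) : V ⊗[k] (X ⊗[k] M) →ₗ[k] X ⊗[k] (V ⊗[k] M) :=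
  Q.assocHom ρX ρV ρM ∘ₗ (ydBraid lV ρX).rTensor M ∘ₗ Q.assocInv ρV ρX ρM

theorem ydSlide_assocHom (hV : IsRep ρV) (hX : IsRep ρX) (hM : IsRep ρM)
    (z : (V ⊗[k] X) ⊗[k] M) : ydSlide Q lV ρV ρX ρM (Q.assocHom ρV ρX ρM z) =
      Q.assocHom ρX ρV ρM ((ydBraid lV ρX).rTensor M z) := by
  simp only [ydSlide, LinearMap.comp_apply, Q.assocInv_assocHom hV hX hM]

theorem isRepHom_ydSlide (hX : IsRep ρX) (hM : IsRep ρM) (hV : IsYDModule Q ρV lV) :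
    IsRepHom (Q.tensorAct ρV (Q.tensorAct ρX ρM)) (Q.tensorAct ρX (Q.tensorAct ρV ρM))
      (ydSlide Q lV ρV ρX ρM) :=
  (Q.isRepHom_assocHom hX hV.isRep hM).comp
    ((Q.isRepHom_rTensor (isRepHom_ydBraid Q hX hV)).comp (Q.isRepHom_assocInv hV.isRep hX hM))

/-- To prove a statement about all elements of `M ⊗ (N ⊗ P)` it suffices to consider the values
of the associativity constraint. -/
theorem QuasiBialgebra.assocHom_surjective (hV : IsRep ρV) (hX : IsRep ρX) (hM : IsRep ρM) :
    Function.Surjective (Q.assocHom ρV ρX ρM) :=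
  fun u => ⟨_, Q.assocHom_assocInv hV hX hM u⟩

theorem QuasiBialgebra.assocHom_injective (hV : IsRep ρV) (hX : IsRep ρX) (hM : IsRep ρM) :
    Function.Injective (Q.assocHom ρV ρX ρM) :=
  Function.LeftInverse.injective (Q.assocInv_assocHom hV hX hM)

theorem lTensor_rTensor_comm {M N M' N' : Type*} [AddCommGroup M] [Module k M] [AddCommGroup N]
    [Module k N] [AddCommGroup M'] [Module k M'] [AddCommGroup N'] [Module k N']
    (f : M →ₗ[k] M') (g : N →ₗ[k] N') (u : M ⊗[k] N) :
    g.lTensor M' (f.rTensor N u) = f.rTensor N' (g.lTensor M u) := by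
  rw [← LinearMap.comp_apply, ← LinearMap.comp_apply, LinearMap.lTensor_comp_rTensor,
    LinearMap.rTensor_comp_lTensor]

section Naturality

theorem ydSlide_lTensor_rTensor {f : X →ₗ[k] X'} (hf : IsRepHom ρX ρX' f) (hV : IsRep ρV)
    (hX : IsRep ρX) (hX' : IsRep ρX') (hM : IsRep ρM) (u : V ⊗[k] (X ⊗[k] M)) :
    ydSlide Q lV ρV ρX' ρM ((f.rTensor M).lTensor V u) =
      f.rTensor (V ⊗[k] M) (ydSlide Q lV ρV ρX ρM u) := by
  obtain ⟨z, rfl⟩ := Q.assocHom_surjective hV hX hM u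
  rw [← Q.assocHom_rl hf, ydSlide_assocHom Q hV hX' hM, ydSlide_assocHom Q hV hX hM,
    ← Q.assocHom_rr hf, ← LinearMap.rTensor_comp_apply, ← LinearMap.rTensor_comp_apply]
  congr 3
  exact LinearMap.ext (ydBraid_lTensor hf)

theorem ydSlide_lTensor_lTensor {f : M →ₗ[k] M'} (hf : IsRepHom ρM ρM' f) (hV : IsRep ρV)
    (hX : IsRep ρX) (hM : IsRep ρM) (hM' : IsRep ρM') (u : V ⊗[k] (X ⊗[k] M)) :
    ydSlide Q lV ρV ρX ρM' ((f.lTensor X).lTensor V u) =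
      (f.lTensor V).lTensor X (ydSlide Q lV ρV ρX ρM u) := by
  obtain ⟨z, rfl⟩ := Q.assocHom_surjective hV hX hM u
  rw [← Q.assocHom_l hf, ydSlide_assocHom Q hV hX hM', ydSlide_assocHom Q hV hX hM,
    ← Q.assocHom_l hf, lTensor_rTensor_comm]

end Naturality

/-- The half-braiding of a tensor product, `(V ⊗ W) ⊗ X → X ⊗ (V ⊗ W)`. -/
def tensorBraid (lV : V →ₗ[k] H ⊗[k] V) (ρV : H →ₗ[k] V →ₗ[k] V) (lW : W →ₗ[k] H ⊗[k] W)
    (ρW : H →ₗ[k] W →ₗ[k] W) (ρX : H →ₗ[k] X →ₗ[k] X) :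
    (V ⊗[k] W) ⊗[k] X →ₗ[k] X ⊗[k] (V ⊗[k] W) :=
  ydSlide Q lV ρV ρX ρW ∘ₗ (ydBraid lW ρX).lTensor V ∘ₗ Q.assocHom ρV ρW ρX

theorem tensorBraid_lTensor {f : X →ₗ[k] X'} (hf : IsRepHom ρX ρX' f) (hV : IsRep ρV)
    (hW : IsRep ρW) (hX : IsRep ρX) (hX' : IsRep ρX') (u : (V ⊗[k] W) ⊗[k] X) :
    tensorBraid Q lV ρV lW ρW ρX' (f.lTensor (V ⊗[k] W) u) =
      f.rTensor (V ⊗[k] W) (tensorBraid Q lV ρV lW ρW ρX u) := by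
  simp only [tensorBraid, LinearMap.comp_apply]
  rw [← ydSlide_lTensor_rTensor Q hf hV hX hX' hW, Q.assocHom_l hf,
    ← LinearMap.lTensor_comp_apply, ← LinearMap.lTensor_comp_apply]
  congr 3
  exact LinearMap.ext (ydBraid_lTensor hf)

theorem tensorCoact_eq (u : V ⊗[k] W) : tensorCoact Q ρV lV ρW lW u =
    tensorBraid Q lV ρV lW ρW (LinearMap.mul k H) (u ⊗ₜ 1) := rfl

theorem ydBraid_tensorCoact (hV : IsRep ρV) (hW : IsRep ρW) (hX : IsRep ρX)
    (u : (V ⊗[k] W) ⊗[k] X) :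
    ydBraid (tensorCoact Q ρV lV ρW lW) ρX u = tensorBraid Q lV ρV lW ρW ρX u := by
  refine TensorProduct.induction_on u (by simp) (fun v x => ?_) (fun x y hx hy => by
    simp only [map_add, hx, hy])
  have hx := isRepHom_apply_right hX x
  rw [tmul_eq_lTensor_flip hX v x, ydBraid_lTensor hx,
    tensorBraid_lTensor Q hx hV hW IsRep.mulLeft hX, ydBraid_tmul_one, tensorCoact_eq]

theorem isRepHom_tensorBraid (hX : IsRep ρX) (hV : IsYDModule Q ρV lV) (hW : IsYDModule Q ρW lW) :
    IsRepHom (Q.tensorAct (Q.tensorAct ρV ρW) ρX) (Q.tensorAct ρX (Q.tensorAct ρV ρW))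
      (tensorBraid Q lV ρV lW ρW ρX) :=
  (isRepHom_ydSlide Q hX hW.isRep hV).comp
    ((Q.isRepHom_lTensor (isRepHom_ydBraid Q hX hW)).comp
      (Q.isRepHom_assocHom hV.isRep hW.isRep hX))

/-- Moving `V ⊗ W` past `X` is moving first `W`, then `V`. -/
theorem ydSlide_ydSlide_tensor (hX : IsRep ρX) (hM : IsRep ρM) (hV' : IsYDModule Q ρV lV)
    (hW' : IsYDModule Q ρW lW) (z : ((V ⊗[k] W) ⊗[k] X) ⊗[k] M) :
    (Q.assocHom ρV ρW ρM).lTensor X (Q.assocHom ρX (Q.tensorAct ρV ρW) ρM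
      ((tensorBraid Q lV ρV lW ρW ρX).rTensor M z)) =
    ydSlide Q lV ρV ρX (Q.tensorAct ρW ρM) ((ydSlide Q lW ρW ρX ρM).lTensor V
      (Q.assocHom ρV ρW (Q.tensorAct ρX ρM) (Q.assocHom (Q.tensorAct ρV ρW) ρX ρM z))) := by
  have hV := hV'.isRep
  have hW := hW'.isRep
  have hWM := Q.isRep_tensorAct hW hM
  have hWX := isRepHom_ydBraid Q hX hW'
  rw [← Q.assocHom_pentagon hV hW hX hM, ← LinearMap.lTensor_comp_apply]
  have e1 : ydSlide Q lW ρW ρX ρM ∘ₗ Q.assocHom ρW ρX ρM =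
      Q.assocHom ρX ρW ρM ∘ₗ (ydBraid lW ρX).rTensor M :=
    LinearMap.ext (ydSlide_assocHom Q hW hX hM)
  rw [e1, LinearMap.lTensor_comp_apply, ← Q.assocHom_rl hWX]
  simp only [tensorBraid, LinearMap.rTensor_comp_apply]
  generalize (((ydBraid lW ρX).lTensor V).rTensor M ((Q.assocHom ρV ρW ρX).rTensor M z)) = w
  obtain ⟨w, rfl⟩ : ∃ w', w = (Q.assocHom ρV ρX ρW).rTensor M w' :=
    ⟨(Q.assocInv ρV ρX ρW).rTensor M w, by
      rw [← LinearMap.rTensor_comp_apply]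
      have : Q.assocHom ρV ρX ρW ∘ₗ Q.assocInv ρV ρX ρW = LinearMap.id :=
        LinearMap.ext (Q.assocHom_assocInv hV hX hW)
      rw [this, LinearMap.rTensor_id, LinearMap.id_apply]⟩
  have e2 : (ydSlide Q lV ρV ρX ρW).rTensor M ((Q.assocHom ρV ρX ρW).rTensor M w) =
      (Q.assocHom ρX ρV ρW).rTensor M (((ydBraid lV ρX).rTensor W).rTensor M w) := by
    rw [← LinearMap.rTensor_comp_apply, ← LinearMap.rTensor_comp_apply]
    congr 2
    exact LinearMap.ext (ydSlide_assocHom Q hV hX hW)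
  rw [e2, Q.assocHom_pentagon hX hV hW hM, Q.assocHom_pentagon hV hX hW hM,
    ydSlide_assocHom Q hV hX hWM, Q.assocHom_rr (isRepHom_ydBraid Q hX hV')]

/-- Moving `V` past `X ⊗ Y` is moving it past `X`, then past `Y`. -/
theorem ydSlide_tensor (hX : IsRep ρX) (hY : IsRep ρY) (hM : IsRep ρM) (hV' : IsYDModule Q ρV lV)
    (u : V ⊗[k] ((X ⊗[k] Y) ⊗[k] M)) :
    (ydSlide Q lV ρV ρY ρM).lTensor X (ydSlide Q lV ρV ρX (Q.tensorAct ρY ρM)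
      ((Q.assocHom ρX ρY ρM).lTensor V u)) =
    Q.assocHom ρX ρY (Q.tensorAct ρV ρM) (ydSlide Q lV ρV (Q.tensorAct ρX ρY) ρM u) := by
  have hV := hV'.isRep
  have hXY := Q.isRep_tensorAct hX hY
  obtain ⟨z, rfl⟩ := Q.assocHom_surjective hV hXY hM u
  obtain ⟨z, rfl⟩ : ∃ z', z = (Q.assocHom ρV ρX ρY).rTensor M z' :=
    ⟨(Q.assocInv ρV ρX ρY).rTensor M z, by
      rw [← LinearMap.rTensor_comp_apply]
      have : Q.assocHom ρV ρX ρY ∘ₗ Q.assocInv ρV ρX ρY = LinearMap.id :=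
        LinearMap.ext (Q.assocHom_assocInv hV hX hY)
      rw [this, LinearMap.rTensor_id, LinearMap.id_apply]⟩
  have e1 : ydSlide Q lV ρV ρY ρM ∘ₗ Q.assocHom ρV ρY ρM =
      Q.assocHom ρY ρV ρM ∘ₗ (ydBraid lV ρY).rTensor M :=
    LinearMap.ext (ydSlide_assocHom Q hV hY hM)
  have e2 : (ydBraid lV ρY).lTensor X ∘ₗ Q.assocHom ρX ρV ρY ∘ₗ (ydBraid lV ρX).rTensor Y =
      Q.assocHom ρX ρY ρV ∘ₗ ydBraid lV (Q.tensorAct ρX ρY) ∘ₗ Q.assocHom ρV ρX ρY :=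
    LinearMap.ext (ydBraid_hexagon Q hX hY hV')
  rw [Q.assocHom_pentagon hV hX hY hM, ydSlide_assocHom Q hV hX (Q.isRep_tensorAct hY hM),
    ← Q.assocHom_rr (isRepHom_ydBraid Q hX hV'), ← Q.assocHom_pentagon hX hV hY hM,
    ← LinearMap.lTensor_comp_apply, e1, LinearMap.lTensor_comp_apply,
    ← Q.assocHom_rl (isRepHom_ydBraid Q hY hV'), ← LinearMap.rTensor_comp_apply,
    ← LinearMap.rTensor_comp_apply, LinearMap.comp_assoc, e2, LinearMap.rTensor_comp_apply,
    LinearMap.rTensor_comp_apply, Q.assocHom_pentagon hX hY hV hM, ydSlide_assocHom Q hV hXY hM]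

end HalfBraiding

/-! ### Comodule algebras and intertwiners -/

section Intertwiners

variable {k H B : Type*} [Field k] [Ring H] [Algebra k H] [Ring B] [Algebra k B]
variable {V W U X Y M X' M' : Type*} [AddCommGroup V] [Module k V] [AddCommGroup W] [Module k W]
  [AddCommGroup U] [Module k U]
  [AddCommGroup X] [Module k X] [AddCommGroup Y] [Module k Y] [AddCommGroup M] [Module k M]
  [AddCommGroup X'] [Module k X'] [AddCommGroup M'] [Module k M']

variable {lV : V →ₗ[k] H ⊗[k] V} {lW : W →ₗ[k] H ⊗[k] W} {ρX : H →ₗ[k] X →ₗ[k] X}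
  {ρY : H →ₗ[k] Y →ₗ[k] Y} {ρV : H →ₗ[k] V →ₗ[k] V} {ρW : H →ₗ[k] W →ₗ[k] W}
  {ρU : H →ₗ[k] U →ₗ[k] U}
  {ρX' : H →ₗ[k] X' →ₗ[k] X'} {θ : B →ₗ[k] M →ₗ[k] M} {θ' : B →ₗ[k] M' →ₗ[k] M'}

variable (Q : QuasiBialgebra k H) (v : H →ₐ[k] B) (ℓ : B →ₐ[k] H ⊗[k] B)

/-- `B` with the coaction `ℓ` is a left `H`-comodule algebra with reassociator
`(id ⊗ id ⊗ v)(Φ)`, and `v : H → B` is a morphism of comodule algebras. -/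
structure IsComoduleAlgebra : Prop where
  coact_map : ∀ h, ℓ (v h) = Algebra.TensorProduct.map (AlgHom.id k H) v (Q.Δ h)
  coassoc : ∀ b, Algebra.TensorProduct.map (AlgHom.id k H) ℓ (ℓ b) *
      Algebra.TensorProduct.map (AlgHom.id k H) (Algebra.TensorProduct.map (AlgHom.id k H) v) Q.Φ =
    Algebra.TensorProduct.map (AlgHom.id k H) (Algebra.TensorProduct.map (AlgHom.id k H) v) Q.Φ *
      Algebra.TensorProduct.assoc k k k H H B
        (Algebra.TensorProduct.map Q.Δ (AlgHom.id k B) (ℓ b))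
  counit : ∀ b, Algebra.TensorProduct.map Q.ε (AlgHom.id k B) (ℓ b) = 1 ⊗ₜ b

/-- Restriction of a `B`-module along `v`. -/
def resAct (θ : B →ₗ[k] M →ₗ[k] M) : H →ₗ[k] M →ₗ[k] M := θ ∘ₗ v.toLinearMap

/-- The `B`-module `X ⊗ M`, for an `H`-module `X` and a `B`-module `M`, on which `B` acts through
its coaction. -/
def coactAct (ρX : H →ₗ[k] X →ₗ[k] X) (θ : B →ₗ[k] M →ₗ[k] M) :
    B →ₗ[k] X ⊗[k] M →ₗ[k] X ⊗[k] M :=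
  TensorProduct.map₂ ρX θ ∘ₗ ℓ.toLinearMap

/-- A linear map `f : V → B` lets `V` act on every `B`-module: `v ⊗ m ↦ f(v) m`. -/
def evalMap (f : V →ₗ[k] B) (θ : B →ₗ[k] M →ₗ[k] M) : V ⊗[k] M →ₗ[k] M :=
  TensorProduct.lift (θ ∘ₗ f)

/-- `f : V → B` satisfies `v(h) f(x) = f(h₁ · x) v(h₂)`, that is, the evaluation
`x ⊗ b ↦ f(x) b` is `H`-linear. -/
def IsIntertwiner (ρV : H →ₗ[k] V →ₗ[k] V) (f : V →ₗ[k] B) : Prop :=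
  IsRepHom (Q.tensorAct ρV (resAct v (LinearMap.mul k B))) (resAct v (LinearMap.mul k B))
    (evalMap f (LinearMap.mul k B))

variable {v ℓ}

theorem isRep_resAct (hθ : IsRep θ) : IsRep (resAct v θ) := hθ.comp v

theorem isRep_coactAct (hX : IsRep ρX) (hθ : IsRep θ) : IsRep (coactAct ℓ ρX θ) :=
  (hX.map₂ hθ).comp ℓ

@[simp]
theorem evalMap_tmul (f : V →ₗ[k] B) (θ : B →ₗ[k] M →ₗ[k] M) (x : V) (m : M) :
    evalMap f θ (x ⊗ₜ m) = θ (f x) m := rfl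

theorem evalMap_lTensor {g : M →ₗ[k] M'} (hg : IsRepHom θ θ' g) (f : V →ₗ[k] B) (u : V ⊗[k] M) :
    evalMap f θ' (g.lTensor V u) = g (evalMap f θ u) := by
  refine TensorProduct.induction_on u (by simp) (fun x m => by simp [hg (f x) m])
    (fun x y hx hy => by simp only [map_add, hx, hy])

theorem evalMap_rTensor (g : W →ₗ[k] V) (f : V →ₗ[k] B) (u : W ⊗[k] M) :
    evalMap f θ (g.rTensor M u) = evalMap (f ∘ₗ g) θ u := by
  refine TensorProduct.induction_on u (by simp) (fun x m => by simp)
    (fun x y hx hy => by simp only [map_add, hx, hy])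

theorem IsRepHom.resAct {g : M →ₗ[k] M'} (hg : IsRepHom θ θ' g) :
    IsRepHom (resAct v θ) (resAct v θ') g := hg.restrict v

theorem IsRepHom.coactAct {f : X →ₗ[k] X'} {g : M →ₗ[k] M'} (hf : IsRepHom ρX ρX' f)
    (hg : IsRepHom θ θ' g) :
    IsRepHom (coactAct ℓ ρX θ) (coactAct ℓ ρX' θ') (TensorProduct.map f g) :=
  (hf.map hg).restrict ℓ

variable {Q}

/-- An intertwiner acts `H`-linearly on every `B`-module. -/
theorem IsIntertwiner.isRepHom {f : V →ₗ[k] B} (hf : IsIntertwiner Q v ρV f) (hθ : IsRep θ) :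
    IsRepHom (Q.tensorAct ρV (resAct v θ)) (resAct v θ) (evalMap f θ) := by
  intro h u
  refine TensorProduct.induction_on u (by simp) (fun x m => ?_) (fun x y hx hy => by
    simp only [map_add, hx, hy])
  have hm := isRepHom_apply_right hθ m
  have e : x ⊗ₜ[k] m = (θ.flip m).lTensor V (x ⊗ₜ 1) := by simp [hθ.one]
  rw [e, ← Q.isRepHom_lTensor (hm.resAct (v := v)), evalMap_lTensor hm, evalMap_lTensor hm, hf,
    hm.resAct (v := v)]

theorem resAct_coactAct (hB : IsComoduleAlgebra Q v ℓ) :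
    resAct v (coactAct ℓ ρX θ) = Q.tensorAct ρX (resAct v θ) := by
  refine LinearMap.ext fun h => ?_
  rw [QuasiBialgebra.tensorAct, resAct, coactAct, LinearMap.comp_apply, LinearMap.comp_apply,
    LinearMap.comp_apply, AlgHom.toLinearMap_apply, AlgHom.toLinearMap_apply,
    AlgHom.toLinearMap_apply, hB.coact_map]
  exact (QuasiBialgebra.map₂_comp_algHom_right v θ ρX (Q.Δ h)).symm

/-- The associativity constraint `(X ⊗ Y) ⊗ M → X ⊗ (Y ⊗ M)` is `B`-linear. -/
theorem isRepHom_assocHom_coactAct (hB : IsComoduleAlgebra Q v ℓ) (hX : IsRep ρX) (hY : IsRep ρY)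
    (hθ : IsRep θ) :
    IsRepHom (coactAct ℓ (Q.tensorAct ρX ρY) θ) (coactAct ℓ ρX (coactAct ℓ ρY θ))
      (Q.assocHom ρX ρY (resAct v θ)) := by
  intro b u
  have h3 := hX.map₂ (hY.map₂ hθ)
  have e1 : TensorProduct.map₂ ρX (TensorProduct.map₂ ρY (resAct v θ)) Q.Φ =
      TensorProduct.map₂ ρX (TensorProduct.map₂ ρY θ) (Algebra.TensorProduct.map (AlgHom.id k H)
        (Algebra.TensorProduct.map (AlgHom.id k H) v) Q.Φ) := by
    have : TensorProduct.map₂ ρY (resAct v θ) = TensorProduct.map₂ ρY θ ∘ₗ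
        (Algebra.TensorProduct.map (AlgHom.id k H) v).toLinearMap :=
      LinearMap.ext fun t => QuasiBialgebra.map₂_comp_algHom_right v θ ρY t
    rw [this, QuasiBialgebra.map₂_comp_algHom_right]
  have e2 : coactAct ℓ ρX (coactAct ℓ ρY θ) b = TensorProduct.map₂ ρX (TensorProduct.map₂ ρY θ)
      (Algebra.TensorProduct.map (AlgHom.id k H) ℓ (ℓ b)) :=
    QuasiBialgebra.map₂_comp_algHom_right ℓ _ ρX (ℓ b)
  simp only [QuasiBialgebra.assocHom, LinearMap.comp_apply, LinearEquiv.coe_coe, e1, e2]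
  rw [← h3.mul, hB.coassoc, h3.mul]
  congr 1
  exact Q.map₂_map_Δ_id θ (ℓ b) u

/-- The linear map `V ⊗ W → B` with `(f ∗ g)(x ⊗ y) = f(X¹ · x) g(X² · y) v(X³)`. -/
def convMap (Q : QuasiBialgebra k H) (v : H →ₐ[k] B) (ρV : H →ₗ[k] V →ₗ[k] V)
    (ρW : H →ₗ[k] W →ₗ[k] W) (f : V →ₗ[k] B) (g : W →ₗ[k] B) : V ⊗[k] W →ₗ[k] B :=
  evalMap f (LinearMap.mul k B) ∘ₗ (evalMap g (LinearMap.mul k B)).lTensor V ∘ₗ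
    Q.assocHom ρV ρW (resAct v (LinearMap.mul k B)) ∘ₗ (TensorProduct.mk k (V ⊗[k] W) B).flip 1

theorem evalMap_convMap (hθ : IsRep θ) (f : V →ₗ[k] B) (g : W →ₗ[k] B)
    (u : (V ⊗[k] W) ⊗[k] M) :
    evalMap (convMap Q v ρV ρW f g) θ u =
      evalMap f θ ((evalMap g θ).lTensor V (Q.assocHom ρV ρW (resAct v θ) u)) := by
  refine TensorProduct.induction_on u (by simp) (fun w m => ?_) (fun x y hx hy => by
    simp only [map_add, hx, hy])
  have hm := isRepHom_apply_right hθ m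
  have e : w ⊗ₜ[k] m = (θ.flip m).lTensor (V ⊗[k] W) (w ⊗ₜ 1) := by simp [hθ.one]
  have e2 : evalMap g θ ∘ₗ (θ.flip m).lTensor W = θ.flip m ∘ₗ evalMap g (LinearMap.mul k B) :=
    LinearMap.ext (evalMap_lTensor hm g)
  rw [e, evalMap_lTensor hm, Q.assocHom_l (hm.resAct (v := v)), ← LinearMap.lTensor_comp_apply, e2,
    LinearMap.lTensor_comp_apply, evalMap_lTensor hm]
  simp [convMap]

theorem IsIntertwiner.convMap {f : V →ₗ[k] B} {g : W →ₗ[k] B} (hf : IsIntertwiner Q v ρV f)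
    (hg : IsIntertwiner Q v ρW g) (hV : IsRep ρV) (hW : IsRep ρW) :
    IsIntertwiner Q v (Q.tensorAct ρV ρW) (convMap Q v ρV ρW f g) := by
  have hB : IsRep (LinearMap.mul k B) := IsRep.mulLeft
  have e : evalMap (_root_.convMap Q v ρV ρW f g) (LinearMap.mul k B) =
      evalMap f (LinearMap.mul k B) ∘ₗ (evalMap g (LinearMap.mul k B)).lTensor V ∘ₗ
        Q.assocHom ρV ρW (resAct v (LinearMap.mul k B)) :=
    LinearMap.ext (evalMap_convMap hB f g)
  unfold IsIntertwiner
  rw [e]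
  exact hf.comp ((Q.isRepHom_lTensor hg).comp (Q.isRepHom_assocHom hV hW (isRep_resAct hB)))

/-- An intertwiner `f : V → B` is compatible with the half-braiding of `V`: acting by `V` on the
`B`-module `H ⊗ B` is moving `V` past `H` and then acting on `B`. -/
structure IsBraidedIntertwiner (Q : QuasiBialgebra k H) (v : H →ₐ[k] B) (ℓ : B →ₐ[k] H ⊗[k] B)
    (ρV : H →ₗ[k] V →ₗ[k] V) (lV : V →ₗ[k] H ⊗[k] V) (f : V →ₗ[k] B) : Prop where
  isIntertwiner : IsIntertwiner Q v ρV f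
  braid : ∀ x : V, (evalMap f (LinearMap.mul k B)).lTensor H
      (Q.assocHom (LinearMap.mul k H) ρV (resAct v (LinearMap.mul k B)) (lV x ⊗ₜ 1)) =
    evalMap f (coactAct ℓ (LinearMap.mul k H) (LinearMap.mul k B))
      (Q.assocHom ρV (LinearMap.mul k H) (resAct v (LinearMap.mul k B)) ((x ⊗ₜ 1) ⊗ₜ 1))

theorem IsBraidedIntertwiner.evalMap_ydBraid {f : V →ₗ[k] B}
    (hf : IsBraidedIntertwiner Q v ℓ ρV lV f) (hX : IsRep ρX) (hθ : IsRep θ)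
    (z : (V ⊗[k] X) ⊗[k] M) :
    (evalMap f θ).lTensor X (Q.assocHom ρX ρV (resAct v θ) ((ydBraid lV ρX).rTensor M z)) =
      evalMap f (coactAct ℓ ρX θ) (Q.assocHom ρV ρX (resAct v θ) z) := by
  refine TensorProduct.induction_on z (by simp) (fun z m => ?_) (fun x y hx hy => by
    simp only [map_add, hx, hy])
  refine TensorProduct.induction_on z (by simp) (fun y x => ?_) (fun x y hx hy => by
    simp only [TensorProduct.add_tmul, map_add, hx, hy])
  have hm := isRepHom_apply_right hθ m
  have hx := isRepHom_apply_right hX x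
  have e : (y ⊗ₜ[k] x) ⊗ₜ[k] m = TensorProduct.map ((ρX.flip x).lTensor V) (θ.flip m)
      ((y ⊗ₜ (1 : H)) ⊗ₜ (1 : B)) := by
    simp [hX.one, hθ.one]
  have e1 : (ydBraid lV ρX).rTensor M (TensorProduct.map ((ρX.flip x).lTensor V) (θ.flip m)
      ((y ⊗ₜ (1 : H)) ⊗ₜ (1 : B))) =
      TensorProduct.map (TensorProduct.map (ρX.flip x) LinearMap.id) (θ.flip m)
        (lV y ⊗ₜ (1 : B)) := by
    rw [TensorProduct.map_tmul, LinearMap.rTensor_tmul, ydBraid_lTensor hx, ydBraid_tmul_one]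
    rfl
  have e2 : ∀ u : H ⊗[k] (V ⊗[k] B), (evalMap f θ).lTensor X
      (TensorProduct.map (ρX.flip x) (TensorProduct.map LinearMap.id (θ.flip m)) u) =
      TensorProduct.map (ρX.flip x) (θ.flip m) ((evalMap f (LinearMap.mul k B)).lTensor H u) := by
    intro u
    have : evalMap f θ ∘ₗ TensorProduct.map LinearMap.id (θ.flip m) =
        θ.flip m ∘ₗ evalMap f (LinearMap.mul k B) :=
      LinearMap.ext (evalMap_lTensor hm f)
    rw [LinearMap.lTensor, LinearMap.lTensor, ← LinearMap.comp_apply, ← TensorProduct.map_comp,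
      this, ← LinearMap.comp_apply, ← TensorProduct.map_comp, LinearMap.id_comp,
      LinearMap.comp_id]
  have e3 : ∀ u : V ⊗[k] (H ⊗[k] B), evalMap f (coactAct ℓ ρX θ)
      (TensorProduct.map LinearMap.id (TensorProduct.map (ρX.flip x) (θ.flip m)) u) =
      TensorProduct.map (ρX.flip x) (θ.flip m)
        (evalMap f (coactAct ℓ (LinearMap.mul k H) (LinearMap.mul k B)) u) :=
    fun u => evalMap_lTensor (hx.coactAct hm) f u
  rw [e, e1, Q.assocHom_map hx (IsRepHom.id ρV) (hm.resAct (v := v)), e2, hf.braid, ← e3,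
    ← Q.assocHom_map (IsRepHom.id ρV) hx (hm.resAct (v := v))]
  rfl

theorem IsBraidedIntertwiner.evalMap_ydSlide {f : V →ₗ[k] B}
    (hf : IsBraidedIntertwiner Q v ℓ ρV lV f) (hV : IsRep ρV) (hX : IsRep ρX) (hθ : IsRep θ)
    (u : V ⊗[k] (X ⊗[k] M)) :
    (evalMap f θ).lTensor X (ydSlide Q lV ρV ρX (resAct v θ) u) =
      evalMap f (coactAct ℓ ρX θ) u := by
  obtain ⟨z, rfl⟩ := Q.assocHom_surjective hV hX (isRep_resAct (v := v) hθ) u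
  rw [ydSlide_assocHom Q hV hX (isRep_resAct hθ), hf.evalMap_ydBraid hX hθ]

/-- The convolution of braided intertwiners is compatible with the half-braiding of the tensor
product. -/
theorem evalMap_convMap_tensorBraid {f : V →ₗ[k] B} {g : W →ₗ[k] B}
    (hB : IsComoduleAlgebra Q v ℓ)
    (hf : IsBraidedIntertwiner Q v ℓ ρV lV f) (hg : IsBraidedIntertwiner Q v ℓ ρW lW g)
    (hV : IsYDModule Q ρV lV) (hW : IsYDModule Q ρW lW) (hX : IsRep ρX) (hθ : IsRep θ)
    (z : ((V ⊗[k] W) ⊗[k] X) ⊗[k] M) :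
    (evalMap (convMap Q v ρV ρW f g) θ).lTensor X (Q.assocHom ρX (Q.tensorAct ρV ρW)
      (resAct v θ) ((tensorBraid Q lV ρV lW ρW ρX).rTensor M z)) =
    evalMap (convMap Q v ρV ρW f g) (coactAct ℓ ρX θ)
      (Q.assocHom (Q.tensorAct ρV ρW) ρX (resAct v θ) z) := by
  have e1 : evalMap (convMap Q v ρV ρW f g) θ = evalMap f θ ∘ₗ (evalMap g θ).lTensor V ∘ₗ
      Q.assocHom ρV ρW (resAct v θ) := LinearMap.ext (evalMap_convMap hθ f g)
  have e2 : (evalMap g θ).lTensor X ∘ₗ ydSlide Q lW ρW ρX (resAct v θ) =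
      evalMap g (coactAct ℓ ρX θ) := LinearMap.ext (hg.evalMap_ydSlide hW.isRep hX hθ)
  have hg' := hg.isIntertwiner.isRepHom hθ
  have hMr := isRep_resAct (v := v) hθ
  rw [e1, LinearMap.lTensor_comp_apply, LinearMap.lTensor_comp_apply,
    ydSlide_ydSlide_tensor Q hX hMr hV hW,
    ← ydSlide_lTensor_lTensor Q hg' hV.isRep hX (Q.isRep_tensorAct hW.isRep hMr) hMr,
    hf.evalMap_ydSlide hV.isRep hX hθ, ← LinearMap.lTensor_comp_apply, e2,
    evalMap_convMap (isRep_coactAct hX hθ), resAct_coactAct hB]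

end Intertwiners

/-! ### Algebras of natural endomorphisms -/

section Universal

universe uk uH uB uV

variable {k : Type uk} {H : Type uH} {B : Type uB} [Field k] [Ring H] [Algebra k H] [Ring B]
  [Algebra k B]
variable {V : Type uV} [AddCommGroup V] [Module k V]

/-- The pairing `X ⊗ V → X ⊗ B`, `x ⊗ y ↦ X¹ · x ⊗ f(X² · y) v(X³)`. -/
def pairMap {X : Type*} [AddCommGroup X] [Module k X] (Q : QuasiBialgebra k H) (v : H →ₐ[k] B)
    (ρX : H →ₗ[k] X →ₗ[k] X) (ρV : H →ₗ[k] V →ₗ[k] V) (f : V →ₗ[k] B) :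
    X ⊗[k] V →ₗ[k] X ⊗[k] B :=
  (evalMap f (LinearMap.mul k B)).lTensor X ∘ₗ
    Q.assocHom ρX ρV (resAct v (LinearMap.mul k B)) ∘ₗ (TensorProduct.mk k (X ⊗[k] V) B).flip 1

/-- `V` with the intertwiner `E : V → B` behaves as the object of natural transformations of the
forgetful functor from `B`-modules to `H`-modules: an element of `V`, or of `X ⊗ V`, is determined
by the evaluations of its translates.  Multiplication, unit and coaction of `V` are the ones that
evaluation prescribes. -/
structure IsEndAlgebra (Q : QuasiBialgebra k H) (v : H →ₐ[k] B) (ℓ : B →ₐ[k] H ⊗[k] B)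
    (D : YDAlgebraData k H V) (E : V →ₗ[k] B) : Prop where
  isRep : IsRep D.act
  braided : IsBraidedIntertwiner Q v ℓ D.act D.coact E
  sep : ∀ y y' : V, (∀ h, E (D.act h y) = E (D.act h y')) → y = y'
  sep_tensor : ∀ {X : Type uH} [AddCommGroup X] [Module k X] (ρX : H →ₗ[k] X →ₗ[k] X), IsRep ρX →
    ∀ w w' : X ⊗[k] V, (∀ h, pairMap Q v ρX D.act E (Q.tensorAct ρX D.act h w) =
      pairMap Q v ρX D.act E (Q.tensorAct ρX D.act h w')) → w = w'
  compat : ∀ (h : H) (m : V), Q.tensorAct (LinearMap.mul k H) D.act h (D.coact m) =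
    ydBraid D.coact (LinearMap.mul k H) (Q.tensorAct D.act (LinearMap.mul k H) h (m ⊗ₜ[k] (1 : H)))
  act_mul : IsRepHom (Q.tensorAct D.act D.act) D.act D.mul
  eval_mul : ∀ u, E (D.mul u) = convMap Q v D.act D.act E E u
  act_one : ∀ h, D.act h D.one = Q.ε h • D.one
  eval_one : E D.one = 1

variable {Q : QuasiBialgebra k H} {v : H →ₐ[k] B} {ℓ : B →ₐ[k] H ⊗[k] B}
  {D : YDAlgebraData k H V} {E : V →ₗ[k] B}

theorem pairMap_ydBraid {X : Type*} [AddCommGroup X] [Module k X] {ρX : H →ₗ[k] X →ₗ[k] X}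
    {ρV : H →ₗ[k] V →ₗ[k] V} {lV : V →ₗ[k] H ⊗[k] V} {f : V →ₗ[k] B}
    (hf : IsBraidedIntertwiner Q v ℓ ρV lV f) (hX : IsRep ρX) (u : V ⊗[k] X) :
    pairMap Q v ρX ρV f (ydBraid lV ρX u) = evalMap f (coactAct ℓ ρX (LinearMap.mul k B))
      (Q.assocHom ρV ρX (resAct v (LinearMap.mul k B)) (u ⊗ₜ 1)) := by
  rw [← hf.evalMap_ydBraid hX IsRep.mulLeft]
  rfl

theorem IsEndAlgebra.eval_mul_tmul (hD : IsEndAlgebra Q v ℓ D E) {M : Type*} [AddCommGroup M]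
    [Module k M] {θ : B →ₗ[k] M →ₗ[k] M} (hθ : IsRep θ) (u : (V ⊗[k] V) ⊗[k] M) :
    evalMap E θ (D.mul.rTensor M u) =
      evalMap E θ ((evalMap E θ).lTensor V (Q.assocHom D.act D.act (resAct v θ) u)) := by
  rw [← evalMap_convMap hθ, evalMap_rTensor]
  congr 2
  exact LinearMap.ext hD.eval_mul

theorem IsEndAlgebra.one_mul (hD : IsEndAlgebra Q v ℓ D E) (a : V) :
    D.mul (D.one ⊗ₜ[k] a) = a := by
  refine hD.sep _ _ fun h => ?_
  have hr : IsRep (resAct v (LinearMap.mul k B)) := isRep_resAct IsRep.mulLeft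
  rw [← hD.act_mul, Q.tensorAct_counit_left hD.act_one, hD.eval_mul, convMap]
  simp [Q.assocHom_counit_left hD.isRep hr hD.act_one, hD.eval_one]

theorem IsEndAlgebra.mul_one (hD : IsEndAlgebra Q v ℓ D E) (a : V) :
    D.mul (a ⊗ₜ[k] D.one) = a := by
  refine hD.sep _ _ fun h => ?_
  have hr : IsRep (resAct v (LinearMap.mul k B)) := isRep_resAct IsRep.mulLeft
  rw [← hD.act_mul, Q.tensorAct_counit_right hD.act_one, hD.eval_mul, convMap]
  simp [Q.assocHom_counit_mid hD.isRep hr hD.act_one, hD.eval_one]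

theorem IsEndAlgebra.eval_mul_assoc (hD : IsEndAlgebra Q v ℓ D E) (u : (V ⊗[k] V) ⊗[k] V) :
    E (D.mul (D.mul.rTensor V u)) =
      E (D.mul (D.mul.lTensor V (Q.assocHom D.act D.act D.act u))) := by
  have hE : ∀ y, E y = evalMap E (LinearMap.mul k B) (y ⊗ₜ 1) := fun y => by simp
  have hB : IsRep (LinearMap.mul k B) := IsRep.mulLeft
  have hr : IsRep (resAct v (LinearMap.mul k B)) := isRep_resAct hB
  have hi := hD.braided.isIntertwiner
  have key := hD.eval_mul_tmul hB
  have key' : evalMap E (LinearMap.mul k B) ∘ₗ D.mul.rTensor B = evalMap E (LinearMap.mul k B) ∘ₗ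
    (evalMap E (LinearMap.mul k B)).lTensor V ∘ₗ
      Q.assocHom D.act D.act (resAct v (LinearMap.mul k B)) := LinearMap.ext key
  have e1 : D.mul (D.mul.rTensor V u) ⊗ₜ[k] (1 : B) =
    D.mul.rTensor B ((D.mul.rTensor V).rTensor B (u ⊗ₜ 1)) := rfl
  have e2 : D.mul (D.mul.lTensor V (Q.assocHom D.act D.act D.act u)) ⊗ₜ[k] (1 : B) =
    D.mul.rTensor B ((D.mul.lTensor V).rTensor B
      ((Q.assocHom D.act D.act D.act).rTensor B (u ⊗ₜ 1))) := rfl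
  rw [hE, hE, e1, e2, key, key, Q.assocHom_rr hD.act_mul, lTensor_rTensor_comm, key,
    Q.assocHom_l hi, Q.assocHom_rl hD.act_mul, ← LinearMap.lTensor_comp_apply V _
      (D.mul.rTensor B), key', LinearMap.lTensor_comp_apply,
    LinearMap.lTensor_comp_apply, Q.assocHom_pentagon hD.isRep hD.isRep hD.isRep hr]

theorem IsEndAlgebra.mul_assoc (hD : IsEndAlgebra Q v ℓ D E) (u : (V ⊗[k] V) ⊗[k] V) :
    D.mul (D.mul.rTensor V u) =
      D.mul (D.mul.lTensor V (Q.assocHom D.act D.act D.act u)) := by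
  refine hD.sep _ _ fun h => ?_
  rw [← hD.act_mul, ← hD.act_mul, ← Q.isRepHom_rTensor hD.act_mul,
    ← Q.isRepHom_lTensor hD.act_mul, ← Q.isRepHom_assocHom hD.isRep hD.isRep hD.isRep,
    hD.eval_mul_assoc]

theorem IsEndAlgebra.isRepHom_ydBraid (hD : IsEndAlgebra Q v ℓ D E) {X : Type*} [AddCommGroup X]
    [Module k X] {ρX : H →ₗ[k] X →ₗ[k] X} (hX : IsRep ρX) :
    IsRepHom (Q.tensorAct D.act ρX) (Q.tensorAct ρX D.act) (ydBraid D.coact ρX) :=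
  isRepHom_ydBraid_of_compat Q hX hD.compat

/-- To show that two elements of `X ⊗ V` that depend `H`-linearly on a parameter `p` agree, it
suffices to pair them with `E`. -/
theorem IsEndAlgebra.hom_ext (hD : IsEndAlgebra Q v ℓ D E) {P : Type*} [AddCommGroup P]
    [Module k P] {ρP : H →ₗ[k] P →ₗ[k] P} {X : Type uH} [AddCommGroup X] [Module k X]
    {ρX : H →ₗ[k] X →ₗ[k] X} (hX : IsRep ρX) {F G : P →ₗ[k] X ⊗[k] V}
    (hF : IsRepHom ρP (Q.tensorAct ρX D.act) F) (hG : IsRepHom ρP (Q.tensorAct ρX D.act) G)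
    (h : ∀ p, pairMap Q v ρX D.act E (F p) = pairMap Q v ρX D.act E (G p)) (p : P) :
    F p = G p :=
  hD.sep_tensor ρX hX _ _ fun g => by rw [← hF, ← hG, h]

theorem IsEndAlgebra.counit_coact (hD : IsEndAlgebra Q v ℓ D E) (hB : IsComoduleAlgebra Q v ℓ)
    (m : V) : TensorProduct.lid k V (LinearMap.rTensor V Q.ε.toLinearMap (D.coact m)) = m := by
  -- the trivial module `k`, on which `H` acts through the counit
  let ρk : H →ₗ[k] k →ₗ[k] k := LinearMap.mul k k ∘ₗ Q.ε.toLinearMap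
  have hk : IsRep ρk := ⟨fun x => by simp [ρk], fun a b x => by simp [ρk, _root_.mul_assoc]⟩
  have hk' : ∀ (x : k) (h : H), ρk h x = Q.ε h • x := fun x h => by simp [ρk]
  have hr : IsRep (resAct v (LinearMap.mul k B)) := isRep_resAct IsRep.mulLeft
  have e1 : ∀ m, LinearMap.rTensor V Q.ε.toLinearMap (D.coact m) =
      ydBraid D.coact ρk (m ⊗ₜ 1) := fun m => by
    rw [ydBraid_tmul]
    congr 2
    ext h
    simp [ρk]
  have e2 : ∀ m, TensorProduct.lid k V (ydBraid D.coact ρk (m ⊗ₜ 1)) =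
    TensorProduct.lid k V (LinearMap.rTensor V Q.ε.toLinearMap (D.coact m)) := fun m => by rw [e1]
  have lid_lin : ∀ (h : H) (w : k ⊗[k] V), TensorProduct.lid k V (Q.tensorAct ρk D.act h w) =
      D.act h (TensorProduct.lid k V w) := by
    intro h w
    refine TensorProduct.induction_on w (by simp) (fun x y => ?_) (fun x y hx hy => by
      simp only [map_add, hx, hy])
    rw [Q.tensorAct_counit_left (hk' x)]
    simp
  have eval : ∀ m, E (TensorProduct.lid k V (ydBraid D.coact ρk (m ⊗ₜ 1))) = E m := by
    intro m
    have h1 := pairMap_ydBraid hD.braided hk (m ⊗ₜ[k] (1 : k))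
    rw [Q.assocHom_counit_mid hD.isRep hr (hk' 1)] at h1
    have h2 : ∀ w : k ⊗[k] V, TensorProduct.lid k B (pairMap Q v ρk D.act E w) =
        E (TensorProduct.lid k V w) := by
      intro w
      refine TensorProduct.induction_on w (by simp) (fun x y => ?_) (fun x y hx hy => by
        simp only [map_add, hx, hy])
      simp [pairMap, Q.assocHom_counit_left hD.isRep hr (hk' x)]
    rw [← h2, h1, evalMap_tmul]
    have h3 : ∀ t : H ⊗[k] B, TensorProduct.map₂ ρk (LinearMap.mul k B) t (1 ⊗ₜ 1) =
        Algebra.TensorProduct.map Q.ε (AlgHom.id k B) t := by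
      intro t
      refine TensorProduct.induction_on t (by simp) (fun x y => ?_) (fun x y hx hy => by
        simp only [map_add, LinearMap.add_apply, hx, hy])
      simp [TensorProduct.map₂_apply_tmul, ρk]
    rw [coactAct, LinearMap.comp_apply, AlgHom.toLinearMap_apply, h3, hB.counit,
      TensorProduct.lid_tmul, one_smul]
  refine hD.sep _ _ fun h => ?_
  have h4 : (D.act h m) ⊗ₜ[k] (1 : k) = Q.tensorAct D.act ρk h (m ⊗ₜ 1) :=
    (Q.tensorAct_counit_right (hk' 1) h m).symm
  rw [← e2, ← lid_lin, ← hD.isRepHom_ydBraid hk, ← h4, eval]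

theorem IsEndAlgebra.hexagon (hD : IsEndAlgebra Q v ℓ D E) (hB : IsComoduleAlgebra Q v ℓ)
    {X Y : Type uH} [AddCommGroup X] [Module k X] [AddCommGroup Y] [Module k Y]
    {ρX : H →ₗ[k] X →ₗ[k] X} {ρY : H →ₗ[k] Y →ₗ[k] Y} (hX : IsRep ρX) (hY : IsRep ρY)
    (z : (V ⊗[k] X) ⊗[k] Y) :
    (ydBraid D.coact ρY).lTensor X (Q.assocHom ρX D.act ρY ((ydBraid D.coact ρX).rTensor Y z)) =
      Q.assocHom ρX ρY D.act
        (ydBraid D.coact (Q.tensorAct ρX ρY) (Q.assocHom D.act ρX ρY z)) := by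
  have hV := hD.isRep
  have hXY := Q.isRep_tensorAct hX hY
  have hBr : IsRep (LinearMap.mul k B) := IsRep.mulLeft
  have hr : IsRep (resAct v (LinearMap.mul k B)) := isRep_resAct hBr
  have cX := hD.isRepHom_ydBraid hX
  have cY := hD.isRepHom_ydBraid hY
  have cXY := hD.isRepHom_ydBraid hXY
  have hi := hD.braided.isIntertwiner
  -- the pairing on `(X ⊗ Y) ⊗ V`, in terms of the factors
  have pair : ∀ (w : (X ⊗[k] Y) ⊗[k] V),
      Q.assocHom ρX ρY (resAct v (LinearMap.mul k B))
        (pairMap Q v (Q.tensorAct ρX ρY) D.act E w) =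
      ((evalMap E (LinearMap.mul k B)).lTensor Y).lTensor X
        ((Q.assocHom ρY D.act (resAct v (LinearMap.mul k B))).lTensor X
          (Q.assocHom ρX (Q.tensorAct ρY D.act) (resAct v (LinearMap.mul k B))
            ((Q.assocHom ρX ρY D.act w) ⊗ₜ 1))) := by
    intro w
    have e : (Q.assocHom ρX ρY D.act w) ⊗ₜ[k] (1 : B) =
      (Q.assocHom ρX ρY D.act).rTensor B (w ⊗ₜ 1) := rfl
    rw [e, Q.assocHom_pentagon hX hY hV hr, ← Q.assocHom_l hi]
    rfl
  refine Function.LeftInverse.injective (Q.assocHom_assocInv hX hY hV) ?_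
  refine hD.hom_ext (ρP := Q.tensorAct (Q.tensorAct D.act ρX) ρY) hXY
    (F := Q.assocInv ρX ρY D.act ∘ₗ (ydBraid D.coact ρY).lTensor X ∘ₗ Q.assocHom ρX D.act ρY ∘ₗ
      (ydBraid D.coact ρX).rTensor Y)
    (G := Q.assocInv ρX ρY D.act ∘ₗ Q.assocHom ρX ρY D.act ∘ₗ
      ydBraid D.coact (Q.tensorAct ρX ρY) ∘ₗ Q.assocHom D.act ρX ρY) ?_ ?_ (fun z => ?_) z
  · exact (Q.isRepHom_assocInv hX hY hV).comp ((Q.isRepHom_lTensor cY).comp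
      ((Q.isRepHom_assocHom hX hV hY).comp (Q.isRepHom_rTensor cX)))
  · exact (Q.isRepHom_assocInv hX hY hV).comp ((Q.isRepHom_assocHom hX hY hV).comp
      (cXY.comp (Q.isRepHom_assocHom hV hX hY)))
  refine Q.assocHom_injective hX hY hr ?_
  simp only [LinearMap.comp_apply]
  rw [pair, Q.assocHom_assocInv hX hY hV, Q.assocInv_assocHom hX hY hV,
    pairMap_ydBraid hD.braided hXY]
  have e1 : ((ydBraid D.coact ρY).lTensor X (Q.assocHom ρX D.act ρY
      ((ydBraid D.coact ρX).rTensor Y z))) ⊗ₜ[k] (1 : B) =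
      ((ydBraid D.coact ρY).lTensor X).rTensor B ((Q.assocHom ρX D.act ρY).rTensor B
        (((ydBraid D.coact ρX).rTensor Y).rTensor B (z ⊗ₜ 1))) := rfl
  have e2 : (evalMap E (LinearMap.mul k B)).lTensor Y ∘ₗ
      Q.assocHom ρY D.act (resAct v (LinearMap.mul k B)) ∘ₗ (ydBraid D.coact ρY).rTensor B =
      evalMap E (coactAct ℓ ρY (LinearMap.mul k B)) ∘ₗ
        Q.assocHom D.act ρY (resAct v (LinearMap.mul k B)) :=
    LinearMap.ext (hD.braided.evalMap_ydBraid hY hBr)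
  have e3 : Q.assocHom D.act ρX ρY z ⊗ₜ[k] (1 : B) =
    (Q.assocHom D.act ρX ρY).rTensor B (z ⊗ₜ 1) := rfl
  have hYB := isRep_coactAct (ℓ := ℓ) hY hBr
  have hYr : resAct v (coactAct ℓ ρY (LinearMap.mul k B)) =
    Q.tensorAct ρY (resAct v (LinearMap.mul k B)) := resAct_coactAct hB
  rw [e1, Q.assocHom_rl cY, ← LinearMap.lTensor_comp_apply, ← LinearMap.lTensor_comp_apply,
    LinearMap.comp_assoc, e2, LinearMap.lTensor_comp_apply, Q.assocHom_pentagon hX hV hY hr, Q.assocHom_rr cX, ← hYr,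
    hD.braided.evalMap_ydBraid hX hYB, hYr, e3, ← Q.assocHom_pentagon hV hX hY hr,
    evalMap_lTensor (isRepHom_assocHom_coactAct hB hX hY hBr)]

theorem IsEndAlgebra.isYDModule (hD : IsEndAlgebra Q v ℓ D E) (hB : IsComoduleAlgebra Q v ℓ) :
    IsYDModule Q D.act D.coact where
  one_act := hD.isRep.one
  mul_act := hD.isRep.mul
  quasi_coassoc m := by
    have := hD.hexagon hB (IsRep.mulLeft (k := k) (R := H)) IsRep.mulLeft
      ((m ⊗ₜ[k] (1 : H)) ⊗ₜ[k] (1 : H))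
    rwa [LinearMap.rTensor_tmul, ydBraid_tmul_one] at this
  counit_coact := hD.counit_coact hB
  compat := hD.compat

theorem IsEndAlgebra.coact_one (hD : IsEndAlgebra Q v ℓ D E) :
    D.coact D.one = (1 : H) ⊗ₜ[k] D.one := by
  have hH : IsRep (LinearMap.mul k H) := IsRep.mulLeft
  have hr : IsRep (resAct v (LinearMap.mul k B)) := isRep_resAct IsRep.mulLeft
  refine hD.sep_tensor (LinearMap.mul k H) hH _ _ fun h => ?_
  rw [← ydBraid_tmul_one (lV := D.coact) D.one, ← hD.isRepHom_ydBraid hH,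
    Q.tensorAct_counit_left hD.act_one, Q.tensorAct_counit_right hD.act_one,
    pairMap_ydBraid hD.braided hH, Q.assocHom_counit_left hH hr hD.act_one, evalMap_tmul,
    hD.eval_one, (isRep_coactAct hH IsRep.mulLeft).one]
  simp [pairMap, Q.assocHom_counit_mid hH hr hD.act_one, hD.eval_one]

theorem IsEndAlgebra.coact_mul (hD : IsEndAlgebra Q v ℓ D E) (hB : IsComoduleAlgebra Q v ℓ)
    (u : V ⊗[k] V) : D.coact (D.mul u) =
      LinearMap.lTensor H D.mul (tensorCoact Q D.act D.coact D.act D.coact u) := by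
  have hH : IsRep (LinearMap.mul k H) := IsRep.mulLeft
  have hBr : IsRep (LinearMap.mul k B) := IsRep.mulLeft
  have hr : IsRep (resAct v (LinearMap.mul k B)) := isRep_resAct hBr
  have hV := hD.isYDModule hB
  have key := hD.hom_ext (ρP := Q.tensorAct (Q.tensorAct D.act D.act) (LinearMap.mul k H)) hH
    (F := ydBraid D.coact (LinearMap.mul k H) ∘ₗ D.mul.rTensor H)
    (G := D.mul.lTensor H ∘ₗ tensorBraid Q D.coact D.act D.coact D.act (LinearMap.mul k H))
    ((hD.isRepHom_ydBraid hH).comp (Q.isRepHom_rTensor hD.act_mul))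
    ((Q.isRepHom_lTensor hD.act_mul).comp (isRepHom_tensorBraid Q hH hV hV))
    (fun y => ?_) (u ⊗ₜ 1)
  · rw [LinearMap.comp_apply, LinearMap.comp_apply, LinearMap.rTensor_tmul, ydBraid_tmul_one,
      ← tensorCoact_eq] at key
    exact key
  · have e1 : D.mul.rTensor H y ⊗ₜ[k] (1 : B) = (D.mul.rTensor H).rTensor B (y ⊗ₜ 1) := rfl
    have e2 : ∀ w : H ⊗[k] (V ⊗[k] V), pairMap Q v (LinearMap.mul k H) D.act E
        (D.mul.lTensor H w) = (evalMap (convMap Q v D.act D.act E E) (LinearMap.mul k B)).lTensor H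
        (Q.assocHom (LinearMap.mul k H) (Q.tensorAct D.act D.act)
          (resAct v (LinearMap.mul k B)) (w ⊗ₜ 1)) := by
      intro w
      have e3 : evalMap (convMap Q v D.act D.act E E) (LinearMap.mul k B) =
          evalMap E (LinearMap.mul k B) ∘ₗ D.mul.rTensor B := by
        refine LinearMap.ext fun u => ?_
        rw [LinearMap.comp_apply, evalMap_rTensor]
        congr 2
        exact (LinearMap.ext hD.eval_mul).symm
      rw [e3, LinearMap.lTensor_comp_apply, ← Q.assocHom_rl hD.act_mul]
      rfl
    have e4 := evalMap_convMap_tensorBraid hB hD.braided hD.braided hV hV hH hBr (y ⊗ₜ[k] (1 : B))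
    rw [LinearMap.comp_apply, LinearMap.comp_apply, pairMap_ydBraid hD.braided hH, e2, e1,
      Q.assocHom_rr hD.act_mul, evalMap_rTensor]
    rw [LinearMap.rTensor_tmul] at e4
    rw [e4]
    congr 2
    exact LinearMap.ext hD.eval_mul

/-- An algebra of natural endomorphisms is a Yetter–Drinfeld algebra: each axiom holds after
evaluation, where it becomes an identity for the comodule algebra `B`. -/
theorem IsEndAlgebra.isYDAlgebra (hD : IsEndAlgebra Q v ℓ D E) (hB : IsComoduleAlgebra Q v ℓ) :
    D.IsYDAlgebra Q where
  isYDModule := hD.isYDModule hB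
  one_mul := hD.one_mul
  mul_one := hD.mul_one
  mul_assoc a a' a'' := hD.mul_assoc ((a ⊗ₜ a') ⊗ₜ a'')
  act_mul h a a' := (hD.act_mul h (a ⊗ₜ a')).symm
  act_one := hD.act_one
  coact_one := hD.coact_one
  coact_mul a a' := hD.coact_mul hB (a ⊗ₜ a')

end Universal

/-! ### The smash product as a comodule algebra -/

section Smash

variable {k H A : Type*} [Field k] [Ring H] [Algebra k H] [AddCommGroup A] [Module k A]
variable {M M' X : Type*} [AddCommGroup M] [Module k M] [AddCommGroup M'] [Module k M']
  [AddCommGroup X] [Module k X]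
variable {ρM : H →ₗ[k] M →ₗ[k] M} {ρM' : H →ₗ[k] M' →ₗ[k] M'} {ρX : H →ₗ[k] X →ₗ[k] X}

namespace YDAlgebraData

variable (Q : QuasiBialgebra k H) (D : YDAlgebraData k H A)

/-- The action `A ⊗ (A ⊗ M) → A ⊗ M` of the algebra `A` on the free module `A ⊗ M`. -/
def freeAct (ρM : H →ₗ[k] M →ₗ[k] M) : A ⊗[k] (A ⊗[k] M) →ₗ[k] A ⊗[k] M :=
  D.mul.rTensor M ∘ₗ Q.assocInv D.act D.act ρM

variable {Q D}

namespace IsYDAlgebra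

theorem isRep (hD : D.IsYDAlgebra Q) : IsRep D.act := hD.isYDModule.isRep

theorem isRepHom_mul (hD : D.IsYDAlgebra Q) : IsRepHom (Q.tensorAct D.act D.act) D.act D.mul := by
  intro h u
  refine TensorProduct.induction_on u (by simp) (fun a b => (hD.act_mul h a b).symm)
    (fun x y hx hy => by simp only [map_add, hx, hy])

theorem mul_assoc_apply (hD : D.IsYDAlgebra Q) (u : (A ⊗[k] A) ⊗[k] A) :
    D.mul (D.mul.rTensor A u) = D.mul (D.mul.lTensor A (Q.assocHom D.act D.act D.act u)) := by
  refine TensorProduct.induction_on u (by simp) (fun u c => ?_)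
    (fun x y hx hy => by simp only [map_add, hx, hy])
  refine TensorProduct.induction_on u (by simp) (fun a b => hD.mul_assoc a b c)
    (fun x y hx hy => by simp only [TensorProduct.add_tmul, map_add, hx, hy])

theorem ydBraid_mul (hD : D.IsYDAlgebra Q) (hX : IsRep ρX) (u : (A ⊗[k] A) ⊗[k] X) :
    ydBraid D.coact ρX (D.mul.rTensor X u) =
      D.mul.lTensor X (tensorBraid Q D.coact D.act D.coact D.act ρX u) := by
  rw [← ydBraid_tensorCoact Q hD.isRep hD.isRep hX]
  refine ydBraid_rTensor (fun w => ?_) u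
  refine TensorProduct.induction_on w (by simp) (fun a b => hD.coact_mul a b)
    (fun x y hx hy => by simp only [map_add, hx, hy])

theorem freeAct_assocHom (hD : D.IsYDAlgebra Q) (hM : IsRep ρM) (z : (A ⊗[k] A) ⊗[k] M) :
    D.freeAct Q ρM (Q.assocHom D.act D.act ρM z) = D.mul.rTensor M z := by
  rw [freeAct, LinearMap.comp_apply, Q.assocInv_assocHom hD.isRep hD.isRep hM]

theorem isRepHom_freeAct (hD : D.IsYDAlgebra Q) (hM : IsRep ρM) :
    IsRepHom (Q.tensorAct D.act (Q.tensorAct D.act ρM)) (Q.tensorAct D.act ρM)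
      (D.freeAct Q ρM) :=
  (Q.isRepHom_rTensor hD.isRepHom_mul).comp (Q.isRepHom_assocInv hD.isRep hD.isRep hM)

theorem freeAct_lTensor (hD : D.IsYDAlgebra Q) (hM : IsRep ρM) (hM' : IsRep ρM') {f : M →ₗ[k] M'}
    (hf : IsRepHom ρM ρM' f) (u : A ⊗[k] (A ⊗[k] M)) :
    D.freeAct Q ρM' ((f.lTensor A).lTensor A u) = f.lTensor A (D.freeAct Q ρM u) := by
  obtain ⟨z, rfl⟩ := Q.assocHom_surjective hD.isRep hD.isRep hM u
  rw [← Q.assocHom_l hf, hD.freeAct_assocHom hM', hD.freeAct_assocHom hM, lTensor_rTensor_comm]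

theorem freeAct_mul (hD : D.IsYDAlgebra Q) (hM : IsRep ρM) (u : (A ⊗[k] A) ⊗[k] (A ⊗[k] M)) :
    D.freeAct Q ρM (D.mul.rTensor (A ⊗[k] M) u) =
      D.freeAct Q ρM ((D.freeAct Q ρM).lTensor A
        (Q.assocHom D.act D.act (Q.tensorAct D.act ρM) u)) := by
  have hA := hD.isRep
  obtain ⟨w, rfl⟩ := Q.assocHom_surjective (Q.isRep_tensorAct hA hA) hA hM u
  have e : D.freeAct Q ρM ∘ₗ Q.assocHom D.act D.act ρM = D.mul.rTensor M :=
    LinearMap.ext (hD.freeAct_assocHom hM)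
  have e2 : D.mul ∘ₗ D.mul.rTensor A =
      D.mul ∘ₗ D.mul.lTensor A ∘ₗ Q.assocHom D.act D.act D.act := LinearMap.ext hD.mul_assoc_apply
  rw [← Q.assocHom_rr hD.isRepHom_mul, hD.freeAct_assocHom hM,
    ← Q.assocHom_pentagon hA hA hA hM, ← LinearMap.lTensor_comp_apply, e,
    ← Q.assocHom_rl hD.isRepHom_mul, hD.freeAct_assocHom hM, ← LinearMap.rTensor_comp_apply, e2]
  simp only [← LinearMap.rTensor_comp_apply]

theorem freeAct_freeAct (hD : D.IsYDAlgebra Q) (hM : IsRep ρM)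
    (u : A ⊗[k] (A ⊗[k] (A ⊗[k] M))) :
    D.freeAct Q ρM (D.freeAct Q (Q.tensorAct D.act ρM) u) =
      D.freeAct Q ρM ((D.freeAct Q ρM).lTensor A u) := by
  have hA := hD.isRep
  have hAM := Q.isRep_tensorAct hA hM
  obtain ⟨w, rfl⟩ := Q.assocHom_surjective hA hA hAM u
  rw [hD.freeAct_assocHom hAM, hD.freeAct_mul hM]

theorem freeAct_one_left (hD : D.IsYDAlgebra Q) (hM : IsRep ρM) (u : A ⊗[k] M) :
    D.freeAct Q ρM (D.one ⊗ₜ u) = u := by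
  refine TensorProduct.induction_on u (by simp) (fun a m => ?_)
    (fun x y hx hy => by simp only [TensorProduct.tmul_add, map_add, hx, hy])
  rw [← Q.assocHom_counit_left hD.isRep hM hD.act_one, hD.freeAct_assocHom hM,
    LinearMap.rTensor_tmul, hD.one_mul]

theorem freeAct_one_right (hD : D.IsYDAlgebra Q) (hM : IsRep ρM) (a : A) (m : M) :
    D.freeAct Q ρM (a ⊗ₜ (D.one ⊗ₜ m)) = a ⊗ₜ m := by
  rw [← Q.assocHom_counit_mid hD.isRep hM hD.act_one, hD.freeAct_assocHom hM,
    LinearMap.rTensor_tmul, hD.mul_one]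

/-- Moving `A` past `X` is multiplicative. -/
theorem ydSlide_freeAct (hD : D.IsYDAlgebra Q) (hX : IsRep ρX) (hM : IsRep ρM)
    (u : A ⊗[k] (A ⊗[k] (X ⊗[k] M))) :
    ydSlide Q D.coact D.act ρX ρM (D.freeAct Q (Q.tensorAct ρX ρM) u) =
      (D.freeAct Q ρM).lTensor X (ydSlide Q D.coact D.act ρX (Q.tensorAct D.act ρM)
        ((ydSlide Q D.coact D.act ρX ρM).lTensor A u)) := by
  have hA := hD.isRep
  have hXM := Q.isRep_tensorAct hX hM
  obtain ⟨u, rfl⟩ := Q.assocHom_surjective hA hA hXM u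
  obtain ⟨z, rfl⟩ := Q.assocHom_surjective (Q.isRep_tensorAct hA hA) hX hM u
  have e : D.freeAct Q ρM ∘ₗ Q.assocHom D.act D.act ρM = D.mul.rTensor M :=
    LinearMap.ext (hD.freeAct_assocHom hM)
  have e2 : ydBraid D.coact ρX ∘ₗ D.mul.rTensor X =
      D.mul.lTensor X ∘ₗ tensorBraid Q D.coact D.act D.coact D.act ρX :=
    LinearMap.ext (hD.ydBraid_mul hX)
  rw [hD.freeAct_assocHom hXM, ← Q.assocHom_rr hD.isRepHom_mul, ydSlide_assocHom Q hA hX hM,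
    ← ydSlide_ydSlide_tensor Q hX hM hD.isYDModule hD.isYDModule, ← LinearMap.lTensor_comp_apply,
    e, ← Q.assocHom_rl hD.isRepHom_mul, ← LinearMap.rTensor_comp_apply, e2,
    LinearMap.rTensor_comp_apply]

/-! The algebra structure on `A ⊗ H`. -/

theorem smashMul_tmul (a : A) (h : H) (w : A ⊗[k] H) :
    D.smashMul Q ((a ⊗ₜ h) ⊗ₜ w) = D.freeAct Q (LinearMap.mul k H)
      (a ⊗ₜ Q.tensorAct D.act (LinearMap.mul k H) h w) := rfl

theorem smashMul_eq (u w : A ⊗[k] H) :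
    D.smashMul Q (u ⊗ₜ w) = D.freeAct Q (LinearMap.mul k H)
      (((Q.tensorAct D.act (LinearMap.mul k H)).flip w).lTensor A u) := by
  refine TensorProduct.induction_on u (by simp) (fun a h => ?_)
    (fun x y hx hy => by simp only [TensorProduct.add_tmul, map_add, hx, hy])
  rfl

theorem smashMul_freeAct (hD : D.IsYDAlgebra Q) (u : A ⊗[k] (A ⊗[k] H)) (w : A ⊗[k] H) :
    D.smashMul Q (D.freeAct Q (LinearMap.mul k H) u ⊗ₜ w) = D.freeAct Q (LinearMap.mul k H)
      (((D.smashMul Q) ∘ₗ (TensorProduct.mk k _ _).flip w).lTensor A u) := by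
  have hH : IsRep (LinearMap.mul k H) := IsRep.mulLeft
  have hAH := Q.isRep_tensorAct hD.isRep hH
  have ho := isRepHom_apply_right hAH w
  have e : (D.smashMul Q) ∘ₗ (TensorProduct.mk k _ _).flip w =
      D.freeAct Q (LinearMap.mul k H) ∘ₗ
        ((Q.tensorAct D.act (LinearMap.mul k H)).flip w).lTensor A :=
    LinearMap.ext fun u => smashMul_eq u w
  rw [e, smashMul_eq, ← hD.freeAct_lTensor hH hAH ho, hD.freeAct_freeAct hH,
    LinearMap.lTensor_comp_apply]

theorem smashMul_act (hD : D.IsYDAlgebra Q) (h : H) (u w : A ⊗[k] H) :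
    D.smashMul Q (Q.tensorAct D.act (LinearMap.mul k H) h u ⊗ₜ w) =
      Q.tensorAct D.act (LinearMap.mul k H) h (D.smashMul Q (u ⊗ₜ w)) := by
  have hH : IsRep (LinearMap.mul k H) := IsRep.mulLeft
  have hAH := Q.isRep_tensorAct hD.isRep hH
  have ho := isRepHom_apply_right hAH w
  rw [smashMul_eq, smashMul_eq, Q.isRepHom_lTensor ho, hD.isRepHom_freeAct hH]

theorem smash_one_mul (hD : D.IsYDAlgebra Q) (u : A ⊗[k] H) :
    D.smashMul Q ((D.one ⊗ₜ 1) ⊗ₜ u) = u := by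
  rw [smashMul_tmul, (Q.isRep_tensorAct hD.isRep IsRep.mulLeft).one,
    hD.freeAct_one_left IsRep.mulLeft]

theorem smash_mul_one (hD : D.IsYDAlgebra Q) (u : A ⊗[k] H) :
    D.smashMul Q (u ⊗ₜ (D.one ⊗ₜ 1)) = u := by
  refine TensorProduct.induction_on u (by simp) (fun a h => ?_)
    (fun x y hx hy => by simp only [TensorProduct.add_tmul, map_add, hx, hy])
  rw [smashMul_tmul, Q.tensorAct_counit_left hD.act_one, hD.freeAct_one_right IsRep.mulLeft]
  simp

theorem smash_mul_assoc (hD : D.IsYDAlgebra Q) (u w x : A ⊗[k] H) :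
    D.smashMul Q (D.smashMul Q (u ⊗ₜ w) ⊗ₜ x) = D.smashMul Q (u ⊗ₜ D.smashMul Q (w ⊗ₜ x)) := by
  refine TensorProduct.induction_on u (by simp) (fun a h => ?_)
    (fun x y hx hy => by simp only [TensorProduct.add_tmul, map_add, hx, hy])
  rw [smashMul_tmul, hD.smashMul_freeAct, smashMul_tmul, LinearMap.lTensor_tmul,
    LinearMap.comp_apply, LinearMap.flip_apply, TensorProduct.mk_apply, hD.smashMul_act]

/-- The ring structure of the smash product `A # H` on `A ⊗ H`. -/
@[reducible]
def smashRing (hD : D.IsYDAlgebra Q) : Ring (A ⊗[k] H) :=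
  { (inferInstance : AddCommGroup (A ⊗[k] H)) with
    mul := fun u w => D.smashMul Q (u ⊗ₜ w)
    one := D.one ⊗ₜ 1
    left_distrib := fun u w x => by
      change D.smashMul Q _ = D.smashMul Q _ + D.smashMul Q _
      rw [TensorProduct.tmul_add, map_add]
    right_distrib := fun u w x => by
      change D.smashMul Q _ = D.smashMul Q _ + D.smashMul Q _
      rw [TensorProduct.add_tmul, map_add]
    zero_mul := fun u => by
      change D.smashMul Q _ = 0
      rw [TensorProduct.zero_tmul, map_zero]
    mul_zero := fun u => by
      change D.smashMul Q _ = 0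
      rw [TensorProduct.tmul_zero, map_zero]
    mul_assoc := hD.smash_mul_assoc
    one_mul := hD.smash_one_mul
    mul_one := hD.smash_mul_one }

/-- The `k`-algebra structure of the smash product. -/
@[reducible]
def smashAlgebra (hD : D.IsYDAlgebra Q) :
    letI := hD.smashRing
    Algebra k (A ⊗[k] H) :=
  letI := hD.smashRing
  Algebra.ofModule
    (fun r u w => by
      change D.smashMul Q _ = r • D.smashMul Q _
      rw [← TensorProduct.smul_tmul', map_smul])
    (fun r u w => by
      change D.smashMul Q _ = r • D.smashMul Q _
      rw [TensorProduct.tmul_smul, map_smul])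

end IsYDAlgebra

end YDAlgebraData

end Smash

/-- Left multiplication on a tensor product of algebras, factor by factor. -/
theorem map₂_mul_eq_mul {k R R' : Type*} [Field k] [Ring R] [Algebra k R] [Ring R'] [Algebra k R']
    (s t : R ⊗[k] R') :
    TensorProduct.map₂ (LinearMap.mul k R) (LinearMap.mul k R') s t = s * t := by
  refine TensorProduct.induction_on s (by simp) (fun a b => ?_) (fun x y hx hy => by
    simp only [add_mul, map_add, LinearMap.add_apply, hx, hy])
  refine TensorProduct.induction_on t (by simp) (fun c d => ?_) (fun x y hx hy => by
    simp only [mul_add, map_add, hx, hy])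
  simp [TensorProduct.map₂_apply_tmul]

/-! Products in `H ⊗ (H ⊗ B)`, one leg at a time. -/

section Legs

variable {k H B : Type*} [Field k] [Ring H] [Algebra k H] [Ring B] [Algebra k B]

theorem mul_tmul_tmul (x y : H) (b : B) (w : H ⊗[k] (H ⊗[k] B)) :
    w * (x ⊗ₜ (y ⊗ₜ b)) = ((LinearMap.mul k H).flip x).rTensor _
      ((((LinearMap.mul k H).flip y).rTensor _).lTensor _
        ((((LinearMap.mul k B).flip b).lTensor H).lTensor H w)) := by
  refine TensorProduct.induction_on w (by simp) (fun g w => ?_)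
    (fun x y hx hy => by simp only [map_add, add_mul, hx, hy])
  refine TensorProduct.induction_on w (by simp) (fun g' w => ?_)
    (fun x y hx hy => by simp only [map_add, add_mul, TensorProduct.tmul_add, hx, hy])
  simp

theorem mul_map_of_mul_tmul (v : H →ₐ[k] B) (F : H ⊗[k] (H ⊗[k] H) →ₗ[k] H ⊗[k] (H ⊗[k] B))
    (hF : ∀ s x y z, F s * (x ⊗ₜ (y ⊗ₜ v z)) = F (s * (x ⊗ₜ (y ⊗ₜ z))))
    (s t : H ⊗[k] (H ⊗[k] H)) :
    F s * Algebra.TensorProduct.map (AlgHom.id k H)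
      (Algebra.TensorProduct.map (AlgHom.id k H) v) t = F (s * t) := by
  refine TensorProduct.induction_on t (by simp) (fun x t => ?_)
    (fun x y hx hy => by simp only [map_add, mul_add, hx, hy])
  refine TensorProduct.induction_on t (by simp) (fun y z => ?_)
    (fun x y hx hy => by simp only [map_add, mul_add, TensorProduct.tmul_add, hx, hy])
  exact hF s x y z

theorem map_mul_eq_map₂ (v : H →ₐ[k] B) (t : H ⊗[k] (H ⊗[k] H)) (w : H ⊗[k] (H ⊗[k] B)) :
    Algebra.TensorProduct.map (AlgHom.id k H) (Algebra.TensorProduct.map (AlgHom.id k H) v) t * w =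
      TensorProduct.map₂ (LinearMap.mul k H)
        (TensorProduct.map₂ (LinearMap.mul k H) (resAct v (LinearMap.mul k B))) t w := by
  refine TensorProduct.induction_on t (by simp) (fun x t => ?_)
    (fun x y hx hy => by simp only [map_add, add_mul, LinearMap.add_apply, hx, hy])
  refine TensorProduct.induction_on t (by simp) (fun y z => ?_)
    (fun x y hx hy => by
      simp only [map_add, add_mul, TensorProduct.tmul_add, LinearMap.add_apply, hx, hy])
  refine TensorProduct.induction_on w (by simp) (fun g w => ?_)
    (fun x y hx hy => by simp only [map_add, mul_add, hx, hy])
  refine TensorProduct.induction_on w (by simp) (fun g' w => ?_)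
    (fun x y hx hy => by simp only [map_add, mul_add, TensorProduct.tmul_add, hx, hy])
  simp [TensorProduct.map₂_apply_tmul, resAct]

end Legs

section SmashComodule

variable {k H A : Type*} [Field k] [Ring H] [Algebra k H] [AddCommGroup A] [Module k A]

namespace YDAlgebraData

namespace IsYDAlgebra

variable {Q : QuasiBialgebra k H} {D : YDAlgebraData k H A}

theorem smashCoact_eq (u : A ⊗[k] H) : D.smashCoact Q u =
    ydSlide Q D.coact D.act (LinearMap.mul k H) (LinearMap.mul k H)
      (Q.Δ.toLinearMap.lTensor A u) := rfl

theorem isRepHom_comul :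
    IsRepHom (LinearMap.mul k H) (Q.tensorAct (LinearMap.mul k H) (LinearMap.mul k H))
      Q.Δ.toLinearMap := by
  intro h g
  rw [QuasiBialgebra.tensorAct, LinearMap.comp_apply, map₂_mul_eq_mul]
  simp

theorem isRepHom_smashCoact (hD : D.IsYDAlgebra Q) :
    IsRepHom (Q.tensorAct D.act (LinearMap.mul k H))
      (Q.tensorAct (LinearMap.mul k H) (Q.tensorAct D.act (LinearMap.mul k H)))
      (D.smashCoact Q) :=
  (isRepHom_ydSlide Q IsRep.mulLeft IsRep.mulLeft hD.isYDModule).comp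
    (Q.isRepHom_lTensor isRepHom_comul)

/-- Multiplication by `λ(a # h)` on `H ⊗ (A # H)`: first `h` acts, then `a` is moved past `H`. -/
theorem mul_smashCoact (hD : D.IsYDAlgebra Q) (a : A) (h : H) (w : H ⊗[k] (A ⊗[k] H)) :
    TensorProduct.map₂ (LinearMap.mul k H) (TensorProduct.curry (D.smashMul Q))
      (D.smashCoact Q (a ⊗ₜ h)) w =
    (D.freeAct Q (LinearMap.mul k H)).lTensor H (ydSlide Q D.coact D.act (LinearMap.mul k H)
      (Q.tensorAct D.act (LinearMap.mul k H)) (a ⊗ₜ Q.tensorAct (LinearMap.mul k H)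
        (Q.tensorAct D.act (LinearMap.mul k H)) h w)) := by
  have hH : IsRep (LinearMap.mul k H) := IsRep.mulLeft
  have hAH := Q.isRep_tensorAct hD.isRep hH
  refine TensorProduct.induction_on w (by simp) (fun x b => ?_)
    (fun x y hx hy => by simp only [TensorProduct.tmul_add, map_add, hx, hy])
  have ho := isRepHom_apply_right hAH b
  have hx := isRepHom_apply_right hH x
  -- right multiplication by `x ⊗ b`
  have e1 : ∀ t : H ⊗[k] (A ⊗[k] H), TensorProduct.map₂ (LinearMap.mul k H)
      (TensorProduct.curry (D.smashMul Q)) t (x ⊗ₜ b) =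
      (D.freeAct Q (LinearMap.mul k H)).lTensor H
        (((LinearMap.mul k H).flip x).rTensor _
          ((((Q.tensorAct D.act (LinearMap.mul k H)).flip b).lTensor A).lTensor H t)) := by
    intro t
    refine TensorProduct.induction_on t (by simp) (fun g u => ?_)
      (fun x y hx hy => by simp only [map_add, LinearMap.add_apply, hx, hy])
    simp [TensorProduct.map₂_apply_tmul, smashMul_eq]
  have e2 : ∀ d : H ⊗[k] H, ((LinearMap.mul k H).flip x).rTensor _
      (((Q.tensorAct D.act (LinearMap.mul k H)).flip b).lTensor H d) =
      TensorProduct.map₂ (LinearMap.mul k H) (Q.tensorAct D.act (LinearMap.mul k H)) d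
        (x ⊗ₜ b) := by
    intro d
    refine TensorProduct.induction_on d (by simp) (fun g u => ?_)
      (fun x y hx hy => by simp only [map_add, LinearMap.add_apply, hx, hy])
    simp [TensorProduct.map₂_apply_tmul]
  rw [e1, smashCoact_eq, ← ydSlide_lTensor_lTensor Q ho hD.isRep hH hH hAH,
    ← ydSlide_lTensor_rTensor Q hx hD.isRep hH hH hAH, LinearMap.lTensor_tmul,
    LinearMap.lTensor_tmul, LinearMap.lTensor_tmul, AlgHom.toLinearMap_apply, e2]
  rfl

theorem smashCoact_mul (hD : D.IsYDAlgebra Q) (u w : A ⊗[k] H) :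
    D.smashCoact Q (D.smashMul Q (u ⊗ₜ w)) = TensorProduct.map₂ (LinearMap.mul k H)
      (TensorProduct.curry (D.smashMul Q)) (D.smashCoact Q u) (D.smashCoact Q w) := by
  have hH : IsRep (LinearMap.mul k H) := IsRep.mulLeft
  refine TensorProduct.induction_on u (by simp) (fun a h => ?_)
    (fun x y hx hy => by
      simp only [TensorProduct.add_tmul, map_add, LinearMap.add_apply, hx, hy])
  rw [hD.mul_smashCoact, ← hD.isRepHom_smashCoact, smashMul_tmul, smashCoact_eq,
    ← hD.freeAct_lTensor hH (Q.isRep_tensorAct hH hH) isRepHom_comul, hD.ydSlide_freeAct hH hH]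
  rfl

theorem ydSlide_one (hD : D.IsYDAlgebra Q) {X M : Type*} [AddCommGroup X] [Module k X]
    [AddCommGroup M] [Module k M] {ρX : H →ₗ[k] X →ₗ[k] X} {ρM : H →ₗ[k] M →ₗ[k] M}
    (hX : IsRep ρX) (hM : IsRep ρM) (u : X ⊗[k] M) :
    ydSlide Q D.coact D.act ρX ρM (D.one ⊗ₜ u) = (TensorProduct.mk k A M D.one).lTensor X u := by
  refine TensorProduct.induction_on u (by simp) (fun x m => ?_)
    (fun x y hx hy => by simp only [TensorProduct.tmul_add, map_add, hx, hy])
  rw [← Q.assocHom_counit_left hX hM hD.act_one, ydSlide_assocHom Q hD.isRep hX hM,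
    LinearMap.rTensor_tmul, ydBraid_tmul, hD.coact_one, LinearMap.rTensor_tmul,
    LinearMap.flip_apply, hX.one, Q.assocHom_counit_mid hX hM hD.act_one]
  rfl

theorem smashCoact_smashJ (hD : D.IsYDAlgebra Q) (h : H) :
    D.smashCoact Q (D.smashJ h) = D.smashJ.lTensor H (Q.Δ h) := by
  rw [smashCoact_eq, smashJ, TensorProduct.mk_apply, LinearMap.lTensor_tmul,
    hD.ydSlide_one IsRep.mulLeft IsRep.mulLeft]
  rfl

theorem counit_smashCoact (hD : D.IsYDAlgebra Q) (u : A ⊗[k] H) :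
    Q.ε.toLinearMap.rTensor (A ⊗[k] H) (D.smashCoact Q u) = 1 ⊗ₜ u := by
  have hH : IsRep (LinearMap.mul k H) := IsRep.mulLeft
  let ρk : H →ₗ[k] k →ₗ[k] k := LinearMap.mul k k ∘ₗ Q.ε.toLinearMap
  have hk : IsRep ρk := ⟨fun x => by simp [ρk], fun a b x => by simp [ρk, _root_.mul_assoc]⟩
  have hk' : ∀ (x : k) (h : H), ρk h x = Q.ε h • x := fun x h => by simp [ρk]
  have he : IsRepHom (LinearMap.mul k H) ρk Q.ε.toLinearMap := fun g h => by simp [ρk]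
  refine TensorProduct.induction_on u (by simp) (fun a h => ?_)
    (fun x y hx hy => by simp only [TensorProduct.tmul_add, map_add, hx, hy])
  have e1 : Q.ε.toLinearMap.rTensor H (Q.Δ h) = 1 ⊗ₜ h := Q.counit_left h
  have e2 : ydBraid D.coact ρk (a ⊗ₜ 1) = 1 ⊗ₜ a := by
    have := hD.isYDModule.counit_coact a
    rw [ydBraid_tmul]
    have e3 : ρk.flip 1 = Q.ε.toLinearMap := by ext; simp [ρk]
    rw [e3]
    exact (TensorProduct.lid k A).injective (by rw [this]; simp)
  rw [smashCoact_eq, ← ydSlide_lTensor_rTensor Q he hD.isRep hH hk hH, LinearMap.lTensor_tmul,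
    LinearMap.lTensor_tmul, AlgHom.toLinearMap_apply, e1,
    ← Q.assocHom_counit_mid hD.isRep hH (hk' 1), ydSlide_assocHom Q hD.isRep hk hH,
    LinearMap.rTensor_tmul, e2, Q.assocHom_counit_left hD.isRep hH (hk' 1)]

theorem smashCoact_smashCoact (hD : D.IsYDAlgebra Q) (a : A) (h : H) :
    (D.smashCoact Q).lTensor H (D.smashCoact Q (a ⊗ₜ h)) =
      (ydSlide Q D.coact D.act (LinearMap.mul k H) (LinearMap.mul k H)).lTensor H
        (ydSlide Q D.coact D.act (LinearMap.mul k H)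
          (Q.tensorAct (LinearMap.mul k H) (LinearMap.mul k H)) (a ⊗ₜ Q.ΔR h)) := by
  have hH : IsRep (LinearMap.mul k H) := IsRep.mulLeft
  have e : D.smashCoact Q = ydSlide Q D.coact D.act (LinearMap.mul k H) (LinearMap.mul k H) ∘ₗ
    Q.Δ.toLinearMap.lTensor A := rfl
  rw [smashCoact_eq, e, LinearMap.lTensor_comp_apply,
    ← ydSlide_lTensor_lTensor Q isRepHom_comul hD.isRep hH hH (Q.isRep_tensorAct hH hH)]
  rfl

theorem rTensor_comul_smashCoact (hD : D.IsYDAlgebra Q) (a : A) (h : H) :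
    Q.Δ.toLinearMap.rTensor (A ⊗[k] H) (D.smashCoact Q (a ⊗ₜ h)) =
      ydSlide Q D.coact D.act (Q.tensorAct (LinearMap.mul k H) (LinearMap.mul k H))
        (LinearMap.mul k H) (a ⊗ₜ Q.Δ.toLinearMap.rTensor H (Q.Δ h)) := by
  have hH : IsRep (LinearMap.mul k H) := IsRep.mulLeft
  rw [smashCoact_eq,
    ← ydSlide_lTensor_rTensor Q isRepHom_comul hD.isRep hH (Q.isRep_tensorAct hH hH) hH]
  rfl

theorem smashMul_smashJ (a : A) (h g : H) :
    D.smashMul Q ((a ⊗ₜ h) ⊗ₜ D.smashJ g) =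
      D.freeAct Q (LinearMap.mul k H) (a ⊗ₜ Q.tensorAct D.act (LinearMap.mul k H) h
        (D.one ⊗ₜ g)) := rfl

theorem smashMul_smashJ_right (hD : D.IsYDAlgebra Q) (a : A) (h g : H) :
    D.smashMul Q ((a ⊗ₜ h) ⊗ₜ D.smashJ g) = a ⊗ₜ (h * g) := by
  rw [smashMul_smashJ, Q.tensorAct_counit_left hD.act_one, hD.freeAct_one_right IsRep.mulLeft]
  rfl

theorem smashMul_smashJ_left (hD : D.IsYDAlgebra Q) (h : H) (w : A ⊗[k] H) :
    D.smashMul Q (D.smashJ h ⊗ₜ w) = Q.tensorAct D.act (LinearMap.mul k H) h w := by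
  rw [smashJ, TensorProduct.mk_apply, smashMul_tmul, hD.freeAct_one_left IsRep.mulLeft]

/-- The algebra map `j : H → A # H`. -/
def smashJHom (hD : D.IsYDAlgebra Q) :
    letI := hD.smashRing
    letI := hD.smashAlgebra
    H →ₐ[k] A ⊗[k] H :=
  letI := hD.smashRing
  letI := hD.smashAlgebra
  AlgHom.ofLinearMap D.smashJ rfl fun g h => (hD.smashMul_smashJ_right D.one g h).symm

/-- The coaction of the smash product, as an algebra map. -/
def smashCoactHom (hD : D.IsYDAlgebra Q) :
    letI := hD.smashRing
    letI := hD.smashAlgebra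
    A ⊗[k] H →ₐ[k] H ⊗[k] (A ⊗[k] H) :=
  letI := hD.smashRing
  letI := hD.smashAlgebra
  AlgHom.ofLinearMap (D.smashCoact Q)
    (by
      change D.smashCoact Q (D.smashJ 1) = _
      rw [hD.smashCoact_smashJ, map_one]
      rfl)
    fun u w => (hD.smashCoact_mul u w).trans (map₂_mul_eq_mul _ _)

/-- The smash product is a comodule algebra: its coaction moves `A` past a copy of `H`, so the
axioms are the hexagon and the counit axiom of the half-braiding of `A`. -/
theorem isComoduleAlgebra_smash (hD : D.IsYDAlgebra Q) :
    letI := hD.smashRing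
    letI := hD.smashAlgebra
    IsComoduleAlgebra Q hD.smashJHom hD.smashCoactHom := by
  let _ := hD.smashRing
  let _ := hD.smashAlgebra
  have hH : IsRep (LinearMap.mul k H) := IsRep.mulLeft
  have hA := hD.isRep
  have hAH := Q.isRep_tensorAct hA hH
  refine ⟨fun h => hD.smashCoact_smashJ h, fun b => ?_, fun b => hD.counit_smashCoact b⟩
  refine TensorProduct.induction_on b (by simp) (fun a h => ?_)
    (fun x y hx hy => by simp only [map_add, add_mul, mul_add, hx, hy])
  have hr : ∀ x : H, IsRepHom (LinearMap.mul k H) (LinearMap.mul k H)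
    ((LinearMap.mul k H).flip x) := fun x => isRepHom_apply_right hH x
  let F : H ⊗[k] (H ⊗[k] H) →ₗ[k] H ⊗[k] (H ⊗[k] (A ⊗[k] H)) :=
    (ydSlide Q D.coact D.act (LinearMap.mul k H) (LinearMap.mul k H)).lTensor H ∘ₗ
      ydSlide Q D.coact D.act (LinearMap.mul k H)
        (Q.tensorAct (LinearMap.mul k H) (LinearMap.mul k H)) ∘ₗ TensorProduct.mk k A _ a
  have hF : ∀ s x y z, F s * (x ⊗ₜ (y ⊗ₜ hD.smashJHom z)) = F (s * (x ⊗ₜ (y ⊗ₜ z))) := by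
    intro s x y z
    have hHH := Q.isRep_tensorAct hH hH
    have n1 := fun u => ydSlide_lTensor_rTensor Q (lV := D.coact) (hr x) hA hH hH hHH u
    have n2 := fun u => ydSlide_lTensor_lTensor Q (lV := D.coact)
      (Q.isRepHom_rTensor (ρN := LinearMap.mul k H) (hr y)) hA hH hHH hHH u
    have n3 := fun u => ydSlide_lTensor_lTensor Q (lV := D.coact)
      (Q.isRepHom_lTensor (ρM := LinearMap.mul k H) (hr z)) hA hH hHH hHH u
    have m2 : ydSlide Q D.coact D.act (LinearMap.mul k H) (LinearMap.mul k H) ∘ₗ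
        ((((LinearMap.mul k H).flip y).rTensor H).lTensor A) =
        ((LinearMap.mul k H).flip y).rTensor _ ∘ₗ
          ydSlide Q D.coact D.act (LinearMap.mul k H) (LinearMap.mul k H) :=
      LinearMap.ext (ydSlide_lTensor_rTensor Q (lV := D.coact) (hr y) hA hH hH hH)
    have m3 : ydSlide Q D.coact D.act (LinearMap.mul k H) (LinearMap.mul k H) ∘ₗ
        ((((LinearMap.mul k H).flip z).lTensor H).lTensor A) =
        (((LinearMap.mul k H).flip z).lTensor A).lTensor H ∘ₗ
          ydSlide Q D.coact D.act (LinearMap.mul k H) (LinearMap.mul k H) :=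
      LinearMap.ext (ydSlide_lTensor_lTensor Q (lV := D.coact) (hr z) hA hH hH hH)
    have m2' := fun u => LinearMap.congr_fun (congrArg (LinearMap.lTensor H) m2) u
    have m3' := fun u => LinearMap.congr_fun (congrArg (LinearMap.lTensor H) m3) u
    simp only [LinearMap.lTensor_comp, LinearMap.comp_apply] at m2' m3'
    have e3 : a ⊗ₜ[k] (s * (x ⊗ₜ (y ⊗ₜ z))) = (((LinearMap.mul k H).flip x).rTensor _).lTensor A
        (((((LinearMap.mul k H).flip y).rTensor _).lTensor _).lTensor A
          (((((LinearMap.mul k H).flip z).lTensor H).lTensor H).lTensor A (a ⊗ₜ s))) := by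
      rw [mul_tmul_tmul]
      rfl
    have e5 : (LinearMap.mul k (A ⊗[k] H)).flip (hD.smashJHom z) =
        ((LinearMap.mul k H).flip z).lTensor A :=
      TensorProduct.ext' fun b g => hD.smashMul_smashJ_right b g z
    simp only [F, LinearMap.comp_apply, TensorProduct.mk_apply]
    rw [mul_tmul_tmul, e5, e3, n1, n2, n3, lTensor_rTensor_comm, m2', m3']
  have right := fun t => mul_map_of_mul_tmul hD.smashJHom F hF (Q.ΔR h) t
  have left : ∀ y : (H ⊗[k] H) ⊗[k] (A ⊗[k] H), Algebra.TensorProduct.map (AlgHom.id k H)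
      (Algebra.TensorProduct.map (AlgHom.id k H) hD.smashJHom) Q.Φ *
        TensorProduct.assoc k H H (A ⊗[k] H) y =
      Q.assocHom (LinearMap.mul k H) (LinearMap.mul k H)
        (Q.tensorAct D.act (LinearMap.mul k H)) y := by
    intro y
    have e5 : resAct hD.smashJHom (LinearMap.mul k (A ⊗[k] H)) =
        Q.tensorAct D.act (LinearMap.mul k H) :=
      LinearMap.ext₂ fun h u => hD.smashMul_smashJ_left h u
    rw [map_mul_eq_map₂, e5]
    rfl
  have h1 : Algebra.TensorProduct.map (AlgHom.id k H) hD.smashCoactHom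
      (hD.smashCoactHom (a ⊗ₜ[k] h)) =
      (D.smashCoact Q).lTensor H (D.smashCoact Q (a ⊗ₜ h)) := rfl
  have h2 : Algebra.TensorProduct.map Q.Δ (AlgHom.id k (A ⊗[k] H))
      (hD.smashCoactHom (a ⊗ₜ[k] h)) =
      Q.Δ.toLinearMap.rTensor (A ⊗[k] H) (D.smashCoact Q (a ⊗ₜ h)) := rfl
  have h3 : ∀ y, Algebra.TensorProduct.assoc k k k H H (A ⊗[k] H) y =
    TensorProduct.assoc k H H (A ⊗[k] H) y := fun _ => rfl
  have h4 : Q.assocHom (LinearMap.mul k H) (LinearMap.mul k H) (LinearMap.mul k H)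
      (Q.Δ.toLinearMap.rTensor H (Q.Δ h)) = Q.Φ * Q.ΔL h := by
    have e : TensorProduct.map₂ (LinearMap.mul k H) (LinearMap.mul k H) =
      LinearMap.mul k (H ⊗[k] H) := LinearMap.ext₂ map₂_mul_eq_mul
    rw [QuasiBialgebra.assocHom, LinearMap.comp_apply, e, map₂_mul_eq_mul]
    rfl
  rw [h1, hD.smashCoact_smashCoact, h2, h3, left, hD.rTensor_comul_smashCoact,
    ← ydSlide_tensor Q hH hH hH hD.isYDModule, LinearMap.lTensor_tmul, h4, ← Q.ΔR_mul_Φ]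
  exact right Q.Φ

/-! The inclusion `a ↦ a # 1` of `A` into the smash product. -/

theorem evalMap_smashIncl (hD : D.IsYDAlgebra Q) :
    letI := hD.smashRing
    letI := hD.smashAlgebra
    evalMap ((TensorProduct.mk k A H).flip 1) (LinearMap.mul k (A ⊗[k] H)) =
      D.freeAct Q (LinearMap.mul k H) := by
  let _ := hD.smashRing
  let _ := hD.smashAlgebra
  refine TensorProduct.ext' fun a u => ?_
  rw [evalMap_tmul]
  change D.smashMul Q ((a ⊗ₜ 1) ⊗ₜ u) = _
  rw [smashMul_tmul, (Q.isRep_tensorAct hD.isRep IsRep.mulLeft).one]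

theorem resAct_smashJHom (hD : D.IsYDAlgebra Q) :
    letI := hD.smashRing
    letI := hD.smashAlgebra
    resAct hD.smashJHom (LinearMap.mul k (A ⊗[k] H)) =
      Q.tensorAct D.act (LinearMap.mul k H) :=
  LinearMap.ext₂ fun h u => hD.smashMul_smashJ_left h u

theorem evalMap_smashIncl_coactAct (hD : D.IsYDAlgebra Q) :
    letI := hD.smashRing
    letI := hD.smashAlgebra
    evalMap ((TensorProduct.mk k A H).flip 1) (coactAct hD.smashCoactHom (LinearMap.mul k H)
      (LinearMap.mul k (A ⊗[k] H))) =
      (D.freeAct Q (LinearMap.mul k H)).lTensor H ∘ₗ ydSlide Q D.coact D.act (LinearMap.mul k H)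
      (Q.tensorAct D.act (LinearMap.mul k H)) := by
  let _ := hD.smashRing
  let _ := hD.smashAlgebra
  have hH : IsRep (LinearMap.mul k H) := IsRep.mulLeft
  refine TensorProduct.ext' fun a u => ?_
  rw [evalMap_tmul]
  have := hD.mul_smashCoact a 1 u
  rw [(Q.isRep_tensorAct hH (Q.isRep_tensorAct hD.isRep hH)).one] at this
  exact this

/-- The inclusion `a ↦ a # 1` is a braided intertwiner. -/
theorem isBraidedIntertwiner_smashIncl (hD : D.IsYDAlgebra Q) :
    letI := hD.smashRing
    letI := hD.smashAlgebra
    IsBraidedIntertwiner Q hD.smashJHom hD.smashCoactHom D.act D.coact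
      ((TensorProduct.mk k A H).flip 1) := by
  let _ := hD.smashRing
  let _ := hD.smashAlgebra
  have hH : IsRep (LinearMap.mul k H) := IsRep.mulLeft
  have hAH := Q.isRep_tensorAct hD.isRep hH
  constructor
  · rw [IsIntertwiner, hD.evalMap_smashIncl, hD.resAct_smashJHom]
    exact hD.isRepHom_freeAct hH
  · intro a
    rw [hD.evalMap_smashIncl, hD.resAct_smashJHom, hD.evalMap_smashIncl_coactAct,
      LinearMap.comp_apply, ydSlide_assocHom Q hD.isRep hH hAH, LinearMap.rTensor_tmul,
      ydBraid_tmul_one]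

theorem smashIncl_mul (hD : D.IsYDAlgebra Q) (u : A ⊗[k] A) :
    letI := hD.smashRing
    letI := hD.smashAlgebra
    (TensorProduct.mk k A H).flip 1 (D.mul u) = convMap Q hD.smashJHom D.act D.act
      ((TensorProduct.mk k A H).flip 1) ((TensorProduct.mk k A H).flip 1) u := by
  let _ := hD.smashRing
  let _ := hD.smashAlgebra
  have hH : IsRep (LinearMap.mul k H) := IsRep.mulLeft
  have hone : (1 : A ⊗[k] H) = D.one ⊗ₜ 1 := rfl
  rw [convMap, hD.evalMap_smashIncl, hD.resAct_smashJHom, LinearMap.comp_apply,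
    LinearMap.comp_apply, LinearMap.comp_apply, ← hD.freeAct_mul hH, LinearMap.flip_apply,
    LinearMap.flip_apply, TensorProduct.mk_apply, TensorProduct.mk_apply, LinearMap.rTensor_tmul,
    hone, hD.freeAct_one_right hH]

end IsYDAlgebra

end YDAlgebraData

end SmashComodule

/-! ### Antipode contractions -/

section TensorInduction

variable {k A B C D V : Type*} [CommSemiring k] [AddCommMonoid A] [Module k A]
  [AddCommMonoid B] [Module k B] [AddCommMonoid C] [Module k C] [AddCommMonoid D] [Module k D]

theorem tensor_induction₃ {P : A ⊗[k] (B ⊗[k] C) → Prop} (h0 : P 0)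
    (hadd : ∀ x y, P x → P y → P (x + y)) (h : ∀ a b c, P (a ⊗ₜ (b ⊗ₜ c))) : ∀ t, P t := by
  intro t
  refine TensorProduct.induction_on t h0 (fun a t => ?_) hadd
  refine TensorProduct.induction_on t (by rwa [TensorProduct.tmul_zero]) (h a) (fun x y hx hy => ?_)
  rw [TensorProduct.tmul_add]
  exact hadd _ _ hx hy

theorem tensor_induction₄ {P : A ⊗[k] (B ⊗[k] (C ⊗[k] D)) → Prop} (h0 : P 0)
    (hadd : ∀ x y, P x → P y → P (x + y)) (h : ∀ a b c d, P (a ⊗ₜ (b ⊗ₜ (c ⊗ₜ d)))) :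
    ∀ t, P t := by
  refine tensor_induction₃ h0 hadd fun a b t => ?_
  refine TensorProduct.induction_on t (by rwa [TensorProduct.tmul_zero, TensorProduct.tmul_zero])
    (h a b) (fun x y hx hy => ?_)
  rw [TensorProduct.tmul_add, TensorProduct.tmul_add]
  exact hadd _ _ hx hy

end TensorInduction

namespace QuasiBialgebra

variable {k H V : Type*} [Field k] [Ring H] [Algebra k H] [AddCommGroup V] [Module k V]
  (Q : QuasiBialgebra k H)

/-! A linear map on `H ⊗ (H ⊗ H)` that contracts one leg by `ε` takes `Φ` and `Φ⁻¹` to its value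
at `1`. -/

theorem apply_Φ_of_counit {g : H ⊗[k] (H ⊗[k] H) →ₗ[k] V}
    {π : H ⊗[k] (H ⊗[k] H) →ₐ[k] H ⊗[k] (H ⊗[k] H)} (hπ : π Q.Φ = 1)
    (hg : ∀ t, g t = g (π t)) : g Q.Φ = g 1 ∧ g Q.Φinv = g 1 := by
  have h2 : π Q.Φinv = 1 := by
    have := congrArg π Q.Φinv_mul_Φ
    rwa [map_mul, hπ, mul_one, map_one] at this
  exact ⟨by rw [hg, hπ], by rw [hg, h2]⟩

theorem apply_Φ_left {g : H ⊗[k] (H ⊗[k] H) →ₗ[k] V}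
    (hg : ∀ a b c, g (a ⊗ₜ (b ⊗ₜ c)) = Q.ε a • g (1 ⊗ₜ (b ⊗ₜ c))) :
    g Q.Φ = g 1 ∧ g Q.Φinv = g 1 := by
  let ι : k ⊗[k] (H ⊗[k] H) →ₐ[k] H ⊗[k] (H ⊗[k] H) :=
    Algebra.TensorProduct.map (Algebra.ofId k H) (AlgHom.id k (H ⊗[k] H))
  refine Q.apply_Φ_of_counit (π := ι.comp (Algebra.TensorProduct.map Q.ε
    (AlgHom.id k (H ⊗[k] H)))) ?_ ?_
  · rw [AlgHom.comp_apply, Q.counit_Φ_left]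
    exact ι.map_one'
  · refine tensor_induction₃ (by simp) (fun x y hx hy => by simp only [map_add, hx, hy])
      fun a b c => ?_
    rw [hg, AlgHom.comp_apply]
    simp [ι, Algebra.ofId_apply, Algebra.algebraMap_eq_smul_one, ← TensorProduct.smul_tmul']

theorem apply_Φ_mid {g : H ⊗[k] (H ⊗[k] H) →ₗ[k] V}
    (hg : ∀ a b c, g (a ⊗ₜ (b ⊗ₜ c)) = Q.ε b • g (a ⊗ₜ (1 ⊗ₜ c))) :
    g Q.Φ = g 1 ∧ g Q.Φinv = g 1 := by
  let ι : H ⊗[k] (k ⊗[k] H) →ₐ[k] H ⊗[k] (H ⊗[k] H) := Algebra.TensorProduct.map (AlgHom.id k H)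
    (Algebra.TensorProduct.map (Algebra.ofId k H) (AlgHom.id k H))
  refine Q.apply_Φ_of_counit (π := ι.comp (Algebra.TensorProduct.map (AlgHom.id k H)
    (Algebra.TensorProduct.map Q.ε (AlgHom.id k H)))) ?_ ?_
  · rw [AlgHom.comp_apply, Q.counit_Φ_mid]
    exact ι.map_one'
  · refine tensor_induction₃ (by simp) (fun x y hx hy => by simp only [map_add, hx, hy])
      fun a b c => ?_
    rw [hg, AlgHom.comp_apply]
    simp [ι, Algebra.ofId_apply, Algebra.algebraMap_eq_smul_one, ← TensorProduct.smul_tmul']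

theorem apply_Φ_right {g : H ⊗[k] (H ⊗[k] H) →ₗ[k] V}
    (hg : ∀ a b c, g (a ⊗ₜ (b ⊗ₜ c)) = Q.ε c • g (a ⊗ₜ (b ⊗ₜ 1))) :
    g Q.Φ = g 1 ∧ g Q.Φinv = g 1 := by
  let ι : H ⊗[k] (H ⊗[k] k) →ₐ[k] H ⊗[k] (H ⊗[k] H) := Algebra.TensorProduct.map (AlgHom.id k H)
    (Algebra.TensorProduct.map (AlgHom.id k H) (Algebra.ofId k H))
  refine Q.apply_Φ_of_counit (π := ι.comp (Algebra.TensorProduct.map (AlgHom.id k H)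
    (Algebra.TensorProduct.map (AlgHom.id k H) Q.ε))) ?_ ?_
  · rw [AlgHom.comp_apply, Q.counit_Φ_right]
    exact ι.map_one'
  · refine tensor_induction₃ (by simp) (fun x y hx hy => by simp only [map_add, hx, hy])
      fun a b c => ?_
    rw [hg, AlgHom.comp_apply]
    simp [ι, Algebra.ofId_apply, Algebra.algebraMap_eq_smul_one]

theorem apply_Δ_left {g : H ⊗[k] H →ₗ[k] V}
    (hg : ∀ a b, g (a ⊗ₜ b) = Q.ε a • g (1 ⊗ₜ b)) (h : H) : g (Q.Δ h) = g (1 ⊗ₜ h) := by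
  let ι : k ⊗[k] H →ₗ[k] H ⊗[k] H := (Algebra.linearMap k H).rTensor H
  have e : ∀ t, g t = g (ι (Algebra.TensorProduct.map Q.ε (AlgHom.id k H) t)) := fun t =>
    TensorProduct.induction_on t (by simp) (fun a b => by
      rw [hg]; simp [ι, Algebra.algebraMap_eq_smul_one, ← TensorProduct.smul_tmul'])
      (fun x y hx hy => by simp only [map_add, hx, hy])
  rw [e, Q.counit_left]
  simp [ι]

theorem apply_Δ_right {g : H ⊗[k] H →ₗ[k] V}
    (hg : ∀ a b, g (a ⊗ₜ b) = Q.ε b • g (a ⊗ₜ 1)) (h : H) : g (Q.Δ h) = g (h ⊗ₜ 1) := by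
  let ι : H ⊗[k] k →ₗ[k] H ⊗[k] H := (Algebra.linearMap k H).lTensor H
  have e : ∀ t, g t = g (ι (Algebra.TensorProduct.map (AlgHom.id k H) Q.ε t)) := fun t =>
    TensorProduct.induction_on t (by simp) (fun a b => by
      rw [hg]; simp [ι, Algebra.algebraMap_eq_smul_one])
      (fun x y hx hy => by simp only [map_add, hx, hy])
  rw [e, Q.counit_right]
  simp [ι]

/-! Consequences of the pentagon for the inverse legs. -/

theorem map_Φ_mul_map_Φinv (f : H ⊗[k] (H ⊗[k] H) →ₐ[k] H ⊗[k] (H ⊗[k] (H ⊗[k] H))) :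
    f Q.Φ * f Q.Φinv = 1 :=
  (f.map_mul' _ _).symm.trans ((congrArg f Q.Φ_mul_Φinv).trans f.map_one')

theorem map_Φinv_mul_map_Φ (f : H ⊗[k] (H ⊗[k] H) →ₐ[k] H ⊗[k] (H ⊗[k] (H ⊗[k] H))) :
    f Q.Φinv * f Q.Φ = 1 :=
  (f.map_mul' _ _).symm.trans ((congrArg f Q.Φinv_mul_Φ).trans f.map_one')

theorem pentagon_rearrange {R : Type*} [Mul R] [One R] (assoc : ∀ a b c : R, a * b * c = a * (b * c))
    (one_mul : ∀ a : R, 1 * a = a) (mul_one : ∀ a : R, a * 1 = a)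
    {a a' b b' c c' d d' e e' : R}
    (h : a * b * c = d * e) (ha : a' * a = 1) (hb : b * b' = 1) (hb' : b' * b = 1)
    (hc : c * c' = 1) (hd : d' * d = 1) (hd' : d * d' = 1) (he : e * e' = 1) :
    c * e' = b' * (a' * d) ∧ e * c' = d' * (a * b) ∧ a' * d = b * (c * e') ∧
      a' = b * (c * e' * d') := by
  have h1 : c * e' = b' * (a' * d) := by
    calc c * e' = b' * ((a' * a) * b) * (c * e') := by rw [ha, one_mul, hb', one_mul]
      _ = b' * a' * (a * b * c) * e' := by simp only [assoc]
      _ = b' * (a' * d) * (e * e') := by rw [h]; simp only [assoc]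
      _ = _ := by rw [he, mul_one]
  have h2 : a' * d = b * (c * e') := by rw [h1, ← assoc, hb, one_mul]
  refine ⟨h1, ?_, h2, ?_⟩
  · calc e * c' = d' * (d * e) * c' := by rw [← assoc d', hd, one_mul]
      _ = d' * (a * b) * (c * c') := by rw [← h]; simp only [assoc]
      _ = _ := by rw [hc, mul_one]
  · rw [← assoc, ← h2, assoc, hd', mul_one]

theorem pentagon_inv : leg123 Q.Φ * Q.leg12_3_4 Q.Φinv =
      Q.leg1_23_4 Q.Φinv * (leg234 Q.Φinv * Q.leg1_2_34 Q.Φ) ∧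
    Q.leg12_3_4 Q.Φ * leg123 Q.Φinv = Q.leg1_2_34 Q.Φinv * (leg234 Q.Φ * Q.leg1_23_4 Q.Φ) ∧
    leg234 Q.Φinv * Q.leg1_2_34 Q.Φ =
      Q.leg1_23_4 Q.Φ * (leg123 Q.Φ * Q.leg12_3_4 Q.Φinv) ∧
    leg234 Q.Φinv =
      Q.leg1_23_4 Q.Φ * (leg123 Q.Φ * Q.leg12_3_4 Q.Φinv * Q.leg1_2_34 Q.Φinv) :=
  pentagon_rearrange (fun a b c => by exact mul_assoc a b c) (fun a => by exact one_mul a)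
    (fun a => by exact mul_one a) Q.pentagon_legs
    (Q.map_Φinv_mul_map_Φ leg234)
    (Q.map_Φ_mul_map_Φinv Q.leg1_23_4) (Q.map_Φinv_mul_map_Φ Q.leg1_23_4)
    (Q.map_Φ_mul_map_Φinv leg123) (Q.map_Φinv_mul_map_Φ Q.leg1_2_34)
    (Q.map_Φ_mul_map_Φinv Q.leg1_2_34) (Q.map_Φ_mul_map_Φinv Q.leg12_3_4)

theorem leg_tmul (a b c : H) :
    leg234 (a ⊗ₜ[k] (b ⊗ₜ[k] c)) = 1 ⊗ₜ (a ⊗ₜ (b ⊗ₜ c)) ∧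
    leg123 (a ⊗ₜ[k] (b ⊗ₜ[k] c)) = a ⊗ₜ (b ⊗ₜ (c ⊗ₜ 1)) ∧
    Q.leg1_23_4 (a ⊗ₜ[k] (b ⊗ₜ[k] c)) = a ⊗ₜ TensorProduct.assoc k H H H (Q.Δ b ⊗ₜ c) ∧
    Q.leg1_2_34 (a ⊗ₜ[k] (b ⊗ₜ[k] c)) = a ⊗ₜ (b ⊗ₜ Q.Δ c) ∧
    Q.leg12_3_4 (a ⊗ₜ[k] (b ⊗ₜ[k] c)) =
      TensorProduct.assoc k H H (H ⊗[k] H) (Q.Δ a ⊗ₜ (b ⊗ₜ c)) :=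
  ⟨rfl, rfl, rfl, rfl, rfl⟩

end QuasiBialgebra

section QuadrupleTensors

variable {k H : Type*} [Field k] [Ring H] [Algebra k H] (s t u : H ⊗[k] (H ⊗[k] (H ⊗[k] H)))

/-! Ring axioms on quadruple tensors, restated for the product instance found by unification, so
that rewriting does not have to search for the derived structures on deeply nested tensors. -/

theorem tensor₄_mul_add : s * (t + u) = s * t + s * u := map_add (LinearMap.mulLeft k s) t u
theorem tensor₄_add_mul : (s + t) * u = s * u + t * u := map_add (LinearMap.mulRight k u) s t
theorem tensor₄_mul_zero : s * 0 = 0 := by exact mul_zero s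
theorem tensor₄_zero_mul : 0 * s = 0 := by exact zero_mul s
theorem tensor₄_one_mul : 1 * s = s := by exact one_mul s
theorem tensor₄_mul_one : s * 1 = s := by exact mul_one s
theorem tensor₄_tmul_mul_tmul (a a' : H) (w w' : H ⊗[k] (H ⊗[k] H)) :
    (a ⊗ₜ[k] w) * (a' ⊗ₜ[k] w') = (a * a') ⊗ₜ[k] (w * w') := by
  exact Algebra.TensorProduct.tmul_mul_tmul a a' w w'

/-- Right multiplication on quadruple tensors. -/
def tensor₄MulRight : H ⊗[k] (H ⊗[k] (H ⊗[k] H)) →ₗ[k] H ⊗[k] (H ⊗[k] (H ⊗[k] H)) :=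
  LinearMap.mulRight k t

/-- Left multiplication on quadruple tensors. -/
def tensor₄MulLeft : H ⊗[k] (H ⊗[k] (H ⊗[k] H)) →ₗ[k] H ⊗[k] (H ⊗[k] (H ⊗[k] H)) :=
  LinearMap.mulLeft k t

end QuadrupleTensors

namespace QuasiHopfAlgebra

variable {k H V : Type*} [Field k] [Ring H] [Algebra k H] [AddCommGroup V] [Module k V]
  (Q : QuasiHopfAlgebra k H)

theorem S_one : Q.S 1 = 1 := by
  obtain ⟨x, hx⟩ := Q.S.surjective 1
  have := Q.S_mul x 1
  rw [mul_one, hx, mul_one] at this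
  exact this.symm

/-- The contraction `a ⊗ b ↦ S(a)αb`, under which `Δ(h)` becomes `ε(h)α`. -/
def contractα : H ⊗[k] H →ₗ[k] H :=
  LinearMap.mul' k H ∘ₗ TensorProduct.map Q.S.toLinearMap (LinearMap.mulLeft k Q.α)

@[simp]
theorem contractα_tmul (a b : H) : Q.contractα (a ⊗ₜ b) = Q.S a * (Q.α * b) := rfl

/-- The contraction `a ⊗ b ↦ aβS(b)`, under which `Δ(h)` becomes `ε(h)β`. -/
def contractβ : H ⊗[k] H →ₗ[k] H :=
  LinearMap.mul' k H ∘ₗ TensorProduct.map (LinearMap.mulRight k Q.β) Q.S.toLinearMap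

@[simp]
theorem contractβ_tmul (a b : H) : Q.contractβ (a ⊗ₜ b) = a * Q.β * Q.S b := rfl

theorem contractα_mul_tmul (t : H ⊗[k] H) (a b : H) :
    Q.contractα (t * (a ⊗ₜ b)) = Q.S a * Q.contractα t * b := by
  refine TensorProduct.induction_on t (by simp) (fun c d => ?_)
    (fun x y hx hy => by simp only [add_mul, mul_add, map_add, hx, hy])
  simp [Q.S_mul, mul_assoc]

theorem contractβ_tmul_mul (t : H ⊗[k] H) (a b : H) :
    Q.contractβ ((a ⊗ₜ b) * t) = a * Q.contractβ t * Q.S b := by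
  refine TensorProduct.induction_on t (by simp) (fun c d => ?_)
    (fun x y hx hy => by simp only [add_mul, mul_add, map_add, hx, hy])
  simp [Q.S_mul, mul_assoc]

theorem contractα_Δ (h : H) : Q.contractα (Q.Δ h) = Q.ε h • Q.α := Q.antipode_left h

theorem contractβ_Δ (h : H) : Q.contractβ (Q.Δ h) = Q.ε h • Q.β := Q.antipode_right h

theorem contractα_Δ_mul (h : H) (t : H ⊗[k] H) :
    Q.contractα (Q.Δ h * t) = Q.ε h • Q.contractα t := by
  refine TensorProduct.induction_on t (by simp) (fun c d => ?_)
    (fun x y hx hy => by simp only [mul_add, map_add, hx, hy, smul_add])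
  simp [Q.contractα_mul_tmul, contractα_Δ, mul_assoc]

theorem contractβ_mul_Δ (h : H) (t : H ⊗[k] H) :
    Q.contractβ (t * Q.Δ h) = Q.ε h • Q.contractβ t := by
  refine TensorProduct.induction_on t (by simp) (fun c d => ?_)
    (fun x y hx hy => by simp only [add_mul, map_add, hx, hy, smul_add])
  simp [Q.contractβ_tmul_mul, contractβ_Δ]

/-- The element `X¹ ⊗ S(X²)αX³`, through which a bimodule element is evaluated at `1`. -/
def qElem : H ⊗[k] H := Q.contractα.lTensor H (Q.Φ : H ⊗[k] (H ⊗[k] H))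

/-- The element `p = x¹ ⊗ x²βS(x³)`. -/
def pElem : H ⊗[k] H := Q.contractβ.lTensor H Q.Φinv

/-- The map `h ↦ S(h₂) ⊗ S(h₁)`, that is, `(S ⊗ S) ∘ Δᶜᵒᵖ`. -/
def Scop : H →ₗ[k] H ⊗[k] H :=
  TensorProduct.map Q.S.toLinearMap Q.S.toLinearMap ∘ₗ (TensorProduct.comm k H H).toLinearMap ∘ₗ
    Q.Δ.toLinearMap

theorem map_S_comm_mul (s t : H ⊗[k] H) :
    TensorProduct.map Q.S.toLinearMap Q.S.toLinearMap (TensorProduct.comm k H H (s * t)) =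
      TensorProduct.map Q.S.toLinearMap Q.S.toLinearMap (TensorProduct.comm k H H t) *
        TensorProduct.map Q.S.toLinearMap Q.S.toLinearMap (TensorProduct.comm k H H s) := by
  refine TensorProduct.induction_on s (by simp) (fun c d => ?_)
    (fun x y hx hy => by simp only [add_mul, mul_add, map_add, hx, hy])
  refine TensorProduct.induction_on t (by simp) (fun c d => ?_)
    (fun x y hx hy => by simp only [add_mul, mul_add, map_add, hx, hy])
  simp [Q.S_mul]

theorem Scop_mul (g h : H) : Q.Scop (g * h) = Q.Scop h * Q.Scop g := by
  simp only [Scop, LinearMap.comp_apply, AlgHom.toLinearMap_apply, map_mul]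
  exact Q.map_S_comm_mul _ _

theorem Scop_one : Q.Scop 1 = 1 := by
  simp only [Scop, LinearMap.comp_apply, AlgHom.toLinearMap_apply, map_one,
    Algebra.TensorProduct.one_def]
  simp [S_one]

/-! Contracting two legs of `(id ⊗ Δ)Δ(h)`, and the maps built from `p` and from `Φ`. -/

/-- `h₁t¹ ⊗ S(h₂₁t²)αh₂₂t³ = ht¹ ⊗ S(t²)αt³` -/
theorem contractα_ΔR_mul (h : H) (t : H ⊗[k] (H ⊗[k] H)) :
    Q.contractα.lTensor H (Q.ΔR h * t) = (h ⊗ₜ 1) * Q.contractα.lTensor H t := by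
  refine TensorProduct.induction_on t (by simp) (fun a t => ?_)
    (fun x y hx hy => by simp only [mul_add, map_add, hx, hy])
  let g : H ⊗[k] H →ₗ[k] H ⊗[k] H := Q.contractα.lTensor H ∘ₗ
    LinearMap.mulRight k (a ⊗ₜ[k] t) ∘ₗ Q.Δ.toLinearMap.lTensor H
  have hg : ∀ x y, g (x ⊗ₜ y) = Q.ε y • g (x ⊗ₜ 1) := fun x y => by
    simp [g, contractα_Δ_mul, TensorProduct.tmul_smul]
  have := Q.apply_Δ_right hg h
  simp only [g, LinearMap.comp_apply, LinearMap.mulRight_apply, LinearMap.lTensor_tmul,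
    AlgHom.toLinearMap_apply, map_one, one_mul, Algebra.TensorProduct.tmul_mul_tmul] at this ⊢
  exact this

/-- `X¹h₁₁ ⊗ S(X²h₁₂)αX³h₂ = hX¹ ⊗ S(X²)αX³` -/
theorem contractα_Φ_mul_ΔL (h : H) :
    Q.contractα.lTensor H (Q.Φ * Q.ΔL h) = (h ⊗ₜ 1) * Q.qElem := by
  rw [← Q.ΔR_mul_Φ, contractα_ΔR_mul, qElem]

/-- `t¹h₁ ⊗ t²h₂₁βS(t³h₂₂) = t¹h ⊗ t²βS(t³)` -/
theorem contractβ_mul_ΔR (h : H) (t : H ⊗[k] (H ⊗[k] H)) :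
    Q.contractβ.lTensor H (t * Q.ΔR h) = Q.contractβ.lTensor H t * (h ⊗ₜ 1) := by
  refine TensorProduct.induction_on t (by simp) (fun a t => ?_)
    (fun x y hx hy => by simp only [add_mul, map_add, hx, hy])
  let g : H ⊗[k] H →ₗ[k] H ⊗[k] H := Q.contractβ.lTensor H ∘ₗ
    LinearMap.mulLeft k (a ⊗ₜ[k] t) ∘ₗ Q.Δ.toLinearMap.lTensor H
  have hg : ∀ x y, g (x ⊗ₜ y) = Q.ε y • g (x ⊗ₜ 1) := fun x y => by
    simp [g, contractβ_mul_Δ, TensorProduct.tmul_smul]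
  have := Q.apply_Δ_right hg h
  simp only [g, LinearMap.comp_apply, LinearMap.mulLeft_apply, LinearMap.lTensor_tmul,
    AlgHom.toLinearMap_apply, map_one, mul_one, Algebra.TensorProduct.tmul_mul_tmul] at this ⊢
  exact this

/-- The map `a ⊗ b ↦ Δ(a) p (1 ⊗ b)`, where `p = x¹ ⊗ x²βS(x³)`. -/
def pMap : H ⊗[k] H →ₗ[k] H ⊗[k] H :=
  TensorProduct.lift ((LinearMap.mul k (H ⊗[k] H)).compl₁₂
    (LinearMap.mulRight k Q.pElem ∘ₗ Q.Δ.toLinearMap) (TensorProduct.mk k H H 1))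

@[simp]
theorem pMap_tmul (a b : H) : Q.pMap (a ⊗ₜ b) = Q.Δ a * Q.pElem * (1 ⊗ₜ b) := rfl

theorem contractβ_assoc_mul (d : H ⊗[k] H) (c : H) (t : H ⊗[k] (H ⊗[k] H)) :
    Q.contractβ.lTensor H (TensorProduct.assoc k H H H (d ⊗ₜ c) * t) =
      d * Q.contractβ.lTensor H t * (1 ⊗ₜ Q.S c) := by
  refine TensorProduct.induction_on d (by simp) (fun a b => ?_)
    (fun x y hx hy => by simp only [TensorProduct.add_tmul, map_add, add_mul, hx, hy])
  refine TensorProduct.induction_on t (by simp) (fun a t => ?_)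
    (fun x y hx hy => by simp only [mul_add, add_mul, map_add, hx, hy])
  simp [contractβ_tmul_mul]

/-- `h₁₁p¹ ⊗ h₁₂p²S(h₂) = p¹h ⊗ p²` -/
theorem pMap_Δ (h : H) : Q.pMap (Q.S.toLinearMap.lTensor H (Q.Δ h)) = Q.pElem * (h ⊗ₜ 1) := by
  have e : ∀ d : H ⊗[k] H, Q.pMap (Q.S.toLinearMap.lTensor H d) = Q.contractβ.lTensor H
      (TensorProduct.assoc k H H H (Q.Δ.toLinearMap.rTensor H d) * Q.Φinv) := fun d =>
    TensorProduct.induction_on d (by simp) (fun a b => by simp [contractβ_assoc_mul, pElem])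
      (fun x y hx hy => by simp only [add_mul, map_add, hx, hy])
  have e2 : TensorProduct.assoc k H H H (Q.Δ.toLinearMap.rTensor H (Q.Δ h)) = Q.ΔL h := rfl
  rw [e, e2, ← Q.Φinv_mul_ΔR, contractβ_mul_ΔR, pElem]

/-- The map `h ⊗ c ↦ X¹h₁ ⊗ S(X²h₂)αX³c`. -/
def eMap : H ⊗[k] H →ₗ[k] H ⊗[k] H :=
  Q.contractα.lTensor H ∘ₗ LinearMap.mulLeft k (Q.Φ : H ⊗[k] (H ⊗[k] H)) ∘ₗ
    (TensorProduct.assoc k H H H).toLinearMap ∘ₗ Q.Δ.toLinearMap.rTensor H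

theorem eMap_tmul (h c : H) : Q.eMap (h ⊗ₜ c) =
    Q.contractα.lTensor H (Q.Φ * TensorProduct.assoc k H H H (Q.Δ h ⊗ₜ c)) := rfl

theorem eMap_Δ (h : H) : Q.eMap (Q.Δ h) = (h ⊗ₜ 1) * Q.qElem := by
  rw [← contractα_Φ_mul_ΔL]
  rfl

theorem contractα_mul_assoc_tmul (d : H ⊗[k] H) (c e : H) (t : H ⊗[k] (H ⊗[k] H)) :
    Q.contractα.lTensor H (t * TensorProduct.assoc k H H H (d ⊗ₜ (c * e))) =
      Q.contractα.lTensor H (t * TensorProduct.assoc k H H H (d ⊗ₜ c)) * (1 ⊗ₜ e) := by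
  refine TensorProduct.induction_on d (by simp) (fun a b => ?_)
    (fun x y hx hy => by simp only [TensorProduct.add_tmul, map_add, add_mul, mul_add, hx, hy])
  induction t using tensor_induction₃ with
  | h0 => simp
  | hadd x y hx hy => simp only [map_add, add_mul, hx, hy]
  | h x y z => simp [mul_assoc]

/-! A linear map on `H ⊗ H ⊗ H ⊗ H` that contracts, by an antipode axiom, the legs that come from
`Δ` of one leg of `Φ` or `Φ⁻¹` does not see that factor of a product. -/

theorem contract_mid_left {R : Type*} [AddCommGroup R] [Module k R]
    {f : H ⊗[k] (H ⊗[k] (H ⊗[k] H)) →ₗ[k] R} {t : H ⊗[k] (H ⊗[k] (H ⊗[k] H))}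
    (hf : ∀ a b c, f (Q.leg1_23_4 (a ⊗ₜ (b ⊗ₜ c)) * t) =
      Q.ε b • f (Q.leg1_23_4 (a ⊗ₜ (1 ⊗ₜ c)) * t)) :
    f (Q.leg1_23_4 Q.Φ * t) = f t ∧ f (Q.leg1_23_4 Q.Φinv * t) = f t := by
  have := Q.apply_Φ_mid (g := f ∘ₗ tensor₄MulRight t ∘ₗ Q.leg1_23_4.toLinearMap) hf
  have e : (f ∘ₗ tensor₄MulRight t ∘ₗ Q.leg1_23_4.toLinearMap) 1 = f t := by
    change f (Q.leg1_23_4 1 * t) = f t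
    rw [show Q.leg1_23_4 1 = 1 from Q.leg1_23_4.map_one', tensor₄_one_mul]
  rw [e] at this
  exact this

theorem contract_mid_right {R : Type*} [AddCommGroup R] [Module k R]
    {f : H ⊗[k] (H ⊗[k] (H ⊗[k] H)) →ₗ[k] R} {t : H ⊗[k] (H ⊗[k] (H ⊗[k] H))}
    (hf : ∀ a b c, f (t * Q.leg1_23_4 (a ⊗ₜ (b ⊗ₜ c))) =
      Q.ε b • f (t * Q.leg1_23_4 (a ⊗ₜ (1 ⊗ₜ c)))) :
    f (t * Q.leg1_23_4 Q.Φ) = f t ∧ f (t * Q.leg1_23_4 Q.Φinv) = f t := by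
  have := Q.apply_Φ_mid (g := f ∘ₗ tensor₄MulLeft t ∘ₗ Q.leg1_23_4.toLinearMap) hf
  have e : (f ∘ₗ tensor₄MulLeft t ∘ₗ Q.leg1_23_4.toLinearMap) 1 = f t := by
    change f (t * Q.leg1_23_4 1) = f t
    rw [show Q.leg1_23_4 1 = 1 from Q.leg1_23_4.map_one', tensor₄_mul_one]
  rw [e] at this
  exact this

theorem contract_last_left {R : Type*} [AddCommGroup R] [Module k R]
    {f : H ⊗[k] (H ⊗[k] (H ⊗[k] H)) →ₗ[k] R} {t : H ⊗[k] (H ⊗[k] (H ⊗[k] H))}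
    (hf : ∀ a b c, f (Q.leg1_2_34 (a ⊗ₜ (b ⊗ₜ c)) * t) =
      Q.ε c • f (Q.leg1_2_34 (a ⊗ₜ (b ⊗ₜ 1)) * t)) :
    f (Q.leg1_2_34 Q.Φ * t) = f t ∧ f (Q.leg1_2_34 Q.Φinv * t) = f t := by
  have := Q.apply_Φ_right (g := f ∘ₗ tensor₄MulRight t ∘ₗ Q.leg1_2_34.toLinearMap) hf
  have e : (f ∘ₗ tensor₄MulRight t ∘ₗ Q.leg1_2_34.toLinearMap) 1 = f t := by
    change f (Q.leg1_2_34 1 * t) = f t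
    rw [show Q.leg1_2_34 1 = 1 from Q.leg1_2_34.map_one', tensor₄_one_mul]
  rw [e] at this
  exact this

theorem contract_last_right {R : Type*} [AddCommGroup R] [Module k R]
    {f : H ⊗[k] (H ⊗[k] (H ⊗[k] H)) →ₗ[k] R} {t : H ⊗[k] (H ⊗[k] (H ⊗[k] H))}
    (hf : ∀ a b c, f (t * Q.leg1_2_34 (a ⊗ₜ (b ⊗ₜ c))) =
      Q.ε c • f (t * Q.leg1_2_34 (a ⊗ₜ (b ⊗ₜ 1)))) :
    f (t * Q.leg1_2_34 Q.Φ) = f t ∧ f (t * Q.leg1_2_34 Q.Φinv) = f t := by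
  have := Q.apply_Φ_right (g := f ∘ₗ tensor₄MulLeft t ∘ₗ Q.leg1_2_34.toLinearMap) hf
  have e : (f ∘ₗ tensor₄MulLeft t ∘ₗ Q.leg1_2_34.toLinearMap) 1 = f t := by
    change f (t * Q.leg1_2_34 1) = f t
    rw [show Q.leg1_2_34 1 = 1 from Q.leg1_2_34.map_one', tensor₄_mul_one]
  rw [e] at this
  exact this

end QuasiHopfAlgebra

namespace QuasiHopfAlgebra

variable {k H V : Type*} [Field k] [Ring H] [Algebra k H] [AddCommGroup V] [Module k V]
  (Q : QuasiHopfAlgebra k H)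

/-- `X¹x¹₁ ⊗ S(X²x¹₂)αX³x²βS(x³) = 1 ⊗ 1` -/
theorem eMap_pElem : Q.eMap Q.pElem = 1 := by
  let ψ : H ⊗[k] (H ⊗[k] H) →ₗ[k] H := LinearMap.mul' k H ∘ₗ
    TensorProduct.map Q.S.toLinearMap (LinearMap.mulLeft k Q.α ∘ₗ Q.contractβ)
  let f : H ⊗[k] (H ⊗[k] (H ⊗[k] H)) →ₗ[k] H ⊗[k] H := ψ.lTensor H
  have e : ∀ s t : H ⊗[k] (H ⊗[k] H), Q.contractα.lTensor H (s *
      TensorProduct.assoc k H H H (Q.Δ.toLinearMap.rTensor H (Q.contractβ.lTensor H t))) =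
      f (QuasiBialgebra.leg123 s * Q.leg12_3_4 t) := by
    intro s t
    induction t using tensor_induction₃ with
    | h0 => simp only [map_zero, mul_zero, tensor₄_mul_zero]
    | hadd x y hx hy => simp only [map_add, mul_add, tensor₄_mul_add, hx, hy]
    | h y1 y2 y3 =>
    induction s using tensor_induction₃ with
    | h0 => simp only [map_zero, zero_mul, tensor₄_zero_mul]
    | hadd x y hx hy => simp only [map_add, add_mul, tensor₄_add_mul, hx, hy]
    | h x1 x2 x3 =>
    rw [(Q.leg_tmul _ _ _).2.1, (Q.leg_tmul _ _ _).2.2.2.2, LinearMap.lTensor_tmul,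
      LinearMap.rTensor_tmul, AlgHom.toLinearMap_apply]
    generalize Q.Δ y1 = d
    refine TensorProduct.induction_on d ?_ (fun a b => ?_) (fun x y hx hy => ?_)
    · simp only [TensorProduct.zero_tmul, map_zero, mul_zero, tensor₄_mul_zero]
    · simp [f, ψ, mul_assoc]
    · simp only [TensorProduct.add_tmul, map_add, mul_add, tensor₄_mul_add, hx, hy]
  have h1 : ∀ (t : H ⊗[k] (H ⊗[k] (H ⊗[k] H))) (a b c : H),
      f (Q.leg1_23_4 (a ⊗ₜ (b ⊗ₜ c)) * t) = Q.ε b • f (Q.leg1_23_4 (a ⊗ₜ (1 ⊗ₜ c)) * t) := by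
    intro t a b c
    rw [(Q.leg_tmul _ _ _).2.2.1, (Q.leg_tmul _ _ _).2.2.1]
    induction t using tensor_induction₄ with
    | h0 => simp only [map_zero, tensor₄_mul_zero, smul_zero]
    | hadd x y hx hy => simp only [map_add, tensor₄_mul_add, smul_add, hx, hy]
    | h t1 t2 t3 t4 =>
    have key : ∀ d : H ⊗[k] H, f ((a ⊗ₜ TensorProduct.assoc k H H H (d ⊗ₜ c)) *
        (t1 ⊗ₜ (t2 ⊗ₜ (t3 ⊗ₜ t4)))) =
        (a * t1) ⊗ₜ (Q.contractα (d * (t2 ⊗ₜ t3)) * (Q.β * Q.S (c * t4))) := by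
      intro d
      refine TensorProduct.induction_on d ?_ (fun a b => ?_) (fun x y hx hy => ?_)
      · simp only [TensorProduct.zero_tmul, map_zero, TensorProduct.tmul_zero, zero_mul,
          tensor₄_zero_mul]
      · simp [f, ψ, mul_assoc]
      · simp only [TensorProduct.add_tmul, map_add, TensorProduct.tmul_add, add_mul,
          tensor₄_add_mul, hx, hy]
    rw [key, key, contractα_Δ_mul, contractα_Δ_mul]
    simp
  have h2 : ∀ (t : H ⊗[k] (H ⊗[k] (H ⊗[k] H))) (a b c : H),
      f (t * Q.leg1_2_34 (a ⊗ₜ (b ⊗ₜ c))) = Q.ε c • f (t * Q.leg1_2_34 (a ⊗ₜ (b ⊗ₜ 1))) := by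
    intro t a b c
    rw [(Q.leg_tmul _ _ _).2.2.2.1, (Q.leg_tmul _ _ _).2.2.2.1]
    induction t using tensor_induction₄ with
    | h0 => simp only [map_zero, tensor₄_zero_mul, smul_zero]
    | hadd x y hx hy => simp only [map_add, tensor₄_add_mul, smul_add, hx, hy]
    | h t1 t2 t3 t4 =>
    have key : ∀ d : H ⊗[k] H, f ((t1 ⊗ₜ (t2 ⊗ₜ (t3 ⊗ₜ t4))) * (a ⊗ₜ (b ⊗ₜ d))) =
        (t1 * a) ⊗ₜ (Q.S (t2 * b) * (Q.α * Q.contractβ ((t3 ⊗ₜ t4) * d))) := by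
      intro d
      simp [f, ψ]
    rw [key, key, contractβ_mul_Δ, contractβ_mul_Δ]
    simp
  have h3 : f (QuasiBialgebra.leg234 Q.Φinv) = 1 := by
    have := Q.antipode_Φinv
    change (1 : H) ⊗ₜ ψ Q.Φinv = 1
    have e : ψ Q.Φinv = 1 := by
      rw [← this]
      change ψ Q.Φinv = LinearMap.mul' k H (TensorProduct.map Q.S.toLinearMap _ Q.Φinv)
      generalize Q.Φinv = t
      induction t using tensor_induction₃ with
      | h0 => simp only [map_zero]
      | hadd x y hx hy => simp only [map_add, hx, hy]
      | h x y z => simp [ψ, mul_assoc]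
    rw [e]
    rfl
  have h4 : Q.eMap Q.pElem = f (QuasiBialgebra.leg123 Q.Φ * Q.leg12_3_4 Q.Φinv) := e Q.Φ Q.Φinv
  rw [h4, Q.pentagon_inv.1, (Q.contract_mid_left (h1 _)).2, (Q.contract_last_right (h2 _)).1, h3]

/-- `X¹₁x¹ ⊗ X¹₂x² ⊗ S(X²x³)αX³ = X¹ ⊗ Y¹X²₁ ⊗ S(Y²X²₂)αY³X³` -/
theorem contractα_leg12_3_4_mul_leg123 :
    (Q.contractα.lTensor H).lTensor H (Q.leg12_3_4 Q.Φ * QuasiBialgebra.leg123 Q.Φinv) =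
      Q.eMap.lTensor H Q.Φ := by
  have h2 : ∀ (t : H ⊗[k] (H ⊗[k] (H ⊗[k] H))) (a b c : H),
      (Q.contractα.lTensor H).lTensor H (Q.leg1_2_34 (a ⊗ₜ (b ⊗ₜ c)) * t) =
        Q.ε c • (Q.contractα.lTensor H).lTensor H (Q.leg1_2_34 (a ⊗ₜ (b ⊗ₜ 1)) * t) := by
    intro t a b c
    rw [(Q.leg_tmul _ _ _).2.2.2.1, (Q.leg_tmul _ _ _).2.2.2.1]
    induction t using tensor_induction₄ with
    | h0 => simp only [map_zero, tensor₄_mul_zero, smul_zero]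
    | hadd x y hx hy => simp only [map_add, tensor₄_mul_add, smul_add, hx, hy]
    | h t1 t2 t3 t4 =>
    have key : ∀ d : H ⊗[k] H, (Q.contractα.lTensor H).lTensor H
        ((a ⊗ₜ (b ⊗ₜ d)) * (t1 ⊗ₜ (t2 ⊗ₜ (t3 ⊗ₜ t4)))) =
        (a * t1) ⊗ₜ ((b * t2) ⊗ₜ Q.contractα (d * (t3 ⊗ₜ t4))) := by
      intro d
      simp
    rw [key, key, contractα_Δ_mul, contractα_Δ_mul]
    simp
  have h3 : ∀ t : H ⊗[k] (H ⊗[k] H), (Q.contractα.lTensor H).lTensor H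
      (QuasiBialgebra.leg234 Q.Φ * Q.leg1_23_4 t) = Q.eMap.lTensor H t := by
    intro t
    induction t using tensor_induction₃ with
    | h0 => simp only [map_zero, tensor₄_mul_zero]
    | hadd x y hx hy => simp only [map_add, tensor₄_mul_add, hx, hy]
    | h a b c =>
    rw [(Q.leg_tmul _ _ _).2.2.1, LinearMap.lTensor_tmul, eMap_tmul]
    change (Q.contractα.lTensor H).lTensor H ((1 ⊗ₜ (Q.Φ : H ⊗[k] (H ⊗[k] H))) * _) = _
    rw [tensor₄_tmul_mul_tmul, one_mul, LinearMap.lTensor_tmul]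
  rw [Q.pentagon_inv.2.1, (Q.contract_last_left (h2 _)).2, h3]

end QuasiHopfAlgebra

namespace QuasiHopfAlgebra

variable {k H V : Type*} [Field k] [Ring H] [Algebra k H] [AddCommGroup V] [Module k V]
  (Q : QuasiHopfAlgebra k H)

/-- `Y¹ ⊗ Y² ⊗ Y³ = X¹x¹₁ ⊗ S(X²x¹₂)αX³x² ⊗ S(x³)` for the element `Y` that defines the product
of `B^v`. -/
theorem elemMul_eq : Q.elemMul = TensorProduct.assoc k H H H
    (TensorProduct.map Q.eMap Q.S.toLinearMap ((TensorProduct.assoc k H H H).symm Q.Φinv)) := by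
  let f : H ⊗[k] (H ⊗[k] (H ⊗[k] H)) →ₗ[k] H ⊗[k] (H ⊗[k] H) := LinearMap.lTensor H
    (TensorProduct.map Q.contractα Q.S.toLinearMap ∘ₗ
      (TensorProduct.assoc k H H H).symm.toLinearMap)
  have h0 : Q.elemMul = f (QuasiBialgebra.leg234 Q.Φinv * Q.leg1_2_34 Q.Φ) := rfl
  have h1 : ∀ (t : H ⊗[k] (H ⊗[k] (H ⊗[k] H))) (a b c : H),
      f (Q.leg1_23_4 (a ⊗ₜ (b ⊗ₜ c)) * t) = Q.ε b • f (Q.leg1_23_4 (a ⊗ₜ (1 ⊗ₜ c)) * t) := by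
    intro t a b c
    rw [(Q.leg_tmul _ _ _).2.2.1, (Q.leg_tmul _ _ _).2.2.1]
    induction t using tensor_induction₄ with
    | h0 => simp only [map_zero, tensor₄_mul_zero, smul_zero]
    | hadd x y hx hy => simp only [map_add, tensor₄_mul_add, smul_add, hx, hy]
    | h t1 t2 t3 t4 =>
    have key : ∀ d : H ⊗[k] H, f ((a ⊗ₜ TensorProduct.assoc k H H H (d ⊗ₜ c)) *
        (t1 ⊗ₜ (t2 ⊗ₜ (t3 ⊗ₜ t4)))) =
        (a * t1) ⊗ₜ (Q.contractα (d * (t2 ⊗ₜ t3)) ⊗ₜ Q.S (c * t4)) := by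
      intro d
      refine TensorProduct.induction_on d ?_ (fun a b => ?_) (fun x y hx hy => ?_)
      · simp only [TensorProduct.zero_tmul, map_zero, TensorProduct.tmul_zero, zero_mul,
          tensor₄_zero_mul]
      · simp [f]
      · simp only [TensorProduct.add_tmul, map_add, TensorProduct.tmul_add, add_mul,
          tensor₄_add_mul, hx, hy]
    rw [key, key, contractα_Δ_mul, contractα_Δ_mul]
    simp [← TensorProduct.smul_tmul']
  have h2 : ∀ t : H ⊗[k] (H ⊗[k] H), f (QuasiBialgebra.leg123 Q.Φ * Q.leg12_3_4 t) =
      TensorProduct.assoc k H H H (TensorProduct.map Q.eMap Q.S.toLinearMap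
        ((TensorProduct.assoc k H H H).symm t)) := by
    intro t
    induction t using tensor_induction₃ with
    | h0 => simp only [map_zero, tensor₄_mul_zero]
    | hadd x y hx hy => simp only [map_add, tensor₄_mul_add, hx, hy]
    | h y1 y2 y3 =>
    rw [(Q.leg_tmul _ _ _).2.2.2.2, TensorProduct.assoc_symm_tmul, TensorProduct.map_tmul,
      eMap_tmul]
    generalize Q.Δ y1 = d
    generalize (Q.Φ : H ⊗[k] (H ⊗[k] H)) = s
    refine TensorProduct.induction_on d ?_ (fun a b => ?_) (fun x y hx hy => ?_)
    · simp only [TensorProduct.zero_tmul, map_zero, mul_zero, tensor₄_mul_zero]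
    · induction s using tensor_induction₃ with
      | h0 => simp only [map_zero, zero_mul, TensorProduct.zero_tmul, tensor₄_zero_mul]
      | hadd x y hx hy =>
        simp only [map_add, add_mul, TensorProduct.add_tmul, tensor₄_add_mul, hx, hy]
      | h x1 x2 x3 =>
      rw [(Q.leg_tmul _ _ _).2.1]
      simp [f]
    · simp only [TensorProduct.add_tmul, map_add, mul_add, tensor₄_mul_add, hx, hy]
  rw [h0, Q.pentagon_inv.2.2.1, (Q.contract_mid_left (h1 _)).1, h2]

/-! ### The element `δ` and the twist `f⁻¹` -/

/-- `a ⊗ b ⊗ c ↦ Δ(a) p (βS(c) ⊗ S(b))` -/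
def δMap (p : H ⊗[k] H) : H ⊗[k] (H ⊗[k] H) →ₗ[k] H ⊗[k] H :=
  TensorProduct.lift ((LinearMap.mul k (H ⊗[k] H)).compl₁₂
    (LinearMap.mulRight k p ∘ₗ Q.Δ.toLinearMap)
    (LinearMap.mulLeft k (Q.β ⊗ₜ 1) ∘ₗ TensorProduct.map Q.S.toLinearMap Q.S.toLinearMap ∘ₗ
      (TensorProduct.comm k H H).toLinearMap))

theorem δMap_tmul (p w : H ⊗[k] H) (a : H) : Q.δMap p (a ⊗ₜ w) = Q.Δ a * p * ((Q.β ⊗ₜ 1) *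
    TensorProduct.map Q.S.toLinearMap Q.S.toLinearMap (TensorProduct.comm k H H w)) := rfl

theorem elemδ_eq : Q.elemδ = Q.δMap Q.pElem Q.Φ := by
  let f : H ⊗[k] (H ⊗[k] (H ⊗[k] H)) →ₗ[k] H ⊗[k] H :=
    TensorProduct.map Q.contractβ Q.contractβ ∘ₗ
      (TensorProduct.assoc k H H (H ⊗[k] H)).symm.toLinearMap ∘ₗ
        LinearMap.lTensor H (TensorProduct.comm k (H ⊗[k] H) H).toLinearMap ∘ₗ
          LinearMap.lTensor H (TensorProduct.assoc k H H H).symm.toLinearMap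
  have h0 : Q.elemδ = f (Q.leg12_3_4 Q.Φ * QuasiBialgebra.leg123 Q.Φinv) := rfl
  have h1 : ∀ s t, f (Q.leg12_3_4 s * QuasiBialgebra.leg123 t) =
      Q.δMap (Q.contractβ.lTensor H t) s := by
    intro s t
    induction s using tensor_induction₃ with
    | h0 => simp only [map_zero, tensor₄_zero_mul]
    | hadd x y hx hy => simp only [map_add, tensor₄_add_mul, hx, hy]
    | h x1 x2 x3 =>
    rw [(Q.leg_tmul _ _ _).2.2.2.2, δMap_tmul]
    generalize Q.Δ x1 = d
    refine TensorProduct.induction_on d ?_ (fun a b => ?_) (fun x y hx hy => ?_)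
    · simp only [TensorProduct.zero_tmul, map_zero, zero_mul, tensor₄_zero_mul]
    · induction t using tensor_induction₃ with
      | h0 => simp only [map_zero, mul_zero, zero_mul, tensor₄_mul_zero]
      | hadd x y hx hy => simp only [map_add, mul_add, add_mul, tensor₄_mul_add, hx, hy]
      | h y1 y2 y3 =>
      rw [(Q.leg_tmul _ _ _).2.1]
      simp [f, mul_assoc, Q.S_mul]
    · simp only [TensorProduct.add_tmul, map_add, add_mul, tensor₄_add_mul, hx, hy]
  rw [h0, h1, pElem]

/-- `a ⊗ b ↦ Δ(a) δ (S ⊗ S)(Δᶜᵒᵖ(b))` -/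
def contractδ : H ⊗[k] H →ₗ[k] H ⊗[k] H :=
  TensorProduct.lift ((LinearMap.mul k (H ⊗[k] H)).compl₁₂
    (LinearMap.mulRight k Q.elemδ ∘ₗ Q.Δ.toLinearMap) Q.Scop)

@[simp]
theorem contractδ_tmul (a b : H) : Q.contractδ (a ⊗ₜ b) = Q.Δ a * Q.elemδ * Q.Scop b := rfl

/-- `Δ(h₁) δ (S ⊗ S)(Δᶜᵒᵖ(h₂)) = ε(h)δ` -/
theorem contractδ_Δ (h : H) : Q.contractδ (Q.Δ h) = Q.ε h • Q.elemδ := by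
  have h1 : ∀ d t, TensorProduct.lift ((LinearMap.mul k (H ⊗[k] H)).compl₁₂
      (LinearMap.mulRight k (Q.δMap Q.pElem t) ∘ₗ Q.Δ.toLinearMap) Q.Scop) d =
      Q.δMap Q.pElem (Q.Δ.toLinearMap.lTensor H d * t) := by
    intro d t
    refine TensorProduct.induction_on d (by simp) (fun a b => ?_)
      (fun x y hx hy => by simp only [map_add, add_mul, hx, hy])
    refine TensorProduct.induction_on t (by simp) (fun c w => ?_)
      (fun x y hx hy => by
        simp only [TensorProduct.lift.tmul, LinearMap.compl₁₂_apply, LinearMap.comp_apply,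
          LinearMap.mulRight_apply, map_add, LinearMap.add_apply, mul_add] at hx hy ⊢
        rw [hx, hy])
    simp only [TensorProduct.lift.tmul, LinearMap.compl₁₂_apply, LinearMap.comp_apply,
      LinearMap.mulRight_apply, LinearMap.mul_apply', LinearMap.lTensor_tmul, δMap_tmul,
      AlgHom.toLinearMap_apply, Algebra.TensorProduct.tmul_mul_tmul, map_mul, map_S_comm_mul,
      mul_assoc]
    rfl
  let g : H ⊗[k] (H ⊗[k] H) →ₗ[k] H →ₗ[k] H ⊗[k] H := TensorProduct.lift (LinearMap.mk₂ k
    (fun c w => LinearMap.mulLeft k (Q.Δ c * Q.pElem) ∘ₗ LinearMap.mulRight k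
      (TensorProduct.map Q.S.toLinearMap Q.S.toLinearMap (TensorProduct.comm k H H w)) ∘ₗ
        (TensorProduct.mk k H H).flip 1)
    (by intros; ext; simp [add_mul, mul_assoc]) (by intros; ext; simp [mul_assoc])
    (by intros; ext; simp [mul_add]) (by intros; ext; simp))
  have hg : ∀ c w r, g (c ⊗ₜ w) r = Q.Δ c * Q.pElem * ((r ⊗ₜ 1) *
      TensorProduct.map Q.S.toLinearMap Q.S.toLinearMap (TensorProduct.comm k H H w)) :=
    fun _ _ _ => rfl
  have h2 : ∀ d t, Q.δMap Q.pElem (t * TensorProduct.assoc k H H H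
      (Q.Δ.toLinearMap.rTensor H d)) = g t (Q.contractβ d) := by
    intro d t
    refine TensorProduct.induction_on d (by simp) (fun a b => ?_)
      (fun x y hx hy => by simp only [map_add, mul_add, hx, hy])
    refine TensorProduct.induction_on t (by simp) (fun c w => ?_)
      (fun x y hx hy => by simp only [map_add, LinearMap.add_apply, add_mul, hx, hy])
    have h3 : ∀ e : H ⊗[k] H, Q.δMap Q.pElem ((c ⊗ₜ w) * TensorProduct.assoc k H H H (e ⊗ₜ b)) =
        Q.Δ c * (TensorProduct.lift ((LinearMap.mul k (H ⊗[k] H)).compl₁₂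
          (LinearMap.mulRight k Q.pElem ∘ₗ Q.Δ.toLinearMap) (TensorProduct.mk k H H 1))
          (Q.S.toLinearMap.lTensor H e)) * (((Q.β * Q.S b) ⊗ₜ 1) *
          TensorProduct.map Q.S.toLinearMap Q.S.toLinearMap (TensorProduct.comm k H H w)) := by
      intro e
      refine TensorProduct.induction_on e (by simp) (fun x y => ?_)
        (fun x y hx hy => by
          simp only [TensorProduct.add_tmul, map_add, add_mul, mul_add, hx, hy])
      have h4 : ((Q.β * Q.S b) ⊗ₜ[k] Q.S y) = ((1 : H) ⊗ₜ[k] Q.S y) * ((Q.β * Q.S b) ⊗ₜ[k] 1) := by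
        simp
      simp only [TensorProduct.assoc_tmul, Algebra.TensorProduct.tmul_mul_tmul, δMap_tmul,
        map_mul, map_S_comm_mul, LinearMap.lTensor_tmul, TensorProduct.lift.tmul,
        LinearMap.compl₁₂_apply, LinearMap.comp_apply, LinearMap.mulRight_apply,
        LinearMap.mul_apply', TensorProduct.comm_tmul, TensorProduct.map_tmul,
        AlgHom.toLinearMap_apply, TensorProduct.mk_apply, mul_assoc, LinearEquiv.coe_coe]
      rw [← mul_assoc (Q.β ⊗ₜ[k] (1 : H)), Algebra.TensorProduct.tmul_mul_tmul, one_mul, h4]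
      simp only [mul_assoc]
    rw [LinearMap.rTensor_tmul, AlgHom.toLinearMap_apply, h3]
    change Q.Δ c * Q.pMap (Q.S.toLinearMap.lTensor H (Q.Δ a)) * _ = _
    rw [pMap_Δ, hg, contractβ_tmul]
    simp only [mul_assoc]
    rw [← mul_assoc (a ⊗ₜ[k] (1 : H)), Algebra.TensorProduct.tmul_mul_tmul, one_mul]
  have h5 : Q.contractδ (Q.Δ h) = Q.δMap Q.pElem (Q.ΔR h * Q.Φ) := by
    rw [contractδ, elemδ_eq]
    exact h1 _ _
  have h6 : Q.δMap Q.pElem (Q.Φ * Q.ΔL h) = g Q.Φ (Q.contractβ (Q.Δ h)) := h2 _ _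
  have h7 : ∀ t, g t Q.β = Q.δMap Q.pElem t := fun t =>
    TensorProduct.induction_on t (by simp) (fun c w => rfl)
      (fun x y hx hy => by simp only [map_add, LinearMap.add_apply, hx, hy])
  rw [h5, Q.ΔR_mul_Φ, h6, contractβ_Δ, map_smul, h7, elemδ_eq]

theorem contractδ_mul_Δ (h : H) (t : H ⊗[k] H) :
    Q.contractδ (t * Q.Δ h) = Q.ε h • Q.contractδ t := by
  refine TensorProduct.induction_on t (by simp) (fun a b => ?_)
    (fun x y hx hy => by simp only [add_mul, map_add, hx, hy, smul_add])
  have : ∀ d : H ⊗[k] H, Q.contractδ ((a ⊗ₜ b) * d) = Q.Δ a * Q.contractδ d * Q.Scop b := fun d =>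
    TensorProduct.induction_on d (by simp) (fun x y => by simp [Scop_mul, mul_assoc])
      (fun x y hx hy => by simp only [add_mul, mul_add, map_add, hx, hy])
  rw [this, contractδ_Δ]
  simp

theorem contractδ_tmul_mul (a : H) (t : H ⊗[k] H) :
    Q.contractδ ((a ⊗ₜ 1) * t) = Q.Δ a * Q.contractδ t := by
  refine TensorProduct.induction_on t (by simp) (fun a b => ?_)
    (fun x y hx hy => by simp only [mul_add, map_add, hx, hy])
  simp [mul_assoc]

theorem fInv_eq : Q.fInv = Q.contractδ (Q.contractα.rTensor H
    ((TensorProduct.assoc k H H H).symm Q.Φinv)) := by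
  rw [fInv]
  generalize (TensorProduct.assoc k H H H).symm Q.Φinv = t
  refine TensorProduct.induction_on t (by simp) (fun a b => ?_)
    (fun x y hx hy => by simp only [map_add, hx, hy])
  rfl

/-- `Δ(S(h)) f⁻¹ = f⁻¹ (S ⊗ S)(Δᶜᵒᵖ(h))` -/
theorem Δ_S_mul_fInv (h : H) : Q.Δ (Q.S h) * Q.fInv = Q.fInv * Q.Scop h := by
  let f : H ⊗[k] (H ⊗[k] H) →ₗ[k] H ⊗[k] H := Q.contractδ ∘ₗ Q.contractα.rTensor H ∘ₗ
    (TensorProduct.assoc k H H H).symm.toLinearMap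
  have hf : Q.fInv = f Q.Φinv := Q.fInv_eq
  have hp : ∀ x y z, f (x ⊗ₜ (y ⊗ₜ z)) = Q.contractδ (Q.contractα (x ⊗ₜ y) ⊗ₜ z) :=
    fun _ _ _ => rfl
  have h1 : ∀ a b t, f (t * (a ⊗ₜ Q.Δ b)) = Q.ε b • (Q.Δ (Q.S a) * f t) := by
    intro a b t
    induction t using tensor_induction₃ with
    | h0 => simp only [map_zero, zero_mul, mul_zero, smul_zero]
    | hadd x y hx hy => simp only [map_add, add_mul, mul_add, smul_add, hx, hy]
    | h x y z =>
    have : ∀ d : H ⊗[k] H, f ((x ⊗ₜ (y ⊗ₜ z)) * (a ⊗ₜ d)) =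
        Q.contractδ (((Q.S a * Q.contractα (x ⊗ₜ y)) ⊗ₜ z) * d) := fun d =>
      TensorProduct.induction_on d (by simp) (fun c e => by simp [hp, mul_assoc, Q.S_mul])
        (fun x y hx hy => by simp only [TensorProduct.tmul_add, mul_add, map_add, hx, hy])
    rw [this, contractδ_mul_Δ, hp]
    simp [mul_assoc]
  have h2 : ∀ a b t, f (TensorProduct.assoc k H H H (Q.Δ a ⊗ₜ b) * t) =
      Q.ε a • (f t * Q.Scop b) := by
    intro a b t
    induction t using tensor_induction₃ with
    | h0 => simp only [map_zero, zero_mul, mul_zero, smul_zero]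
    | hadd x y hx hy => simp only [map_add, add_mul, mul_add, smul_add, hx, hy]
    | h x y z =>
    have : ∀ d : H ⊗[k] H, f (TensorProduct.assoc k H H H (d ⊗ₜ b) * (x ⊗ₜ (y ⊗ₜ z))) =
        Q.contractδ (Q.contractα (d * (x ⊗ₜ y)) ⊗ₜ (b * z)) := fun d =>
      TensorProduct.induction_on d (by simp) (fun c e => by simp [hp])
        (fun x y hx hy => by
          simp only [TensorProduct.add_tmul, add_mul, map_add, hx, hy])
    rw [this, contractα_Δ_mul, hp]
    simp [Scop_mul, mul_assoc]
  let g1 : H ⊗[k] H →ₗ[k] H ⊗[k] H :=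
    f ∘ₗ LinearMap.mulLeft k Q.Φinv ∘ₗ Q.Δ.toLinearMap.lTensor H
  have e1 : g1 (Q.Δ h) = g1 (h ⊗ₜ 1) := Q.apply_Δ_right (fun a b => by
    change f (Q.Φinv * (a ⊗ₜ Q.Δ b)) = _ • f (Q.Φinv * (a ⊗ₜ Q.Δ 1))
    rw [h1, h1]; simp) h
  let g2 : H ⊗[k] H →ₗ[k] H ⊗[k] H :=
    f ∘ₗ LinearMap.mulRight k Q.Φinv ∘ₗ (TensorProduct.assoc k H H H).toLinearMap ∘ₗ
      Q.Δ.toLinearMap.rTensor H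
  have e2 : g2 (Q.Δ h) = g2 (1 ⊗ₜ h) := Q.apply_Δ_left (fun a b => by
    change f (TensorProduct.assoc k H H H (Q.Δ a ⊗ₜ b) * Q.Φinv) =
      _ • f (TensorProduct.assoc k H H H (Q.Δ 1 ⊗ₜ b) * Q.Φinv)
    rw [h2, h2]; simp) h
  have e3 : g1 (Q.Δ h) = g2 (Q.Δ h) := congrArg f (Q.Φinv_mul_ΔR h)
  rw [e1, e2] at e3
  change f (Q.Φinv * (h ⊗ₜ Q.Δ 1)) = f (TensorProduct.assoc k H H H (Q.Δ 1 ⊗ₜ h) * Q.Φinv) at e3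
  rw [h1, h2] at e3
  simpa [hf] using e3

/-- `Δ(β) f⁻¹ = δ` -/
theorem Δ_β_mul_fInv : Q.Δ Q.β * Q.fInv = Q.elemδ := by
  let ω : H ⊗[k] (H ⊗[k] (H ⊗[k] H)) →ₗ[k] H ⊗[k] H :=
    (LinearMap.mul' k H).rTensor H ∘ₗ (TensorProduct.assoc k H H H).symm.toLinearMap ∘ₗ
      TensorProduct.map (LinearMap.mulRight k Q.β)
        (Q.contractα.rTensor H ∘ₗ (TensorProduct.assoc k H H H).symm.toLinearMap)
  let f : H ⊗[k] (H ⊗[k] (H ⊗[k] H)) →ₗ[k] H ⊗[k] H := Q.contractδ ∘ₗ ω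
  have hp : ∀ a b c d, f (a ⊗ₜ (b ⊗ₜ (c ⊗ₜ d))) =
      Q.contractδ ((a * Q.β * Q.contractα (b ⊗ₜ c)) ⊗ₜ d) := fun _ _ _ _ => rfl
  have h0 : Q.Δ Q.β * Q.fInv = f (QuasiBialgebra.leg234 Q.Φinv) := by
    rw [fInv_eq, ← contractδ_tmul_mul]
    generalize Q.Φinv = t
    induction t using tensor_induction₃ with
    | h0 => simp only [map_zero, mul_zero]
    | hadd x y hx hy => simp only [map_add, mul_add, hx, hy]
    | h x y z =>
    rw [(Q.leg_tmul _ _ _).1, hp]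
    simp
  have h1 : ∀ (t : H ⊗[k] (H ⊗[k] (H ⊗[k] H))) (a b c : H),
      f (Q.leg1_23_4 (a ⊗ₜ (b ⊗ₜ c)) * t) = Q.ε b • f (Q.leg1_23_4 (a ⊗ₜ (1 ⊗ₜ c)) * t) := by
    intro t a b c
    rw [(Q.leg_tmul _ _ _).2.2.1, (Q.leg_tmul _ _ _).2.2.1]
    induction t using tensor_induction₄ with
    | h0 => simp only [map_zero, tensor₄_mul_zero, smul_zero]
    | hadd x y hx hy => simp only [map_add, tensor₄_mul_add, smul_add, hx, hy]
    | h t1 t2 t3 t4 =>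
    have key : ∀ d : H ⊗[k] H, f ((a ⊗ₜ TensorProduct.assoc k H H H (d ⊗ₜ c)) *
        (t1 ⊗ₜ (t2 ⊗ₜ (t3 ⊗ₜ t4)))) =
        Q.contractδ ((a * t1 * Q.β * Q.contractα (d * (t2 ⊗ₜ t3))) ⊗ₜ (c * t4)) := by
      intro d
      refine TensorProduct.induction_on d ?_ (fun a b => ?_) (fun x y hx hy => ?_)
      · simp only [TensorProduct.zero_tmul, map_zero, TensorProduct.tmul_zero, zero_mul,
          tensor₄_zero_mul, mul_zero]
      · rw [TensorProduct.assoc_tmul, tensor₄_tmul_mul_tmul, Algebra.TensorProduct.tmul_mul_tmul,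
          Algebra.TensorProduct.tmul_mul_tmul, hp, Algebra.TensorProduct.tmul_mul_tmul]
      · simp only [TensorProduct.add_tmul, map_add, TensorProduct.tmul_add, add_mul, mul_add,
          tensor₄_add_mul, hx, hy]
    rw [key, key, contractα_Δ_mul, contractα_Δ_mul]
    simp
  have h2 : ∀ (t : H ⊗[k] (H ⊗[k] (H ⊗[k] H))) (a b c : H),
      f (t * Q.leg1_2_34 (a ⊗ₜ (b ⊗ₜ c))) = Q.ε c • f (t * Q.leg1_2_34 (a ⊗ₜ (b ⊗ₜ 1))) := by
    intro t a b c
    rw [(Q.leg_tmul _ _ _).2.2.2.1, (Q.leg_tmul _ _ _).2.2.2.1]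
    induction t using tensor_induction₄ with
    | h0 => simp only [map_zero, tensor₄_zero_mul, smul_zero]
    | hadd x y hx hy => simp only [map_add, tensor₄_add_mul, smul_add, hx, hy]
    | h t1 t2 t3 t4 =>
    have key : ∀ d : H ⊗[k] H, f ((t1 ⊗ₜ (t2 ⊗ₜ (t3 ⊗ₜ t4))) * (a ⊗ₜ (b ⊗ₜ d))) =
        Q.contractδ (((t1 * a * Q.β * Q.contractα ((t2 * b) ⊗ₜ t3)) ⊗ₜ t4) * d) := by
      intro d
      refine TensorProduct.induction_on d ?_ (fun a b => ?_) (fun x y hx hy => ?_)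
      · simp only [map_zero, TensorProduct.tmul_zero, tensor₄_mul_zero, mul_zero]
      · rw [tensor₄_tmul_mul_tmul, Algebra.TensorProduct.tmul_mul_tmul,
          Algebra.TensorProduct.tmul_mul_tmul, hp, Algebra.TensorProduct.tmul_mul_tmul]
        simp [mul_assoc]
      · simp only [map_add, TensorProduct.tmul_add, mul_add, tensor₄_mul_add, hx, hy]
    rw [key, key, contractδ_mul_Δ, contractδ_mul_Δ]
    simp
  have h3 : ∀ s y1 y2 y3, f (QuasiBialgebra.leg123 s * Q.leg12_3_4 (y1 ⊗ₜ (y2 ⊗ₜ y3))) =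
      Q.ε y1 • Q.contractδ ((LinearMap.mul' k H (TensorProduct.map (LinearMap.mulRight k Q.β)
        Q.contractα s) * y2) ⊗ₜ y3) := by
    intro s y1 y2 y3
    rw [(Q.leg_tmul _ _ _).2.2.2.2]
    induction s using tensor_induction₃ with
    | h0 => simp only [map_zero, zero_mul, TensorProduct.zero_tmul, tensor₄_zero_mul, smul_zero]
    | hadd x y hx hy =>
      simp only [map_add, add_mul, TensorProduct.add_tmul, tensor₄_add_mul, hx, hy, smul_add]
    | h x1 x2 x3 =>
    rw [(Q.leg_tmul _ _ _).2.1]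
    have key : ∀ d : H ⊗[k] H, f ((x1 ⊗ₜ (x2 ⊗ₜ (x3 ⊗ₜ 1))) *
        TensorProduct.assoc k H H (H ⊗[k] H) (d ⊗ₜ (y2 ⊗ₜ y3))) =
        Q.contractδ ((x1 * Q.contractβ d * Q.contractα (x2 ⊗ₜ x3) * y2) ⊗ₜ y3) := by
      intro d
      refine TensorProduct.induction_on d ?_ (fun a b => ?_) (fun x y hx hy => ?_)
      · simp only [TensorProduct.zero_tmul, map_zero, tensor₄_mul_zero, mul_zero, zero_mul]
      · rw [TensorProduct.assoc_tmul, tensor₄_tmul_mul_tmul, Algebra.TensorProduct.tmul_mul_tmul,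
          Algebra.TensorProduct.tmul_mul_tmul, hp]
        simp [mul_assoc, Q.S_mul]
      · simp only [TensorProduct.add_tmul, map_add, mul_add, add_mul, tensor₄_mul_add, hx, hy]
    rw [key, contractβ_Δ]
    simp [mul_assoc]
  have h4 : LinearMap.mul' k H (TensorProduct.map (LinearMap.mulRight k Q.β) Q.contractα Q.Φ) = 1 :=
    Q.antipode_Φ
  have h5 := (Q.apply_Φ_left (g := f ∘ₗ tensor₄MulLeft (QuasiBialgebra.leg123 Q.Φ) ∘ₗ
    Q.leg12_3_4.toLinearMap) (fun a b c => by
      change f (_ * Q.leg12_3_4 _) = _ • f (_ * Q.leg12_3_4 _)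
      rw [h3, h3]
      simp)).2
  have h6 : f (QuasiBialgebra.leg123 Q.Φ * Q.leg12_3_4 Q.Φinv) = Q.elemδ := by
    refine h5.trans ?_
    change f (_ * Q.leg12_3_4 (1 ⊗ₜ (1 ⊗ₜ 1))) = _
    rw [h3, h4]
    simp [Scop_one]
  rw [h0, Q.pentagon_inv.2.2.2, (Q.contract_mid_left (h1 _)).1, (Q.contract_last_right (h2 _)).2,
    h6]

end QuasiHopfAlgebra

namespace QuasiHopfAlgebra

variable {k H V : Type*} [Field k] [Ring H] [Algebra k H] [AddCommGroup V] [Module k V]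
  (Q : QuasiHopfAlgebra k H)

/-! ### The element that defines the coaction of `B^v` -/

/-- `b ⊗ c ↦ S(b₂)S(X²)αX³c ⊗ S(b₁)S(X¹)` -/
def kMap : H ⊗[k] H →ₗ[k] H ⊗[k] H :=
  (TensorProduct.comm k H H).toLinearMap ∘ₗ Q.S.toLinearMap.rTensor H ∘ₗ Q.eMap

theorem kMap_tmul_mul (x b c : H) : Q.kMap ((b * x) ⊗ₜ c) = Q.Scop x * Q.kMap (b ⊗ₜ c) := by
  have e : ∀ (s : H ⊗[k] (H ⊗[k] H)) (d d' : H ⊗[k] H), TensorProduct.comm k H H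
      (Q.S.toLinearMap.rTensor H (Q.contractα.lTensor H (s * TensorProduct.assoc k H H H
        ((d * d') ⊗ₜ c)))) = TensorProduct.map Q.S.toLinearMap Q.S.toLinearMap
          (TensorProduct.comm k H H d') * TensorProduct.comm k H H (Q.S.toLinearMap.rTensor H
            (Q.contractα.lTensor H (s * TensorProduct.assoc k H H H (d ⊗ₜ c)))) := by
    intro s d d'
    induction s using tensor_induction₃ with
    | h0 => simp only [map_zero, zero_mul, mul_zero]
    | hadd x y hx hy => simp only [map_add, add_mul, mul_add, hx, hy]
    | h x1 x2 x3 =>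
    refine TensorProduct.induction_on d (by simp) (fun a b => ?_) (fun x y hx hy => by
      simp only [TensorProduct.add_tmul, map_add, add_mul, mul_add, hx, hy])
    refine TensorProduct.induction_on d' (by simp) (fun a b => ?_) (fun x y hx hy => by
      simp only [TensorProduct.add_tmul, map_add, add_mul, mul_add, hx, hy])
    simp [Q.S_mul, mul_assoc]
  have := e Q.Φ (Q.Δ b) (Q.Δ x)
  rw [← map_mul] at this
  exact this

theorem kMap_mul_tmul (b c e : H) : Q.kMap (b ⊗ₜ (c * e)) = Q.kMap (b ⊗ₜ c) * (e ⊗ₜ 1) := by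
  have h : ∀ t : H ⊗[k] H, TensorProduct.comm k H H (Q.S.toLinearMap.rTensor H (t * (1 ⊗ₜ e))) =
      TensorProduct.comm k H H (Q.S.toLinearMap.rTensor H t) * (e ⊗ₜ 1) := fun t =>
    TensorProduct.induction_on t (by simp) (fun a b => by simp)
      (fun x y hx hy => by simp only [map_add, add_mul, hx, hy])
  simp only [kMap, LinearMap.comp_apply, eMap_tmul, contractα_mul_assoc_tmul, LinearEquiv.coe_coe,
    h]

theorem kMap_Δ_mul (g : H) (t : H ⊗[k] H) :
    Q.kMap (Q.Δ g * t) = Q.kMap t * (1 ⊗ₜ Q.S g) := by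
  have h : ∀ t : H ⊗[k] H, TensorProduct.comm k H H (Q.S.toLinearMap.rTensor H ((g ⊗ₜ 1) * t)) =
      TensorProduct.comm k H H (Q.S.toLinearMap.rTensor H t) * (1 ⊗ₜ Q.S g) := fun t =>
    TensorProduct.induction_on t (by simp) (fun a b => by simp [Q.S_mul])
      (fun x y hx hy => by simp only [map_add, mul_add, add_mul, hx, hy])
  have h1 : Q.kMap (Q.Δ g) = Q.kMap 1 * (1 ⊗ₜ Q.S g) := by
    have e1 : Q.eMap 1 = Q.qElem := by
      have := Q.eMap_Δ 1
      rwa [map_one, ← Algebra.TensorProduct.one_def, one_mul] at this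
    simp only [kMap, LinearMap.comp_apply, LinearEquiv.coe_coe, eMap_Δ, h, e1]
  have h2 : ∀ (d : H ⊗[k] H) (x y : H), Q.kMap (d * (x ⊗ₜ y)) = Q.Scop x * Q.kMap d * (y ⊗ₜ 1) :=
    fun d x y => TensorProduct.induction_on d (by simp)
      (fun a b => by
        rw [Algebra.TensorProduct.tmul_mul_tmul, kMap_tmul_mul, kMap_mul_tmul, mul_assoc])
      (fun x y hx hy => by simp only [map_add, mul_add, add_mul, hx, hy])
  refine TensorProduct.induction_on t (by simp) (fun x y => ?_)
    (fun x y hx hy => by simp only [map_add, mul_add, add_mul, hx, hy])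
  have h3 := h2 1 x y
  rw [one_mul] at h3
  rw [h2, h1, h3]
  simp only [mul_assoc, Algebra.TensorProduct.tmul_mul_tmul, one_mul, mul_one]

theorem kMap_tmul (b c : H) : Q.kMap (b ⊗ₜ c) =
    Q.Scop b * TensorProduct.comm k H H (Q.S.toLinearMap.rTensor H Q.qElem) * (c ⊗ₜ 1) := by
  have e1 : Q.eMap (1 ⊗ₜ 1) = Q.qElem := by
    have := Q.eMap_Δ 1
    rwa [map_one, ← Algebra.TensorProduct.one_def, one_mul] at this
  have h1 := Q.kMap_tmul_mul b 1 c
  have h2 := Q.kMap_mul_tmul 1 1 c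
  rw [one_mul] at h1 h2
  rw [h1, h2, ← mul_assoc]
  congr 2
  rw [kMap, LinearMap.comp_apply, LinearMap.comp_apply, e1]
  rfl

/-- The part of the coaction of `B^v` to the right of `b₍₀₎`, in terms of `q = X¹ ⊗ S(X²)αX³`. -/
theorem lTensor_coactAux_midΔ (t : H ⊗[k] (H ⊗[k] H)) : Q.coactAux.lTensor H
      (((1 : H) ⊗ₜ[k] LinearMap.lTensor H ((TensorProduct.mk k H H).flip 1) Q.qR) * Q.midΔ t) =
    Q.kMap.lTensor H t := by
  induction t using tensor_induction₃ with
  | h0 => simp only [map_zero, tensor₄_mul_zero]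
  | hadd x y hx hy => simp only [map_add, tensor₄_mul_add, hx, hy]
  | h a b c =>
  have e : ∀ (s : H ⊗[k] (H ⊗[k] H)) (d : H ⊗[k] H), Q.coactAux (LinearMap.lTensor H
      ((TensorProduct.mk k H H).flip 1) (LinearMap.lTensor H (LinearMap.mul' k H ∘ₗ
      LinearMap.rTensor H (Q.S.symm.toLinearMap ∘ₗ LinearMap.mulLeft k Q.α) ∘ₗ
      (TensorProduct.comm k H H).toLinearMap) s) * TensorProduct.assoc k H H H (d ⊗ₜ c)) =
      TensorProduct.comm k H H (Q.S.toLinearMap.rTensor H (Q.contractα.lTensor H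
        (s * TensorProduct.assoc k H H H (d ⊗ₜ c)))) := by
    intro s d
    induction s using tensor_induction₃ with
    | h0 => simp only [map_zero, zero_mul]
    | hadd x y hx hy => simp only [map_add, add_mul, hx, hy]
    | h x1 x2 x3 =>
    refine TensorProduct.induction_on d (by simp) (fun a b => ?_) (fun x y hx hy => by
      simp only [TensorProduct.add_tmul, map_add, mul_add, hx, hy])
    simp [coactAux, Q.S_mul, mul_assoc]
  have e1 : Q.midΔ (a ⊗ₜ (b ⊗ₜ c)) = a ⊗ₜ TensorProduct.assoc k H H H (Q.Δ b ⊗ₜ c) := rfl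
  rw [e1, tensor₄_tmul_mul_tmul, one_mul, LinearMap.lTensor_tmul, LinearMap.lTensor_tmul]
  exact congrArg (fun z => a ⊗ₜ z) (e Q.Φ (Q.Δ b))

/-- `a ⊗ b ⊗ c ↦ Δ(a) δ K(b ⊗ c)`, where `K = kMap`. -/
def δkMap : H ⊗[k] (H ⊗[k] H) →ₗ[k] H ⊗[k] H :=
  TensorProduct.lift ((LinearMap.mul k (H ⊗[k] H)).compl₁₂
    (LinearMap.mulRight k Q.elemδ ∘ₗ Q.Δ.toLinearMap) Q.kMap)

theorem δkMap_tmul (a : H) (w : H ⊗[k] H) : Q.δkMap (a ⊗ₜ w) = Q.Δ a * Q.elemδ * Q.kMap w := rfl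

/-- `Δ(X¹) δ K(X² ⊗ X³) = p` -/
theorem δkMap_Φ : Q.δkMap Q.Φ = Q.pElem := by
  -- `a ⊗ b ⊗ c ⊗ d ↦ Δ(a) p (βS(c)αd ⊗ S(b))`
  let f : H ⊗[k] (H ⊗[k] (H ⊗[k] H)) →ₗ[k] H ⊗[k] H :=
    TensorProduct.lift ((LinearMap.mul k (H ⊗[k] H)).compl₁₂
      (LinearMap.mulRight k Q.pElem ∘ₗ Q.Δ.toLinearMap)
      ((TensorProduct.comm k H H).toLinearMap ∘ₗ
        TensorProduct.map Q.S.toLinearMap (LinearMap.mulLeft k Q.β ∘ₗ Q.contractα)))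
  have hp : ∀ a b c d, f (a ⊗ₜ (b ⊗ₜ (c ⊗ₜ d))) =
      Q.Δ a * Q.pElem * ((Q.β * Q.contractα (c ⊗ₜ d)) ⊗ₜ Q.S b) := fun _ _ _ _ => rfl
  have h2 : ∀ (t : H ⊗[k] (H ⊗[k] (H ⊗[k] H))) (a b c : H),
      f (Q.leg1_2_34 (a ⊗ₜ (b ⊗ₜ c)) * t) = Q.ε c • f (Q.leg1_2_34 (a ⊗ₜ (b ⊗ₜ 1)) * t) := by
    intro t a b c
    rw [(Q.leg_tmul _ _ _).2.2.2.1, (Q.leg_tmul _ _ _).2.2.2.1]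
    induction t using tensor_induction₄ with
    | h0 => simp only [map_zero, tensor₄_mul_zero, smul_zero]
    | hadd x y hx hy => simp only [map_add, tensor₄_mul_add, smul_add, hx, hy]
    | h t1 t2 t3 t4 =>
    have key : ∀ d : H ⊗[k] H, f ((a ⊗ₜ (b ⊗ₜ d)) * (t1 ⊗ₜ (t2 ⊗ₜ (t3 ⊗ₜ t4)))) =
        Q.Δ (a * t1) * Q.pElem * ((Q.β * Q.contractα (d * (t3 ⊗ₜ t4))) ⊗ₜ Q.S (b * t2)) := by
      intro d
      rw [tensor₄_tmul_mul_tmul, Algebra.TensorProduct.tmul_mul_tmul]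
      rfl
    rw [key, key, contractα_Δ_mul, contractα_Δ_mul]
    simp [← TensorProduct.smul_tmul']
  have h3 : ∀ s : H ⊗[k] (H ⊗[k] H), f (Q.leg12_3_4 s) = Q.pElem *
      ((LinearMap.mul' k H (TensorProduct.map (LinearMap.mulRight k Q.β) Q.contractα s)) ⊗ₜ 1) := by
    intro s
    induction s using tensor_induction₃ with
    | h0 => simp only [map_zero, TensorProduct.zero_tmul, mul_zero]
    | hadd x y hx hy => simp only [map_add, TensorProduct.add_tmul, mul_add, hx, hy]
    | h x y z =>
    have key : ∀ d : H ⊗[k] H, f (TensorProduct.assoc k H H (H ⊗[k] H) (d ⊗ₜ (y ⊗ₜ z))) =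
        Q.pMap (Q.S.toLinearMap.lTensor H d) * ((Q.β * Q.contractα (y ⊗ₜ z)) ⊗ₜ 1) := fun d =>
      TensorProduct.induction_on d (by simp) (fun a b => by
        rw [TensorProduct.assoc_tmul, hp, LinearMap.lTensor_tmul, pMap_tmul]
        simp [mul_assoc])
        (fun x y hx hy => by simp only [TensorProduct.add_tmul, map_add, add_mul, hx, hy])
    rw [(Q.leg_tmul _ _ _).2.2.2.2, key, pMap_Δ]
    simp [mul_assoc]
  have h4 : ∀ s t u : H ⊗[k] (H ⊗[k] H),
      f (QuasiBialgebra.leg234 s * Q.leg1_23_4 t * QuasiBialgebra.leg123 u) =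
      TensorProduct.lift ((LinearMap.mul k (H ⊗[k] H)).compl₁₂
        (LinearMap.mulRight k (Q.δMap Q.pElem u) ∘ₗ Q.Δ.toLinearMap)
        (TensorProduct.lift ((LinearMap.mul k (H ⊗[k] H)).compl₁₂
          (LinearMap.mulRight k (TensorProduct.comm k H H (Q.S.toLinearMap.rTensor H
            (Q.contractα.lTensor H s))) ∘ₗ Q.Scop) ((TensorProduct.mk k H H).flip 1)))) t := by
    intro s t u
    induction t using tensor_induction₃ with
    | h0 => simp only [map_zero, tensor₄_zero_mul, tensor₄_mul_zero]
    | hadd x y hx hy => simp only [map_add, tensor₄_add_mul, tensor₄_mul_add, hx, hy]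
    | h y1 y2 y3 =>
    simp only [TensorProduct.lift.tmul, LinearMap.compl₁₂_apply, LinearMap.comp_apply,
      LinearMap.mulRight_apply, LinearMap.mul_apply', AlgHom.toLinearMap_apply, Scop]
    rw [(Q.leg_tmul _ _ _).2.2.1]
    generalize Q.Δ y2 = d
    refine TensorProduct.induction_on d ?_ (fun a b => ?_) (fun x y hx hy => ?_)
    · simp only [TensorProduct.zero_tmul, map_zero, TensorProduct.tmul_zero, zero_mul, mul_zero,
        tensor₄_zero_mul, tensor₄_mul_zero]
    · induction u using tensor_induction₃ with
      | h0 => simp only [map_zero, mul_zero, zero_mul, tensor₄_mul_zero]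
      | hadd x y hx hy => simp only [map_add, mul_add, add_mul, tensor₄_mul_add, hx, hy]
      | h u1 u2 u3 =>
      induction s using tensor_induction₃ with
      | h0 => simp only [map_zero, mul_zero, zero_mul, tensor₄_zero_mul]
      | hadd x y hx hy => simp only [map_add, mul_add, add_mul, tensor₄_add_mul, hx, hy]
      | h s1 s2 s3 =>
      rw [(Q.leg_tmul _ _ _).1, (Q.leg_tmul _ _ _).2.1, TensorProduct.assoc_tmul,
        tensor₄_tmul_mul_tmul, tensor₄_tmul_mul_tmul, δMap_tmul]
      simp only [Algebra.TensorProduct.tmul_mul_tmul, hp, contractα_tmul, Q.S_mul, mul_assoc,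
        one_mul, mul_one, map_mul, TensorProduct.comm_tmul, TensorProduct.map_tmul,
        LinearMap.lTensor_tmul, LinearMap.rTensor_tmul, LinearEquiv.coe_coe, LinearMap.flip_apply,
        TensorProduct.mk_apply]
    · simp only [TensorProduct.add_tmul, map_add, TensorProduct.tmul_add, add_mul, mul_add,
        tensor₄_mul_add, tensor₄_add_mul, hx, hy]
  have h5 : Q.δkMap Q.Φ = f (QuasiBialgebra.leg234 Q.Φ * Q.leg1_23_4 Q.Φ *
      QuasiBialgebra.leg123 Q.Φ) := by
    rw [h4, δkMap, ← elemδ_eq]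
    congr 3
    refine TensorProduct.ext' fun b c => ?_
    rw [kMap_tmul]
    rfl
  have h6 : LinearMap.mul' k H (TensorProduct.map (LinearMap.mulRight k Q.β) Q.contractα Q.Φ) = 1 :=
    Q.antipode_Φ
  rw [h5, Q.pentagon_legs, (Q.contract_last_left (h2 _)).1, h3, h6,
    ← Algebra.TensorProduct.one_def, mul_one]

/-- `h ⊗ z ↦ h₁p¹ ⊗ Δ(h₂p²) f⁻¹ z` -/
def twistMap : H ⊗[k] (H ⊗[k] H) →ₗ[k] H ⊗[k] (H ⊗[k] H) :=
  TensorProduct.lift ((LinearMap.mul k (H ⊗[k] (H ⊗[k] H))).compl₁₂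
    (Q.Δ.toLinearMap.lTensor H ∘ₗ LinearMap.mulRight k Q.pElem ∘ₗ Q.Δ.toLinearMap)
    (TensorProduct.mk k H (H ⊗[k] H) 1 ∘ₗ LinearMap.mulLeft k Q.fInv))

/-- `X¹₁p¹ ⊗ Δ(X¹₂p²) f⁻¹ K(X² ⊗ X³) = x¹ ⊗ Δ(x²) p (1 ⊗ S(x³))` -/
theorem twistMap_kMap_Φ : Q.twistMap (Q.kMap.lTensor H Q.Φ) =
    (Q.pMap ∘ₗ Q.S.toLinearMap.lTensor H).lTensor H Q.Φinv := by
  let f : H ⊗[k] (H ⊗[k] (H ⊗[k] H)) →ₗ[k] H ⊗[k] (H ⊗[k] H) := Q.δkMap.lTensor H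
  have h1 : ∀ s t : H ⊗[k] (H ⊗[k] H), TensorProduct.lift
      ((LinearMap.mul k (H ⊗[k] (H ⊗[k] H))).compl₁₂
      (Q.Δ.toLinearMap.lTensor H ∘ₗ LinearMap.mulRight k (Q.contractβ.lTensor H t) ∘ₗ
        Q.Δ.toLinearMap) (TensorProduct.mk k H (H ⊗[k] H) 1 ∘ₗ LinearMap.mulLeft k Q.fInv))
        (Q.kMap.lTensor H s) = f (Q.leg12_3_4 s * QuasiBialgebra.leg123 t) := by
    intro s t
    induction s using tensor_induction₃ with
    | h0 => simp only [map_zero, tensor₄_zero_mul]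
    | hadd x y hx hy => simp only [map_add, tensor₄_add_mul, hx, hy]
    | h x1 x2 x3 =>
    rw [(Q.leg_tmul _ _ _).2.2.2.2, LinearMap.lTensor_tmul]
    simp only [TensorProduct.lift.tmul, LinearMap.compl₁₂_apply, LinearMap.comp_apply,
      LinearMap.mulRight_apply, LinearMap.mulLeft_apply, LinearMap.mul_apply',
      TensorProduct.mk_apply]
    rw [AlgHom.toLinearMap_apply]
    generalize Q.Δ x1 = d
    refine TensorProduct.induction_on d ?_ (fun a b => ?_) (fun x y hx hy => ?_)
    · simp only [TensorProduct.zero_tmul, map_zero, zero_mul, tensor₄_zero_mul]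
    · induction t using tensor_induction₃ with
      | h0 => simp only [map_zero, mul_zero, zero_mul, tensor₄_mul_zero]
      | hadd x y hx hy => simp only [map_add, mul_add, add_mul, tensor₄_mul_add, hx, hy]
      | h y1 y2 y3 =>
      rw [(Q.leg_tmul _ _ _).2.1, TensorProduct.assoc_tmul, tensor₄_tmul_mul_tmul,
        Algebra.TensorProduct.tmul_mul_tmul, Algebra.TensorProduct.tmul_mul_tmul, mul_one,
        LinearMap.lTensor_tmul, Algebra.TensorProduct.tmul_mul_tmul, LinearMap.lTensor_tmul,
        Algebra.TensorProduct.tmul_mul_tmul, mul_one]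
      change _ = (a * y1) ⊗ₜ Q.δkMap _
      rw [δkMap_tmul, kMap_tmul_mul, ← Q.Δ_β_mul_fInv, AlgHom.toLinearMap_apply, contractβ_tmul,
        map_mul, map_mul, map_mul, map_mul]
      have := Q.Δ_S_mul_fInv y3
      congr 1
      simp only [mul_assoc]
      rw [← mul_assoc (Q.Δ (Q.S y3)), this]
      simp only [mul_assoc]
    · simp only [TensorProduct.add_tmul, map_add, add_mul, tensor₄_add_mul, hx, hy]
  have h2 : ∀ (t : H ⊗[k] (H ⊗[k] (H ⊗[k] H))) (a b c : H),
      f (t * Q.leg1_23_4 (a ⊗ₜ (b ⊗ₜ c))) = Q.ε b • f (t * Q.leg1_23_4 (a ⊗ₜ (1 ⊗ₜ c))) := by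
    intro t a b c
    rw [(Q.leg_tmul _ _ _).2.2.1, (Q.leg_tmul _ _ _).2.2.1]
    induction t using tensor_induction₄ with
    | h0 => simp only [map_zero, tensor₄_zero_mul, smul_zero]
    | hadd x y hx hy => simp only [map_add, tensor₄_add_mul, smul_add, hx, hy]
    | h t1 t2 t3 t4 =>
    have key : ∀ d : H ⊗[k] H, f ((t1 ⊗ₜ (t2 ⊗ₜ (t3 ⊗ₜ t4))) *
        (a ⊗ₜ TensorProduct.assoc k H H H (d ⊗ₜ c))) =
        (t1 * a) ⊗ₜ (Q.contractδ ((t2 ⊗ₜ t3) * d) * TensorProduct.comm k H H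
          (Q.S.toLinearMap.rTensor H Q.qElem) * ((t4 * c) ⊗ₜ 1)) := by
      intro d
      refine TensorProduct.induction_on d ?_ (fun a b => ?_) (fun x y hx hy => ?_)
      · simp only [TensorProduct.zero_tmul, map_zero, TensorProduct.tmul_zero, zero_mul,
          tensor₄_mul_zero, mul_zero]
      · rw [TensorProduct.assoc_tmul, tensor₄_tmul_mul_tmul, Algebra.TensorProduct.tmul_mul_tmul,
          Algebra.TensorProduct.tmul_mul_tmul, LinearMap.lTensor_tmul, δkMap_tmul, kMap_tmul,
          Algebra.TensorProduct.tmul_mul_tmul, contractδ_tmul]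
        simp only [mul_assoc]
      · simp only [TensorProduct.add_tmul, map_add, TensorProduct.tmul_add, add_mul, mul_add,
          tensor₄_mul_add, hx, hy]
    rw [key, key, contractδ_mul_Δ, contractδ_mul_Δ]
    simp
  have h3 : f (QuasiBialgebra.leg234 Q.Φ) = 1 ⊗ₜ Q.pElem := by
    rw [← δkMap_Φ]
    rfl
  have h4 : ∀ (t : H ⊗[k] (H ⊗[k] (H ⊗[k] H))) (a b c : H),
      f (Q.leg1_2_34 (a ⊗ₜ (b ⊗ₜ c)) * t) = (a ⊗ₜ Q.Δ b) * f t * (1 ⊗ₜ (1 ⊗ₜ Q.S c)) := by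
    intro t a b c
    rw [(Q.leg_tmul _ _ _).2.2.2.1]
    induction t using tensor_induction₄ with
    | h0 => simp only [map_zero, tensor₄_mul_zero, mul_zero, zero_mul]
    | hadd x y hx hy => simp only [map_add, tensor₄_mul_add, mul_add, add_mul, hx, hy]
    | h t1 t2 t3 t4 =>
    rw [tensor₄_tmul_mul_tmul, Algebra.TensorProduct.tmul_mul_tmul, LinearMap.lTensor_tmul,
      LinearMap.lTensor_tmul, δkMap_tmul, δkMap_tmul, kMap_Δ_mul, map_mul,
      Algebra.TensorProduct.tmul_mul_tmul, Algebra.TensorProduct.tmul_mul_tmul, mul_one]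
    simp only [mul_assoc]
  have h5 : ∀ s : H ⊗[k] (H ⊗[k] H),
      f (Q.leg1_2_34 s * (QuasiBialgebra.leg234 Q.Φ * Q.leg1_23_4 Q.Φ)) =
        (Q.pMap ∘ₗ Q.S.toLinearMap.lTensor H).lTensor H s := by
    intro s
    induction s using tensor_induction₃ with
    | h0 => simp only [map_zero, tensor₄_zero_mul]
    | hadd x y hx hy => simp only [map_add, tensor₄_add_mul, hx, hy]
    | h a b c =>
    rw [h4, (Q.contract_mid_right (h2 _)).1, h3, Algebra.TensorProduct.tmul_mul_tmul,
      Algebra.TensorProduct.tmul_mul_tmul, mul_one, mul_one]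
    rfl
  have h6 : Q.twistMap (Q.kMap.lTensor H Q.Φ) =
      f (Q.leg12_3_4 Q.Φ * QuasiBialgebra.leg123 Q.Φinv) := h1 Q.Φ Q.Φinv
  rw [h6, Q.pentagon_inv.2.1, h5]

end QuasiHopfAlgebra

/-! ### Bimodules and their adjoint modules -/

section Bimodules

variable {k H : Type*} [Field k] [Ring H] [Algebra k H]
variable {N N' X : Type*} [AddCommGroup N] [Module k N] [AddCommGroup N'] [Module k N']
  [AddCommGroup X] [Module k X]

/-- The left action `ρ` and the right action `σ` make `N` an `H`-bimodule; `σ h n` is `n h`. -/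
structure IsBimodule (ρ σ : H →ₗ[k] N →ₗ[k] N) : Prop where
  left : IsRep ρ
  right_one : ∀ n, σ 1 n = n
  right_mul : ∀ g h n, σ (g * h) n = σ h (σ g n)
  comm : ∀ g h n, ρ g (σ h n) = σ h (ρ g n)

/-- `a ⊗ b ↦ (n ↦ a n b)` -/
def biAct (ρ σ : H →ₗ[k] N →ₗ[k] N) : H ⊗[k] H →ₗ[k] N →ₗ[k] N :=
  TensorProduct.lift ((LinearMap.mul k (Module.End k N)).compl₁₂ ρ σ)

@[simp]
theorem biAct_tmul (ρ σ : H →ₗ[k] N →ₗ[k] N) (a b : H) (n : N) :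
    biAct ρ σ (a ⊗ₜ b) n = ρ a (σ b n) := rfl

/-- The right action on the second factor of `X ⊗ N`. -/
def rightAct (X : Type*) [AddCommGroup X] [Module k X] (σ : H →ₗ[k] N →ₗ[k] N) :
    H →ₗ[k] X ⊗[k] N →ₗ[k] X ⊗[k] N := LinearMap.lTensorHom X ∘ₗ σ

@[simp]
theorem rightAct_apply (σ : H →ₗ[k] N →ₗ[k] N) (h : H) :
    rightAct X σ h = (σ h).lTensor X := rfl

variable {ρ σ : H →ₗ[k] N →ₗ[k] N} {ρ' σ' : H →ₗ[k] N' →ₗ[k] N'} {ρX : H →ₗ[k] X →ₗ[k] X}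

theorem IsBimodule.biAct_tmul_mul (hN : IsBimodule ρ σ) (a b : H) (t : H ⊗[k] H) (n : N) :
    biAct ρ σ ((a ⊗ₜ b) * t) n = ρ a (biAct ρ σ t (σ b n)) := by
  refine TensorProduct.induction_on t (by simp) (fun c d => ?_)
    (fun x y hx hy => by simp only [mul_add, map_add, LinearMap.add_apply, hx, hy])
  simp [hN.left.mul, hN.right_mul]

theorem biAct_hom {f : N →ₗ[k] N'} (hρ : IsRepHom ρ ρ' f) (hσ : IsRepHom σ σ' f) (t : H ⊗[k] H)
    (n : N) : f (biAct ρ σ t n) = biAct ρ' σ' t (f n) := by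
  refine TensorProduct.induction_on t (by simp) (fun c d => ?_)
    (fun x y hx hy => by simp only [map_add, LinearMap.add_apply, hx, hy])
  simp [hρ c, hσ d]

theorem IsBimodule.tensor (Q : QuasiBialgebra k H) (hN : IsBimodule ρ σ) (hX : IsRep ρX) :
    IsBimodule (Q.tensorAct ρX ρ) (rightAct X σ) where
  left := Q.isRep_tensorAct hX hN.left
  right_one w := by
    have : σ 1 = LinearMap.id := LinearMap.ext hN.right_one
    rw [rightAct_apply, this, LinearMap.lTensor_id, LinearMap.id_apply]
  right_mul g h w := by
    have : σ (g * h) = σ h ∘ₗ σ g := LinearMap.ext (hN.right_mul g h)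
    rw [rightAct_apply, this, LinearMap.lTensor_comp_apply]
    rfl
  comm g h w := (Q.isRepHom_lTensor (ρM := ρX) (g := σ h)
    (fun g n => (hN.comm g h n).symm) g w).symm

namespace QuasiHopfAlgebra

variable (Q : QuasiHopfAlgebra k H)

/-- The adjoint action `h ▷ n = h₁ n S(h₂)` on a bimodule. -/
def adAct (ρ σ : H →ₗ[k] N →ₗ[k] N) : H →ₗ[k] N →ₗ[k] N :=
  biAct ρ (σ ∘ₗ Q.S.toLinearMap) ∘ₗ Q.Δ.toLinearMap

/-- The map `n ↦ X¹ n S(X²)αX³`: the value at `1` of the endomorphism that `n` represents. -/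
def evalOne (ρ σ : H →ₗ[k] N →ₗ[k] N) : N →ₗ[k] N := biAct ρ σ Q.qElem

/-- The map `x ⊗ n ↦ x¹ · x ⊗ x² n S(x³)` from the tensor product of `X` with the adjoint module
of `N` to the adjoint module of `X ⊗ N`. -/
def adTensor (ρX : H →ₗ[k] X →ₗ[k] X) (ρ σ : H →ₗ[k] N →ₗ[k] N) : X ⊗[k] N →ₗ[k] X ⊗[k] N :=
  TensorProduct.map₂ ρX (biAct ρ (σ ∘ₗ Q.S.toLinearMap)) Q.Φinv

/-- The inverse `x ⊗ n ↦ X¹ · x ⊗ X² n S(X³)` of `adTensor`. -/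
def adTensorInv (ρX : H →ₗ[k] X →ₗ[k] X) (ρ σ : H →ₗ[k] N →ₗ[k] N) : X ⊗[k] N →ₗ[k] X ⊗[k] N :=
  TensorProduct.map₂ ρX (biAct ρ (σ ∘ₗ Q.S.toLinearMap)) Q.Φ

/-- The map `x ⊗ n ↦ X¹ · x ⊗ E(X² ▷ n) X³`, where `E = evalOne`. -/
def evalPair (ρX : H →ₗ[k] X →ₗ[k] X) (ρ σ : H →ₗ[k] N →ₗ[k] N) : X ⊗[k] N →ₗ[k] X ⊗[k] N :=
  TensorProduct.map₂ ρX (biAct ρ σ) (Q.eMap.lTensor H Q.Φ)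

theorem isRep_biAct_S (hN : IsBimodule ρ σ) : IsRep (biAct ρ (σ ∘ₗ Q.S.toLinearMap)) where
  one n := by
    rw [Algebra.TensorProduct.one_def, biAct_tmul]
    simp [S_one, hN.right_one, hN.left.one]
  mul s t n := by
    refine TensorProduct.induction_on s (by simp) (fun a b => ?_)
      (fun x y hx hy => by simp only [add_mul, map_add, LinearMap.add_apply, hx, hy])
    refine TensorProduct.induction_on t (by simp) (fun c d => ?_)
      (fun x y hx hy => by simp only [mul_add, map_add, LinearMap.add_apply, hx, hy])
    simp [hN.left.mul, hN.right_mul, Q.S_mul, hN.comm]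

theorem isRep_adAct (hN : IsBimodule ρ σ) : IsRep (Q.adAct ρ σ) := (Q.isRep_biAct_S hN).comp Q.Δ

theorem adAct_hom {f : N →ₗ[k] N'} (hρ : IsRepHom ρ ρ' f) (hσ : IsRepHom σ σ' f) :
    IsRepHom (Q.adAct ρ σ) (Q.adAct ρ' σ') f := fun h n =>
  biAct_hom hρ (fun r n => hσ (Q.S r) n) (Q.Δ h) n

theorem evalOne_hom {f : N →ₗ[k] N'} (hρ : IsRepHom ρ ρ' f) (hσ : IsRepHom σ σ' f) (n : N) :
    f (Q.evalOne ρ σ n) = Q.evalOne ρ' σ' (f n) := biAct_hom hρ hσ _ n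

theorem biAct_eMap_tmul (hN : IsBimodule ρ σ) (h c : H) (n : N) :
    biAct ρ σ (Q.eMap (h ⊗ₜ c)) n = σ c (Q.evalOne ρ σ (Q.adAct ρ σ h n)) := by
  have e : ∀ (s : H ⊗[k] (H ⊗[k] H)) (d : H ⊗[k] H), biAct ρ σ (Q.contractα.lTensor H
      (s * TensorProduct.assoc k H H H (d ⊗ₜ c))) n = σ c (biAct ρ σ (Q.contractα.lTensor H s)
        (biAct ρ (σ ∘ₗ Q.S.toLinearMap) d n)) := by
    intro s d
    refine TensorProduct.induction_on d (by simp) (fun a b => ?_) (fun x y hx hy => by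
      simp only [TensorProduct.add_tmul, map_add, LinearMap.add_apply, mul_add, hx, hy])
    induction s using tensor_induction₃ with
    | h0 => simp only [map_zero, zero_mul, LinearMap.zero_apply]
    | hadd x y hx hy => simp only [map_add, add_mul, LinearMap.add_apply, hx, hy]
    | h x y z => simp [Q.S_mul, mul_assoc, hN.right_mul, hN.left.mul, hN.comm]
  exact e Q.Φ (Q.Δ h)

/-- `h E(n) = E(h₁ ▷ n) h₂` -/
theorem biAct_eMap_Δ (hN : IsBimodule ρ σ) (h : H) (n : N) :
    biAct ρ σ (Q.eMap (Q.Δ h)) n = ρ h (Q.evalOne ρ σ n) := by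
  rw [eMap_Δ, hN.biAct_tmul_mul, hN.right_one]
  rfl

theorem biAct_eMap_Δ_mul (hN : IsBimodule ρ σ) (h : H) (t : H ⊗[k] H) (n : N) :
    biAct ρ σ (Q.eMap (Q.Δ h * t)) n = ρ h (biAct ρ σ (Q.eMap t) n) := by
  refine TensorProduct.induction_on t (by simp) (fun a c => ?_)
    (fun x y hx hy => by simp only [mul_add, map_add, LinearMap.add_apply, hx, hy])
  have e : ∀ d : H ⊗[k] H, biAct ρ σ (Q.eMap (d * (a ⊗ₜ c))) n =
      σ c (biAct ρ σ (Q.eMap d) (Q.adAct ρ σ a n)) := by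
    intro d
    refine TensorProduct.induction_on d (by simp) (fun x y => ?_)
      (fun x y hx hy => by simp only [add_mul, map_add, LinearMap.add_apply, hx, hy])
    rw [Algebra.TensorProduct.tmul_mul_tmul, biAct_eMap_tmul Q hN, biAct_eMap_tmul Q hN,
      (Q.isRep_adAct hN).mul, hN.right_mul]
  rw [e, Q.biAct_eMap_Δ hN, biAct_eMap_tmul Q hN, hN.comm]

/-- `n = E(p¹ ▷ n) p²` -/
theorem biAct_eMap_pElem (hN : IsBimodule ρ σ) (n : N) :
    biAct ρ σ (Q.eMap Q.pElem) n = n := by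
  rw [eMap_pElem, Algebra.TensorProduct.one_def, biAct_tmul, hN.right_one, hN.left.one]

theorem biAct_eMap_congr (hN : IsBimodule ρ σ) {n n' : N}
    (h : ∀ g, Q.evalOne ρ σ (Q.adAct ρ σ g n) = Q.evalOne ρ σ (Q.adAct ρ σ g n')) (t : H ⊗[k] H) :
    biAct ρ σ (Q.eMap t) n = biAct ρ σ (Q.eMap t) n' := by
  refine TensorProduct.induction_on t (by simp) (fun a b => ?_)
    (fun x y hx hy => by simp only [map_add, LinearMap.add_apply, hx, hy])
  rw [biAct_eMap_tmul Q hN, biAct_eMap_tmul Q hN, h]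

/-- The evaluations of all translates determine an element of an adjoint module. -/
theorem eq_of_evalOne (hN : IsBimodule ρ σ) {n n' : N}
    (h : ∀ g, Q.evalOne ρ σ (Q.adAct ρ σ g n) = Q.evalOne ρ σ (Q.adAct ρ σ g n')) : n = n' := by
  rw [← Q.biAct_eMap_pElem hN n, Q.biAct_eMap_congr hN h, Q.biAct_eMap_pElem hN]

theorem adAct_tensor (h : H) :
    Q.adAct (Q.tensorAct ρX ρ) (rightAct X σ) h =
      TensorProduct.map₂ ρX (biAct ρ (σ ∘ₗ Q.S.toLinearMap)) (Q.ΔL h) := by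
  have e : ∀ d e : H ⊗[k] H, ∀ b, TensorProduct.map₂ ρX ρ e ∘ₗ (σ (Q.S b)).lTensor X =
      TensorProduct.map₂ ρX (biAct ρ (σ ∘ₗ Q.S.toLinearMap))
        (TensorProduct.assoc k H H H (e ⊗ₜ b)) := by
    intro d e b
    refine TensorProduct.induction_on e (by simp) (fun x y => ?_) (fun x y hx hy => by
      simp only [TensorProduct.add_tmul, map_add, LinearMap.add_comp, hx, hy])
    exact TensorProduct.ext' fun _ _ => rfl
  have e2 : ∀ d : H ⊗[k] H, biAct (Q.tensorAct ρX ρ) (rightAct X σ ∘ₗ Q.S.toLinearMap) d =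
      TensorProduct.map₂ ρX (biAct ρ (σ ∘ₗ Q.S.toLinearMap))
        (TensorProduct.assoc k H H H (Q.Δ.toLinearMap.rTensor H d)) := by
    intro d
    refine TensorProduct.induction_on d (by simp) (fun x y => ?_) (fun x y hx hy => by
      simp only [map_add, hx, hy])
    exact e d (Q.Δ x) y
  exact e2 (Q.Δ h)

theorem tensorAct_adAct (h : H) :
    Q.tensorAct ρX (Q.adAct ρ σ) h =
      TensorProduct.map₂ ρX (biAct ρ (σ ∘ₗ Q.S.toLinearMap)) (Q.ΔR h) :=
  QuasiBialgebra.map₂_comp_algHom_right Q.Δ (biAct ρ (σ ∘ₗ Q.S.toLinearMap)) ρX (Q.Δ h)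

theorem isRepHom_adTensor (hN : IsBimodule ρ σ) (hX : IsRep ρX) :
    IsRepHom (Q.tensorAct ρX (Q.adAct ρ σ)) (Q.adAct (Q.tensorAct ρX ρ) (rightAct X σ))
      (Q.adTensor ρX ρ σ) := by
  intro h w
  have hT := hX.map₂ (Q.isRep_biAct_S hN)
  rw [adAct_tensor, tensorAct_adAct, adTensor, ← hT.mul, Q.Φinv_mul_ΔR, hT.mul]

theorem adTensor_rTensor {X' : Type*} [AddCommGroup X'] [Module k X'] {ρX' : H →ₗ[k] X' →ₗ[k] X'}
    {f : X →ₗ[k] X'} (hf : IsRepHom ρX ρX' f) (w : X ⊗[k] N) :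
    Q.adTensor ρX' ρ σ (f.rTensor N w) = f.rTensor N (Q.adTensor ρX ρ σ w) :=
  ((hf.map (IsRepHom.id (biAct ρ (σ ∘ₗ Q.S.toLinearMap)))) Q.Φinv w).symm

theorem adTensor_lTensor {f : N →ₗ[k] N'} (hρ : IsRepHom ρ ρ' f) (hσ : IsRepHom σ σ' f)
    (w : X ⊗[k] N) : Q.adTensor ρX ρ' σ' (f.lTensor X w) = f.lTensor X (Q.adTensor ρX ρ σ w) :=
  (((IsRepHom.id ρX).map (fun t n => biAct_hom (σ := σ ∘ₗ Q.S.toLinearMap)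
    (σ' := σ' ∘ₗ Q.S.toLinearMap) hρ (fun r n => hσ (Q.S r) n) t n)) Q.Φinv w).symm

theorem adTensor_adTensorInv (hN : IsBimodule ρ σ) (hX : IsRep ρX) (w : X ⊗[k] N) :
    Q.adTensor ρX ρ σ (Q.adTensorInv ρX ρ σ w) = w := by
  have hT := hX.map₂ (Q.isRep_biAct_S hN)
  rw [adTensor, adTensorInv, ← hT.mul, Q.Φinv_mul_Φ, hT.one]

theorem adTensorInv_adTensor (hN : IsBimodule ρ σ) (hX : IsRep ρX) (w : X ⊗[k] N) :
    Q.adTensorInv ρX ρ σ (Q.adTensor ρX ρ σ w) = w := by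
  have hT := hX.map₂ (Q.isRep_biAct_S hN)
  rw [adTensor, adTensorInv, ← hT.mul, Q.Φ_mul_Φinv, hT.one]

theorem bijective_adTensor (hN : IsBimodule ρ σ) (hX : IsRep ρX) :
    Function.Bijective (Q.adTensor ρX ρ σ) :=
  ⟨Function.LeftInverse.injective (Q.adTensorInv_adTensor hN hX),
    Function.RightInverse.surjective (Q.adTensor_adTensorInv hN hX)⟩

/-- Evaluation on `X ⊗ N` after `adTensor` is the pairing `x ⊗ n ↦ X¹ · x ⊗ E(X² ▷ n) X³`. -/
theorem evalOne_adTensor (hN : IsBimodule ρ σ) (hX : IsRep ρX) (w : X ⊗[k] N) :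
    Q.evalOne (Q.tensorAct ρX ρ) (rightAct X σ) (Q.adTensor ρX ρ σ w) = Q.evalPair ρX ρ σ w := by
  have e : ∀ s t : H ⊗[k] (H ⊗[k] H), biAct (Q.tensorAct ρX ρ) (rightAct X σ)
      (Q.contractα.lTensor H s) (TensorProduct.map₂ ρX (biAct ρ (σ ∘ₗ Q.S.toLinearMap)) t w) =
      TensorProduct.map₂ ρX (biAct ρ σ) ((Q.contractα.lTensor H).lTensor H
        (Q.leg12_3_4 s * QuasiBialgebra.leg123 t)) w := by
    intro s t
    induction s using tensor_induction₃ with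
    | h0 => simp only [map_zero, tensor₄_zero_mul, LinearMap.zero_apply]
    | hadd x y hx hy => simp only [map_add, tensor₄_add_mul, LinearMap.add_apply, hx, hy]
    | h x1 x2 x3 =>
    rw [(Q.leg_tmul _ _ _).2.2.2.2, LinearMap.lTensor_tmul, biAct_tmul,
      QuasiBialgebra.tensorAct, LinearMap.comp_apply, AlgHom.toLinearMap_apply]
    generalize Q.Δ x1 = d
    refine TensorProduct.induction_on d ?_ (fun a b => ?_) (fun x y hx hy => ?_)
    · simp only [TensorProduct.zero_tmul, map_zero, tensor₄_zero_mul, LinearMap.zero_apply]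
    · induction t using tensor_induction₃ with
      | h0 => simp only [map_zero, tensor₄_mul_zero, LinearMap.zero_apply]
      | hadd x y hx hy => simp only [map_add, tensor₄_mul_add, LinearMap.add_apply, hx, hy]
      | h y1 y2 y3 =>
      rw [(Q.leg_tmul _ _ _).2.1, TensorProduct.assoc_tmul, tensor₄_tmul_mul_tmul,
        Algebra.TensorProduct.tmul_mul_tmul, Algebra.TensorProduct.tmul_mul_tmul, mul_one]
      refine TensorProduct.induction_on w (by simp) (fun x n => ?_)
        (fun x y hx hy => by simp only [map_add, hx, hy])
      simp [TensorProduct.map₂_apply_tmul, hX.mul, hN.left.mul, hN.right_mul, hN.comm, Q.S_mul]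
    · simp only [TensorProduct.add_tmul, map_add, tensor₄_add_mul, LinearMap.add_apply, hx, hy]
  rw [evalOne, adTensor, qElem, e, contractα_leg12_3_4_mul_leg123, evalPair]

theorem eq_of_evalPair (hN : IsBimodule ρ σ) (hX : IsRep ρX) {w w' : X ⊗[k] N}
    (h : ∀ g, Q.evalPair ρX ρ σ (Q.tensorAct ρX (Q.adAct ρ σ) g w) =
      Q.evalPair ρX ρ σ (Q.tensorAct ρX (Q.adAct ρ σ) g w')) : w = w' := by
  refine (Q.bijective_adTensor hN hX).1 (Q.eq_of_evalOne (hN.tensor Q.toQuasiBialgebra hX)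
    fun g => ?_)
  rw [← Q.isRepHom_adTensor hN hX, ← Q.isRepHom_adTensor hN hX, Q.evalOne_adTensor hN hX,
    Q.evalOne_adTensor hN hX, h]

end QuasiHopfAlgebra

end Bimodules

/-! ### The algebra `B^v` -/

section Twisted

variable {k H B : Type*} [Field k] [Ring H] [Algebra k H] [Ring B] [Algebra k B]

/-- The right action of `H` on `B` through `v : H → B`. -/
def resRight (v : H →ₐ[k] B) : H →ₗ[k] B →ₗ[k] B := (LinearMap.mul k B).flip ∘ₗ v.toLinearMap

@[simp]
theorem resRight_apply (v : H →ₐ[k] B) (h : H) (b : B) : resRight v h b = b * v h := rfl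

@[simp]
theorem resAct_mul_apply (v : H →ₐ[k] B) (h : H) (b : B) :
    resAct v (LinearMap.mul k B) h b = v h * b := rfl

theorem isBimodule_res (v : H →ₐ[k] B) :
    IsBimodule (resAct v (LinearMap.mul k B)) (resRight v) where
  left := isRep_resAct IsRep.mulLeft
  right_one := by simp
  right_mul := by simp [mul_assoc]
  comm := by simp [mul_assoc]

namespace QuasiHopfAlgebra

variable (Q : QuasiHopfAlgebra k H) (v : H →ₐ[k] B) (ℓ : B →ₐ[k] H ⊗[k] B)

/-- The algebra `B^v` for a comodule algebra given by algebra maps `v` and `ℓ`. -/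
def twisted : YDAlgebraData k H B :=
  Q.twistedAlgebra (LinearMap.mul' k B) v.toLinearMap ℓ.toLinearMap

/-- The evaluation `b ↦ v(X¹) b v(S(X²)αX³)` at `1`. -/
def twistedEval : B →ₗ[k] B := Q.evalOne (resAct v (LinearMap.mul k B)) (resRight v)

variable {v ℓ}

theorem twisted_act : (Q.twisted v ℓ).act =
    Q.adAct (resAct v (LinearMap.mul k B)) (resRight v) := by
  refine LinearMap.ext₂ fun h b => ?_
  change LinearMap.mul' k B (TensorProduct.map _ _ (Q.Δ h)) = biAct _ _ (Q.Δ h) b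
  generalize Q.Δ h = d
  refine TensorProduct.induction_on d (by simp) (fun x y => ?_)
    (fun x y hx hy => by simp only [map_add, LinearMap.add_apply, hx, hy])
  simp [mul_assoc]

theorem isRep_twisted : IsRep (Q.twisted v ℓ).act := by
  rw [twisted_act]
  exact Q.isRep_adAct (isBimodule_res v)

theorem evalMap_twistedEval_map₂ {M : Type*} [AddCommGroup M] [Module k M]
    {θ : B →ₗ[k] M →ₗ[k] M} (hθ : IsRep θ) (d : H ⊗[k] H) (b : B) (m : M) :
    evalMap (Q.twistedEval v) θ (TensorProduct.map₂ (Q.twisted v ℓ).act (resAct v θ) d (b ⊗ₜ m)) =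
      θ (biAct (resAct v (LinearMap.mul k B)) (resRight v) (Q.eMap d) b) m := by
  refine TensorProduct.induction_on d (by simp) (fun x y => ?_)
    (fun x y hx hy => by simp only [map_add, LinearMap.add_apply, hx, hy])
  rw [Q.biAct_eMap_tmul (isBimodule_res v), resRight_apply, hθ.mul, twisted_act]
  rfl

theorem isIntertwiner_twistedEval :
    IsIntertwiner Q.toQuasiBialgebra v (Q.twisted v ℓ).act (Q.twistedEval v) := by
  intro h u
  refine TensorProduct.induction_on u (by simp) (fun b m => ?_)
    (fun x y hx hy => by simp only [map_add, hx, hy])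
  rw [QuasiBialgebra.tensorAct, LinearMap.comp_apply, AlgHom.toLinearMap_apply,
    Q.evalMap_twistedEval_map₂ IsRep.mulLeft, Q.biAct_eMap_Δ (isBimodule_res v)]
  simp [mul_assoc, twistedEval]

theorem evalPair_eq_pairMap {X : Type*} [AddCommGroup X] [Module k X]
    (ρX : H →ₗ[k] X →ₗ[k] X) (w : X ⊗[k] B) :
    Q.evalPair ρX (resAct v (LinearMap.mul k B)) (resRight v) w =
      pairMap Q.toQuasiBialgebra v ρX (Q.twisted v ℓ).act (Q.twistedEval v) w := by
  rw [evalPair, pairMap, LinearMap.comp_apply, LinearMap.comp_apply, QuasiBialgebra.assocHom,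
    LinearMap.comp_apply]
  generalize (Q.Φ : H ⊗[k] (H ⊗[k] H)) = s
  refine TensorProduct.induction_on w (by simp) (fun x b => ?_)
    (fun x y hx hy => by simp only [map_add, hx, hy])
  refine TensorProduct.induction_on s (by simp) (fun y t => ?_)
    (fun x y hx hy => by simp only [map_add, LinearMap.add_apply, hx, hy])
  have := Q.evalMap_twistedEval_map₂ (v := v) (ℓ := ℓ) (IsRep.mulLeft (k := k) (R := B)) t b 1
  rw [LinearMap.mul_apply', mul_one] at this
  simp only [LinearMap.lTensor_tmul, TensorProduct.map₂_apply_tmul, TensorProduct.map_tmul, ← this]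
  rfl

/-- `b ⋆ b' = E(x¹ ▷ b) x² b' S(x³)` -/
theorem twisted_mul (u : B ⊗[k] B) : (Q.twisted v ℓ).mul u =
    evalMap (Q.twistedEval v) (LinearMap.mul k B) (Q.adTensor (Q.twisted v ℓ).act
      (resAct v (LinearMap.mul k B)) (resRight v) u) := by
  refine TensorProduct.induction_on u (by simp) (fun b b' => ?_)
    (fun x y hx hy => by simp only [map_add, hx, hy])
  let F : H ⊗[k] H →ₗ[k] B := LinearMap.mul' k B ∘ₗ (TensorProduct.mk k B B).flip b' ∘ₗ
    LinearMap.mul' k B ∘ₗ TensorProduct.map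
      (LinearMap.mul' k B ∘ₗ (TensorProduct.mk k B B).flip b ∘ₗ v.toLinearMap) v.toLinearMap
  have hF : ∀ d, F d = biAct (resAct v (LinearMap.mul k B)) (resRight v) d b * b' := fun d =>
    TensorProduct.induction_on d (by simp) (fun x y => by simp [F, mul_assoc])
      (fun x y hx hy => by simp only [map_add, LinearMap.add_apply, add_mul, hx, hy])
  change LinearMap.mul' k B (TensorProduct.map F v.toLinearMap
    ((TensorProduct.assoc k H H H).symm Q.elemMul)) = _
  rw [elemMul_eq, LinearEquiv.symm_apply_apply, adTensor]
  generalize Q.Φinv = t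
  induction t using tensor_induction₃ with
  | h0 => simp only [map_zero, LinearMap.zero_apply]
  | hadd x y hx hy => simp only [map_add, LinearMap.add_apply, hx, hy]
  | h x y z =>
  simp only [TensorProduct.assoc_symm_tmul, TensorProduct.map_tmul, hF,
    Q.biAct_eMap_tmul (isBimodule_res v), TensorProduct.map₂_apply_tmul, biAct_tmul,
    evalMap_tmul, twisted_act]
  simp [mul_assoc, twistedEval]

/-- Evaluation on a `B`-module with a commuting right action of `H` respects the adjoint
actions. -/
theorem isRepHom_evalMap_right {V M : Type*} [AddCommGroup V] [Module k V] [AddCommGroup M]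
    [Module k M] {θ : B →ₗ[k] M →ₗ[k] M} {σ : H →ₗ[k] M →ₗ[k] M} (f : V →ₗ[k] B)
    (hσ : ∀ b h m, θ b (σ h m) = σ h (θ b m)) :
    IsRepHom (rightAct V σ) σ (evalMap f θ) := fun h u =>
  evalMap_lTensor (fun b m => (hσ b h m).symm) f u

theorem isRepHom_twisted_mul :
    IsRepHom (Q.tensorAct (Q.twisted v ℓ).act (Q.twisted v ℓ).act) (Q.twisted v ℓ).act
      (Q.twisted v ℓ).mul := by
  have hN := isBimodule_res v
  have e : (Q.twisted v ℓ).mul = evalMap (Q.twistedEval v) (LinearMap.mul k B) ∘ₗ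
      Q.adTensor (Q.twisted v ℓ).act (resAct v (LinearMap.mul k B)) (resRight v) :=
    LinearMap.ext Q.twisted_mul
  have h1 := Q.isRepHom_adTensor hN (Q.isRep_twisted (v := v) (ℓ := ℓ))
  have h2 := Q.adAct_hom (Q.isIntertwiner_twistedEval (v := v) (ℓ := ℓ))
    (isRepHom_evalMap_right (Q.twistedEval v) (σ := resRight v) (fun b h m => by simp [mul_assoc]))
  rw [e]
  simp only [← Q.twisted_act (v := v) (ℓ := ℓ)] at h1 h2
  exact h2.comp h1

theorem twistedEval_mul (u : B ⊗[k] B) : Q.twistedEval v ((Q.twisted v ℓ).mul u) =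
    convMap Q.toQuasiBialgebra v (Q.twisted v ℓ).act (Q.twisted v ℓ).act (Q.twistedEval v)
      (Q.twistedEval v) u := by
  have hN := isBimodule_res v
  have key := Q.evalOne_hom (Q.isIntertwiner_twistedEval (v := v) (ℓ := ℓ))
    (isRepHom_evalMap_right (Q.twistedEval v) (σ := resRight v) (fun b h m => by simp [mul_assoc]))
  rw [twisted_mul]
  refine (key _).symm.trans ?_
  rw [Q.evalOne_adTensor hN Q.isRep_twisted, Q.evalPair_eq_pairMap (ℓ := ℓ)]
  rfl

theorem twisted_act_one (h : H) :
    (Q.twisted v ℓ).act h (Q.twisted v ℓ).one = Q.ε h • (Q.twisted v ℓ).one := by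
  have e : ∀ d : H ⊗[k] H, biAct (resAct v (LinearMap.mul k B)) (resRight v ∘ₗ Q.S.toLinearMap) d
      (v Q.β) = v (Q.contractβ d) := fun d =>
    TensorProduct.induction_on d (by simp) (fun x y => by simp [mul_assoc])
      (fun x y hx hy => by simp only [map_add, LinearMap.add_apply, hx, hy])
  rw [twisted_act]
  change biAct _ _ (Q.Δ h) (v Q.β) = Q.ε h • v Q.β
  rw [e, contractβ_Δ, map_smul]

theorem twistedEval_one : Q.twistedEval v (Q.twisted v ℓ).one = 1 := by
  have h6 : LinearMap.mul' k H (TensorProduct.map (LinearMap.mulRight k Q.β) Q.contractα Q.Φ) = 1 :=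
    Q.antipode_Φ
  have e : ∀ s : H ⊗[k] (H ⊗[k] H), biAct (resAct v (LinearMap.mul k B)) (resRight v)
      (Q.contractα.lTensor H s) (v Q.β) = v (LinearMap.mul' k H (TensorProduct.map
        (LinearMap.mulRight k Q.β) Q.contractα s)) := fun s =>
    TensorProduct.induction_on s (by simp) (fun x y => by simp [mul_assoc])
      (fun x y hx hy => by simp only [map_add, LinearMap.add_apply, hx, hy])
  change biAct _ _ Q.qElem (v Q.β) = 1
  rw [qElem, e, h6, map_one]

end QuasiHopfAlgebra

end Twisted

/-! ### The coaction of `B^v` -/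

section TwistedCoaction

variable {k H B : Type*} [Field k] [Ring H] [Algebra k H] [Ring B] [Algebra k B]

theorem tensorAct_resAct (Q : QuasiBialgebra k H) (v : H →ₐ[k] B) (h : H) (w : H ⊗[k] B) :
    Q.tensorAct (LinearMap.mul k H) (resAct v (LinearMap.mul k B)) h w =
      Algebra.TensorProduct.map (AlgHom.id k H) v (Q.Δ h) * w := by
  rw [← map₂_mul_eq_mul]
  exact LinearMap.congr_fun (QuasiBialgebra.map₂_comp_algHom_right v (LinearMap.mul k B)
    (LinearMap.mul k H) (Q.Δ h)) w

theorem rightAct_resRight (v : H →ₐ[k] B) (h : H) (w : H ⊗[k] B) :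
    rightAct H (resRight v) h w = w * (1 ⊗ₜ v h) := by
  refine TensorProduct.induction_on w (by simp) (fun x y => by simp)
    (fun x y hx hy => by simp only [map_add, add_mul, hx, hy])

theorem coactAct_mul (ℓ : B →ₐ[k] H ⊗[k] B) (b : B) (w : H ⊗[k] B) :
    coactAct ℓ (LinearMap.mul k H) (LinearMap.mul k B) b w = ℓ b * w :=
  map₂_mul_eq_mul _ _

namespace QuasiHopfAlgebra

variable (Q : QuasiHopfAlgebra k H) (v : H →ₐ[k] B) (ℓ : B →ₐ[k] H ⊗[k] B)

/-- `h ⊗ z ↦ ℓ(E(h ▷ b)) (id ⊗ v)(z)` -/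
def coactEval (b : B) : H ⊗[k] (H ⊗[k] H) →ₗ[k] H ⊗[k] B :=
  TensorProduct.lift ((LinearMap.mul k (H ⊗[k] B)).compl₁₂
    (ℓ.toLinearMap ∘ₗ Q.twistedEval v ∘ₗ (Q.twisted v ℓ).act.flip b)
    (Algebra.TensorProduct.map (AlgHom.id k H) v).toLinearMap)

theorem coactEval_tmul (b : B) (h : H) (z : H ⊗[k] H) : Q.coactEval v ℓ b (h ⊗ₜ z) =
    ℓ (Q.twistedEval v ((Q.twisted v ℓ).act h b)) *
      Algebra.TensorProduct.map (AlgHom.id k H) v z := rfl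

variable {v ℓ}

/-- The coaction of `B^v`, up to the isomorphism `adTensorInv`. -/
theorem twisted_coact_eq (b : B) : (Q.twisted v ℓ).coact b =
    Q.adTensorInv (LinearMap.mul k H) (resAct v (LinearMap.mul k B)) (resRight v)
      (TensorProduct.lift ((LinearMap.mul k (H ⊗[k] B)).compl₁₂
        (LinearMap.mulRight k (ℓ b) ∘ₗ (Algebra.TensorProduct.map (AlgHom.id k H) v).toLinearMap ∘ₗ
          Q.Δ.toLinearMap)
        ((Algebra.TensorProduct.map (AlgHom.id k H) v).toLinearMap ∘ₗ
          LinearMap.mulLeft k Q.fInv)) (Q.kMap.lTensor H Q.Φ)) := by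
  have hmul : mulTensor (k := k) (H := H) (LinearMap.mul' k B) = LinearMap.mul k (H ⊗[k] B) :=
    LinearMap.ext₂ map₂_mul_eq_mul
  let vt : H ⊗[k] H →ₐ[k] H ⊗[k] B := Algebra.TensorProduct.map (AlgHom.id k H) v
  let F : (H ⊗[k] H) ⊗[k] (H ⊗[k] (H ⊗[k] H)) →ₗ[k] H ⊗[k] B :=
    TensorProduct.lift (LinearMap.mul k (H ⊗[k] B)) ∘ₗ TensorProduct.map
      ((LinearMap.mul k (H ⊗[k] B)).flip (ℓ b) ∘ₗ LinearMap.lTensor H v.toLinearMap)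
      (LinearMap.lTensor H v.toLinearMap ∘ₗ LinearMap.mulLeft k Q.fInv ∘ₗ Q.coactAux)
  have hF : ∀ x w, F (x ⊗ₜ w) = vt x * ℓ b * vt (Q.fInv * Q.coactAux w) := fun _ _ => rfl
  let G : H ⊗[k] (H ⊗[k] H) →ₗ[k] H ⊗[k] B :=
    TensorProduct.lift ((LinearMap.mul k (H ⊗[k] B)).compl₁₂
        (LinearMap.mulRight k (ℓ b) ∘ₗ vt.toLinearMap ∘ₗ Q.Δ.toLinearMap)
        (vt.toLinearMap ∘ₗ LinearMap.mulLeft k Q.fInv))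
  have hG : ∀ x z, G (x ⊗ₜ z) = vt (Q.Δ x) * ℓ b * vt (Q.fInv * z) := fun _ _ => rfl
  have hc : (Q.twisted v ℓ).coact b = F Q.elemCoact := by
    change TensorProduct.lift (mulTensor (LinearMap.mul' k B)) (TensorProduct.map
      ((mulTensor (LinearMap.mul' k B)).flip (ℓ b) ∘ₗ LinearMap.lTensor H v.toLinearMap) _
        Q.elemCoact) = _
    rw [hmul]
    rfl
  have ma : ∀ x y z : (H ⊗[k] H) ⊗[k] (H ⊗[k] (H ⊗[k] H)), x * (y + z) = x * y + x * z :=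
    fun x y z => map_add (LinearMap.mulLeft k x) y z
  have am : ∀ x y z : (H ⊗[k] H) ⊗[k] (H ⊗[k] (H ⊗[k] H)), (x + y) * z = x * z + y * z :=
    fun x y z => map_add (LinearMap.mulRight k z) x y
  have mz : ∀ x : (H ⊗[k] H) ⊗[k] (H ⊗[k] (H ⊗[k] H)), x * 0 = 0 :=
    fun x => map_zero (LinearMap.mulLeft k x)
  have zm : ∀ x : (H ⊗[k] H) ⊗[k] (H ⊗[k] (H ⊗[k] H)), 0 * x = 0 :=
    fun x => map_zero (LinearMap.mulRight k x)
  have mt : ∀ (x x' : H ⊗[k] H) (y y' : H ⊗[k] (H ⊗[k] H)),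
      (x ⊗ₜ[k] y) * (x' ⊗ₜ[k] y') = (x * x') ⊗ₜ (y * y') := fun x x' y y' =>
    Algebra.TensorProduct.tmul_mul_tmul x x' y y'
  have haux : ∀ (c : H) (w : H ⊗[k] (H ⊗[k] H)),
      Q.coactAux ((c ⊗ₜ 1) * w) = Q.coactAux w * (1 ⊗ₜ Q.S c) := by
    intro c w
    induction w using tensor_induction₃ with
    | h0 => simp only [map_zero, mul_zero, zero_mul]
    | hadd x y hx hy => simp only [map_add, mul_add, add_mul, hx, hy]
    | h x y z => simp [coactAux, Q.S_mul, Algebra.TensorProduct.one_def]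
  have key : ∀ (s : H ⊗[k] (H ⊗[k] H)) (W : H ⊗[k] (H ⊗[k] (H ⊗[k] H))),
      F (LinearMap.lTensor (H ⊗[k] H) ((TensorProduct.mk k H (H ⊗[k] H)).flip 1)
        ((TensorProduct.assoc k H H H).symm s) *
        Algebra.TensorProduct.map Q.Δ (AlgHom.id k (H ⊗[k] (H ⊗[k] H))) W) =
      TensorProduct.map₂ (LinearMap.mul k H) (biAct (resAct v (LinearMap.mul k B))
        (resRight v ∘ₗ Q.S.toLinearMap)) s (G (Q.coactAux.lTensor H W)) := by
    intro s W
    refine TensorProduct.induction_on W ?_ (fun w W => ?_) (fun x y hx hy => ?_)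
    · simp only [map_zero, mz]
    · induction s using tensor_induction₃ with
      | h0 => simp only [map_zero, zm, LinearMap.zero_apply]
      | hadd x y hx hy => simp only [map_add, am, LinearMap.add_apply, hx, hy]
      | h x y z =>
      have e2 : ∀ u : H ⊗[k] B, TensorProduct.map₂ (LinearMap.mul k H)
          (biAct (resAct v (LinearMap.mul k B)) (resRight v ∘ₗ Q.S.toLinearMap))
            (x ⊗ₜ (y ⊗ₜ z)) u = vt (x ⊗ₜ y) * u * (1 ⊗ₜ v (Q.S z)) := fun u =>
        TensorProduct.induction_on u (by simp) (fun a b => by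
          simp [TensorProduct.map₂_apply_tmul, vt, mul_assoc])
          (fun x y hx hy => by simp only [map_add, mul_add, add_mul, hx, hy])
      have e3 : vt (1 ⊗ₜ Q.S z) = 1 ⊗ₜ v (Q.S z) := rfl
      rw [LinearMap.lTensor_tmul, hG, e2, TensorProduct.assoc_symm_tmul, LinearMap.lTensor_tmul,
        Algebra.TensorProduct.map_tmul, mt, hF]
      change vt ((x ⊗ₜ y) * Q.Δ w) * ℓ b * vt (Q.fInv * Q.coactAux ((z ⊗ₜ 1) * W)) = _
      rw [haux, ← e3]
      simp only [map_mul, mul_assoc]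
    · simp only [map_add, ma, hx, hy]
  rw [hc, elemCoact, key, lTensor_coactAux_midΔ]
  rfl

/-- The coaction of `B^v` in terms of evaluation: `λ(b)` corresponds under `adTensorInv` to
`ℓ(E(x¹ ▷ b)) Δ(x²) p (1 ⊗ S(x³))`. -/
theorem twisted_coact (hB : IsComoduleAlgebra Q.toQuasiBialgebra v ℓ) (b : B) :
    (Q.twisted v ℓ).coact b =
    Q.adTensorInv (LinearMap.mul k H) (resAct v (LinearMap.mul k B)) (resRight v)
      (Q.coactEval v ℓ b ((Q.pMap ∘ₗ Q.S.toLinearMap.lTensor H).lTensor H Q.Φinv)) := by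
  let vt : H ⊗[k] H →ₐ[k] H ⊗[k] B := Algebra.TensorProduct.map (AlgHom.id k H) v
  have hN := isBimodule_res v
  have h1 : ∀ t w : H ⊗[k] H, Q.coactEval v ℓ b (Q.Δ.toLinearMap.lTensor H t * (1 ⊗ₜ w)) =
      ℓ (biAct (resAct v (LinearMap.mul k B)) (resRight v) (Q.eMap t) b) * vt w := by
    intro t w
    refine TensorProduct.induction_on t (by simp) (fun a c => ?_)
      (fun x y hx hy => by simp only [map_add, add_mul, LinearMap.add_apply, hx, hy])
    rw [LinearMap.lTensor_tmul, Algebra.TensorProduct.tmul_mul_tmul, mul_one, coactEval_tmul,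
      Q.biAct_eMap_tmul hN, resRight_apply, map_mul, map_mul, hB.coact_map, mul_assoc, twisted_act]
    rfl
  have h2 : ∀ t, TensorProduct.lift ((LinearMap.mul k (H ⊗[k] B)).compl₁₂
        (LinearMap.mulRight k (ℓ b) ∘ₗ (Algebra.TensorProduct.map (AlgHom.id k H) v).toLinearMap ∘ₗ
          Q.Δ.toLinearMap)
        ((Algebra.TensorProduct.map (AlgHom.id k H) v).toLinearMap ∘ₗ
          LinearMap.mulLeft k Q.fInv)) t = Q.coactEval v ℓ b (Q.twistMap t) := by
    intro t
    refine TensorProduct.induction_on t (by simp) (fun y z => ?_)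
      (fun x y hx hy => by simp only [map_add, hx, hy])
    change vt (Q.Δ y) * ℓ b * vt (Q.fInv * z) = Q.coactEval v ℓ b
      (Q.Δ.toLinearMap.lTensor H (Q.Δ y * Q.pElem) * (1 ⊗ₜ (Q.fInv * z)))
    rw [h1, Q.biAct_eMap_Δ_mul hN, Q.biAct_eMap_pElem hN, resAct_mul_apply, map_mul,
      map_mul ℓ, hB.coact_map]
  rw [twisted_coact_eq, h2, twistMap_kMap_Φ]

variable (v ℓ)

/-- The half-braiding of `B^v` with the regular module `H`, as evaluation prescribes it, followed by
`adTensor`: `b` acts on `adTensor (h ⊗ 1)` in the `B`-module `H ⊗ B`. -/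
def evalBraid : B ⊗[k] H →ₗ[k] H ⊗[k] B :=
  evalMap (Q.twistedEval v) (coactAct ℓ (LinearMap.mul k H) (LinearMap.mul k B)) ∘ₗ
    Q.adTensor (Q.twisted v ℓ).act
      (Q.tensorAct (LinearMap.mul k H) (resAct v (LinearMap.mul k B))) (rightAct H (resRight v)) ∘ₗ
    (Q.adTensor (LinearMap.mul k H) (resAct v (LinearMap.mul k B)) (resRight v) ∘ₗ
      (TensorProduct.mk k H B).flip (Q.twisted v ℓ).one).lTensor B

variable {v ℓ}

theorem adTensor_one : Q.adTensor (LinearMap.mul k H) (resAct v (LinearMap.mul k B)) (resRight v)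
    (1 ⊗ₜ (Q.twisted v ℓ).one) = Algebra.TensorProduct.map (AlgHom.id k H) v Q.pElem := by
  rw [adTensor, pElem]
  generalize Q.Φinv = t
  induction t using tensor_induction₃ with
  | h0 => simp only [map_zero, LinearMap.zero_apply]
  | hadd x y hx hy => simp only [map_add, LinearMap.add_apply, hx, hy]
  | h x y z =>
  change (x * 1) ⊗ₜ (v y * (v Q.β * v (Q.S z))) = x ⊗ₜ v (y * Q.β * Q.S z)
  simp [mul_assoc]

theorem adTensor_coact (hB : IsComoduleAlgebra Q.toQuasiBialgebra v ℓ) (b : B) :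
    Q.adTensor (LinearMap.mul k H) (resAct v (LinearMap.mul k B)) (resRight v)
      ((Q.twisted v ℓ).coact b) = Q.evalBraid v ℓ (b ⊗ₜ 1) := by
  rw [twisted_coact Q hB, Q.adTensor_adTensorInv (isBimodule_res v) IsRep.mulLeft, evalBraid,
    LinearMap.comp_apply, LinearMap.comp_apply, LinearMap.lTensor_tmul, LinearMap.comp_apply,
    LinearMap.flip_apply, TensorProduct.mk_apply, adTensor_one]
  conv_rhs => rw [adTensor]
  generalize Q.Φinv = t
  induction t using tensor_induction₃ with
  | h0 => simp only [map_zero, LinearMap.zero_apply]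
  | hadd x y hx hy => simp only [map_add, LinearMap.add_apply, hx, hy]
  | h x y z =>
  rw [LinearMap.lTensor_tmul, coactEval_tmul, TensorProduct.map₂_apply_tmul,
    TensorProduct.map_tmul, evalMap_tmul, coactAct_mul, biAct_tmul, tensorAct_resAct,
    LinearMap.comp_apply, LinearMap.comp_apply, rightAct_resRight, LinearMap.lTensor_tmul,
    pMap_tmul, map_mul, map_mul]
  simp [mul_assoc]

theorem adTensor_ydBraid (hB : IsComoduleAlgebra Q.toQuasiBialgebra v ℓ) (u : B ⊗[k] H) :
    Q.adTensor (LinearMap.mul k H) (resAct v (LinearMap.mul k B)) (resRight v)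
      (ydBraid (Q.twisted v ℓ).coact (LinearMap.mul k H) u) = Q.evalBraid v ℓ u := by
  refine TensorProduct.induction_on u (by simp) (fun b x => ?_)
    (fun x y hx hy => by simp only [map_add, hx, hy])
  have hx : IsRepHom (LinearMap.mul k H) (LinearMap.mul k H) ((LinearMap.mul k H).flip x) :=
    isRepHom_apply_right IsRep.mulLeft x
  have e : b ⊗ₜ[k] x = ((LinearMap.mul k H).flip x).lTensor B (b ⊗ₜ 1) := by simp
  have h1 : IsRepHom (Q.tensorAct (LinearMap.mul k H) (resAct v (LinearMap.mul k B)))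
      (Q.tensorAct (LinearMap.mul k H) (resAct v (LinearMap.mul k B)))
      (((LinearMap.mul k H).flip x).rTensor B) := Q.isRepHom_rTensor hx
  have h2 : IsRepHom (rightAct H (resRight v)) (rightAct H (resRight v))
      (((LinearMap.mul k H).flip x).rTensor B) := fun h w =>
    (lTensor_rTensor_comm _ _ _).symm
  have e1 : ((Q.adTensor (LinearMap.mul k H) (resAct v (LinearMap.mul k B)) (resRight v)) ∘ₗ
      (TensorProduct.mk k H B).flip (Q.twisted v ℓ).one) ∘ₗ (LinearMap.mul k H).flip x =
      ((LinearMap.mul k H).flip x).rTensor B ∘ₗ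
        ((Q.adTensor (LinearMap.mul k H) (resAct v (LinearMap.mul k B)) (resRight v)) ∘ₗ
      (TensorProduct.mk k H B).flip (Q.twisted v ℓ).one) :=
    LinearMap.ext fun y => Q.adTensor_rTensor hx (y ⊗ₜ _)
  rw [e, ydBraid_lTensor hx, ydBraid_tmul_one, Q.adTensor_rTensor hx, Q.adTensor_coact hB]
  have e2 := LinearMap.lTensor_comp_apply B _ _ (b ⊗ₜ[k] 1) |>.symm.trans
    ((LinearMap.congr_fun (congrArg (LinearMap.lTensor B) e1) (b ⊗ₜ[k] 1)).trans
      (LinearMap.lTensor_comp_apply B _ _ (b ⊗ₜ[k] 1)))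
  rw [evalBraid, LinearMap.comp_apply, LinearMap.comp_apply, LinearMap.comp_apply,
    LinearMap.comp_apply, e2, Q.adTensor_lTensor h1 h2]
  exact (evalMap_lTensor (hx.coactAct (IsRepHom.id (LinearMap.mul k B))) _ _).symm

/-- The bijection `adTensor` turns the half-braiding into `evalBraid`, which is a composite of
`H`-linear maps. -/
theorem isRepHom_ydBraid_twisted (hB : IsComoduleAlgebra Q.toQuasiBialgebra v ℓ) :
    IsRepHom (Q.tensorAct (Q.twisted v ℓ).act (LinearMap.mul k H))
      (Q.tensorAct (LinearMap.mul k H) (Q.twisted v ℓ).act)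
      (ydBraid (Q.twisted v ℓ).coact (LinearMap.mul k H)) := by
  have hH : IsRep (LinearMap.mul k H) := IsRep.mulLeft
  have hN := isBimodule_res v
  have hHN := hN.tensor Q.toQuasiBialgebra hH
  have hV := Q.isRep_twisted (v := v) (ℓ := ℓ)
  have hAd := Q.isRepHom_adTensor hN hH
  have hAd' := Q.isRepHom_adTensor hHN hV
  simp only [← Q.twisted_act (v := v) (ℓ := ℓ)] at hAd
  have h0 : IsRepHom (LinearMap.mul k H) (Q.tensorAct (LinearMap.mul k H) (Q.twisted v ℓ).act)
      ((TensorProduct.mk k H B).flip (Q.twisted v ℓ).one) := fun h x =>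
    (Q.tensorAct_counit_right Q.twisted_act_one h x).symm
  have hev := Q.adAct_hom
    ((Q.isIntertwiner_twistedEval (v := v) (ℓ := ℓ)).isRepHom
      (isRep_coactAct (ℓ := ℓ) hH IsRep.mulLeft))
    (isRepHom_evalMap_right (Q.twistedEval v) (σ := rightAct H (resRight v))
      (fun b h m => by
        simp only [coactAct_mul, rightAct_resRight, mul_assoc]))
  rw [resAct_coactAct hB] at hev
  have hG : IsRepHom (Q.tensorAct (Q.twisted v ℓ).act (LinearMap.mul k H))
      (Q.adAct (Q.tensorAct (LinearMap.mul k H) (resAct v (LinearMap.mul k B)))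
        (rightAct H (resRight v))) (Q.evalBraid v ℓ) :=
    hev.comp (hAd'.comp (Q.isRepHom_lTensor (hAd.comp h0)))
  intro h u
  refine (Q.bijective_adTensor hN hH).1 ?_
  rw [Q.adTensor_ydBraid hB, hG, hAd, Q.adTensor_ydBraid hB]

theorem twistedEval_braid (hB : IsComoduleAlgebra Q.toQuasiBialgebra v ℓ) (b : B) :
    pairMap Q.toQuasiBialgebra v (LinearMap.mul k H) (Q.twisted v ℓ).act (Q.twistedEval v)
      ((Q.twisted v ℓ).coact b) =
    evalMap (Q.twistedEval v) (coactAct ℓ (LinearMap.mul k H) (LinearMap.mul k B))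
      (Q.assocHom (Q.twisted v ℓ).act (LinearMap.mul k H) (resAct v (LinearMap.mul k B))
        ((b ⊗ₜ 1) ⊗ₜ 1)) := by
  have hH : IsRep (LinearMap.mul k H) := IsRep.mulLeft
  have hN := isBimodule_res v
  have hHN := hN.tensor Q.toQuasiBialgebra hH
  have hV := Q.isRep_twisted (v := v) (ℓ := ℓ)
  have hr : IsRep (resAct v (LinearMap.mul k B)) := isRep_resAct IsRep.mulLeft
  have hAd := Q.isRepHom_adTensor hN hH
  simp only [← Q.twisted_act (v := v) (ℓ := ℓ)] at hAd
  have hev := Q.evalOne_hom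
    ((Q.isIntertwiner_twistedEval (v := v) (ℓ := ℓ)).isRepHom
      (isRep_coactAct (ℓ := ℓ) hH IsRep.mulLeft))
    (isRepHom_evalMap_right (Q.twistedEval v) (σ := rightAct H (resRight v))
      (fun b h m => by
        simp only [coactAct_mul, rightAct_resRight, mul_assoc]))
  rw [resAct_coactAct hB] at hev
  have h1 : ∀ h : H, Q.evalOne (Q.tensorAct (LinearMap.mul k H) (resAct v (LinearMap.mul k B)))
      (rightAct H (resRight v)) (Q.adTensor (LinearMap.mul k H) (resAct v (LinearMap.mul k B))
        (resRight v) (h ⊗ₜ (Q.twisted v ℓ).one)) = h ⊗ₜ 1 := by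
    intro h
    rw [Q.evalOne_adTensor hN hH, Q.evalPair_eq_pairMap (ℓ := ℓ)]
    have hc := Q.assocHom_counit_mid hH hr (ρP := resAct v (LinearMap.mul k B))
      (Q.twisted_act_one (v := v) (ℓ := ℓ)) h 1
    simp [pairMap, hc, twistedEval_one]
  have h2 : ∀ t : H ⊗[k] H, biAct (Q.tensorAct (LinearMap.mul k H)
      (resAct v (LinearMap.mul k B))) (rightAct H (resRight v)) (Q.eMap t)
      (Q.adTensor (LinearMap.mul k H) (resAct v (LinearMap.mul k B))
        (resRight v) (1 ⊗ₜ (Q.twisted v ℓ).one)) =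
      TensorProduct.map₂ (LinearMap.mul k H) (resAct v (LinearMap.mul k B)) t (1 ⊗ₜ 1) := by
    intro t
    refine TensorProduct.induction_on t (by simp) (fun h c => ?_)
      (fun x y hx hy => by simp only [map_add, LinearMap.add_apply, hx, hy])
    rw [Q.biAct_eMap_tmul hHN, ← hAd, Q.tensorAct_counit_right Q.twisted_act_one, h1]
    simp [TensorProduct.map₂_apply_tmul]
  have h3 : Q.evalPair (Q.twisted v ℓ).act (Q.tensorAct (LinearMap.mul k H)
      (resAct v (LinearMap.mul k B))) (rightAct H (resRight v)) (b ⊗ₜ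
      Q.adTensor (LinearMap.mul k H) (resAct v (LinearMap.mul k B))
        (resRight v) (1 ⊗ₜ (Q.twisted v ℓ).one)) =
      Q.assocHom (Q.twisted v ℓ).act (LinearMap.mul k H) (resAct v (LinearMap.mul k B))
        ((b ⊗ₜ 1) ⊗ₜ 1) := by
    rw [evalPair, QuasiBialgebra.assocHom, LinearMap.comp_apply]
    generalize (Q.Φ : H ⊗[k] (H ⊗[k] H)) = s
    refine TensorProduct.induction_on s (by simp) (fun h t => ?_)
      (fun x y hx hy => by simp only [map_add, LinearMap.add_apply, hx, hy])
    rw [LinearMap.lTensor_tmul, TensorProduct.map₂_apply_tmul, TensorProduct.map_tmul, h2]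
    rfl
  rw [← Q.evalPair_eq_pairMap, ← Q.evalOne_adTensor hN hH, Q.adTensor_coact hB, evalBraid,
    LinearMap.comp_apply, LinearMap.comp_apply, ← hev, Q.evalOne_adTensor hHN hV, ← h3]
  rfl

/-- `B^v` represents the natural transformations of the forgetful functor from `B`-modules to
`H`-modules. -/
theorem isEndAlgebra_twisted (hB : IsComoduleAlgebra Q.toQuasiBialgebra v ℓ) :
    IsEndAlgebra Q.toQuasiBialgebra v ℓ (Q.twisted v ℓ) (Q.twistedEval v) where
  isRep := Q.isRep_twisted
  braided := ⟨Q.isIntertwiner_twistedEval, Q.twistedEval_braid hB⟩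
  sep y y' h := Q.eq_of_evalOne (isBimodule_res v) fun g => by
    have := h g
    rwa [twisted_act] at this
  sep_tensor ρX hX w w' h := Q.eq_of_evalPair (isBimodule_res v) hX fun g => by
    have := h g
    rwa [← Q.evalPair_eq_pairMap, ← Q.evalPair_eq_pairMap, twisted_act] at this
  compat h m := by
    rw [Q.isRepHom_ydBraid_twisted hB, ydBraid_tmul_one]
  act_mul := Q.isRepHom_twisted_mul
  eval_mul := Q.twistedEval_mul
  act_one := Q.twisted_act_one
  eval_one := Q.twistedEval_one

theorem isYDAlgebra_twisted (hB : IsComoduleAlgebra Q.toQuasiBialgebra v ℓ) :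
    (Q.twisted v ℓ).IsYDAlgebra Q.toQuasiBialgebra :=
  (Q.isEndAlgebra_twisted hB).isYDAlgebra hB

end QuasiHopfAlgebra

end TwistedCoaction

/-! ### Maps from a braided tensor product to an algebra of natural endomorphisms -/

section BraidedTensor

universe uk uH uB uV uW uU

variable {k : Type uk} {H : Type uH} {B : Type uB} [Field k] [Ring H] [Algebra k H] [Ring B]
  [Algebra k B]
variable {V : Type uV} {W : Type uW} {U : Type uU} [AddCommGroup V] [Module k V]
  [AddCommGroup W] [Module k W] [AddCommGroup U] [Module k U]
  {X M : Type*} [AddCommGroup X] [Module k X] [AddCommGroup M] [Module k M]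
variable {Q : QuasiBialgebra k H} {v : H →ₐ[k] B} {ℓ : B →ₐ[k] H ⊗[k] B}

/-- Sliding `W` past `V` in `(W ⊗ (V ⊗ X)) ⊗ M` may be done with `X ⊗ M` as the spectator. -/
theorem assocHom_ydSlide_rTensor {ρV : H →ₗ[k] V →ₗ[k] V} {lW : W →ₗ[k] H ⊗[k] W}
    {ρW : H →ₗ[k] W →ₗ[k] W} {ρX : H →ₗ[k] X →ₗ[k] X} {ρM : H →ₗ[k] M →ₗ[k] M}
    (hV : IsRep ρV) (hW' : IsYDModule Q ρW lW) (hX : IsRep ρX) (hM : IsRep ρM)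
    (z : (W ⊗[k] (V ⊗[k] X)) ⊗[k] M) :
    (Q.assocHom ρW ρX ρM).lTensor V (Q.assocHom ρV (Q.tensorAct ρW ρX) ρM
      ((ydSlide Q lW ρW ρV ρX).rTensor M z)) =
    ydSlide Q lW ρW ρV (Q.tensorAct ρX ρM) ((Q.assocHom ρV ρX ρM).lTensor W
      (Q.assocHom ρW (Q.tensorAct ρV ρX) ρM z)) := by
  have hW := hW'.isRep
  obtain ⟨z, rfl⟩ : ∃ z', z = (Q.assocHom ρW ρV ρX).rTensor M z' :=
    ⟨(Q.assocInv ρW ρV ρX).rTensor M z, by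
      rw [← LinearMap.rTensor_comp_apply]
      have : Q.assocHom ρW ρV ρX ∘ₗ Q.assocInv ρW ρV ρX = LinearMap.id :=
        LinearMap.ext (Q.assocHom_assocInv hW hV hX)
      rw [this, LinearMap.rTensor_id, LinearMap.id_apply]⟩
  have e : (ydSlide Q lW ρW ρV ρX).rTensor M ((Q.assocHom ρW ρV ρX).rTensor M z) =
      (Q.assocHom ρV ρW ρX).rTensor M (((ydBraid lW ρV).rTensor X).rTensor M z) := by
    rw [← LinearMap.rTensor_comp_apply, ← LinearMap.rTensor_comp_apply]
    congr 2
    exact LinearMap.ext (ydSlide_assocHom Q hW hV hX)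
  rw [e, Q.assocHom_pentagon hV hW hX hM, Q.assocHom_rr (isRepHom_ydBraid Q hV hW'),
    Q.assocHom_pentagon hW hV hX hM, ydSlide_assocHom Q hW hV (Q.isRep_tensorAct hX hM)]

variable {D₁ : YDAlgebraData k H V} {D₂ : YDAlgebraData k H W} {i : V →ₗ[k] B} {e : W →ₗ[k] B}

theorem YDAlgebraData.braidedTensor_mul (D₁ : YDAlgebraData k H V) (D₂ : YDAlgebraData k H W)
    (z : (V ⊗[k] W) ⊗[k] (V ⊗[k] W)) : (D₁.braidedTensor Q D₂).mul z =
      TensorProduct.map D₁.mul D₂.mul (Q.assocInv D₁.act D₁.act (Q.tensorAct D₂.act D₂.act)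
        ((ydSlide Q D₂.coact D₂.act D₁.act D₂.act).lTensor V
          (Q.assocHom D₁.act D₂.act (Q.tensorAct D₁.act D₂.act) z))) := by
  simp only [ydSlide, LinearMap.lTensor_comp_apply]
  rfl

/-- The multiplication of a braided tensor product is `H`-linear. -/
theorem isRepHom_braidedTensor_mul (h₁ : D₁.IsYDAlgebra Q) (h₂ : D₂.IsYDAlgebra Q) :
    IsRepHom (Q.tensorAct (Q.tensorAct D₁.act D₂.act) (Q.tensorAct D₁.act D₂.act))
      (Q.tensorAct D₁.act D₂.act) (D₁.braidedTensor Q D₂).mul := by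
  have hV := h₁.isYDModule.isRep
  have hW := h₂.isYDModule.isRep
  have hmul : (D₁.braidedTensor Q D₂).mul = TensorProduct.map D₁.mul D₂.mul ∘ₗ
      Q.assocInv D₁.act D₁.act (Q.tensorAct D₂.act D₂.act) ∘ₗ
        (ydSlide Q D₂.coact D₂.act D₁.act D₂.act).lTensor V ∘ₗ
          Q.assocHom D₁.act D₂.act (Q.tensorAct D₁.act D₂.act) :=
    LinearMap.ext (YDAlgebraData.braidedTensor_mul D₁ D₂)
  rw [hmul]
  exact (Q.isRepHom_map h₁.isRepHom_mul h₂.isRepHom_mul).comp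
    ((Q.isRepHom_assocInv hV hV (Q.isRep_tensorAct hW hW)).comp
      ((Q.isRepHom_lTensor (isRepHom_ydSlide Q hV hW h₂.isYDModule)).comp
        (Q.isRepHom_assocHom hV hW (Q.isRep_tensorAct hV hW))))

theorem evalMap_mul {θ : B →ₗ[k] M →ₗ[k] M} (hθ : IsRep θ)
    (hi : ∀ u, i (D₁.mul u) = convMap Q v D₁.act D₁.act i i u) (u : (V ⊗[k] V) ⊗[k] M) :
    evalMap i θ (D₁.mul.rTensor M u) =
      evalMap i θ ((evalMap i θ).lTensor V (Q.assocHom D₁.act D₁.act (resAct v θ) u)) := by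
  rw [← evalMap_convMap hθ, evalMap_rTensor]
  congr 2
  exact LinearMap.ext hi

/-- If the values of the braided intertwiner `e` are in the image of `v`, the evaluations along `i`
and `e` commute up to the half-braiding. -/
theorem evalMap_lTensor_evalMap {θ : B →ₗ[k] M →ₗ[k] M} (hθ : IsRep θ)
    (hB : IsComoduleAlgebra Q v ℓ) {ρV : H →ₗ[k] V →ₗ[k] V} {lW : W →ₗ[k] H ⊗[k] W}
    {ρW : H →ₗ[k] W →ₗ[k] W} (hV : IsRep ρV) (hW : IsRep ρW) (hi : IsIntertwiner Q v ρV i)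
    (he : IsBraidedIntertwiner Q v ℓ ρW lW e) (hr : ∀ y, ∃ h, e y = v h)
    (u : W ⊗[k] (V ⊗[k] M)) :
    evalMap i θ ((evalMap e θ).lTensor V (ydSlide Q lW ρW ρV (resAct v θ) u)) =
      evalMap e θ ((evalMap i θ).lTensor W u) := by
  rw [he.evalMap_ydSlide hW hV hθ]
  refine TensorProduct.induction_on u (by simp) (fun y x => ?_)
    (fun x y hx hy => by simp only [map_add, hx, hy])
  obtain ⟨h, hh⟩ := hr y
  have h1 : coactAct ℓ ρV θ (v h) = Q.tensorAct ρV (resAct v θ) h := by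
    rw [← resAct_coactAct hB]
    rfl
  rw [LinearMap.lTensor_tmul, evalMap_tmul, evalMap_tmul, hh, h1, hi.isRepHom hθ]
  rfl

/-- `i ∗ e` is multiplicative on the braided tensor product. -/
theorem evalMap_braidedTensor_mul {θ : B →ₗ[k] M →ₗ[k] M} (hθ : IsRep θ)
    (hB : IsComoduleAlgebra Q v ℓ) (h₁ : D₁.IsYDAlgebra Q) (h₂ : D₂.IsYDAlgebra Q)
    (hi : IsIntertwiner Q v D₁.act i) (he : IsBraidedIntertwiner Q v ℓ D₂.act D₂.coact e)
    (hr : ∀ y, ∃ h, e y = v h)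
    (hi' : ∀ u, i (D₁.mul u) = convMap Q v D₁.act D₁.act i i u)
    (he' : ∀ u, e (D₂.mul u) = convMap Q v D₂.act D₂.act e e u)
    (z : ((V ⊗[k] W) ⊗[k] (V ⊗[k] W)) ⊗[k] M) :
    evalMap (convMap Q v D₁.act D₂.act i e) θ ((D₁.braidedTensor Q D₂).mul.rTensor M z) =
      evalMap (convMap Q v D₁.act D₂.act i e) θ
        ((evalMap (convMap Q v D₁.act D₂.act i e) θ).lTensor (V ⊗[k] W)
          (Q.assocHom (Q.tensorAct D₁.act D₂.act) (Q.tensorAct D₁.act D₂.act) (resAct v θ) z)) := by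
  have hV := h₁.isYDModule.isRep
  have hW := h₂.isYDModule.isRep
  have hM := isRep_resAct (v := v) hθ
  have hWM := Q.isRep_tensorAct hW hM
  have hVW := Q.isRep_tensorAct hV hW
  have hWW := Q.isRep_tensorAct hW hW
  have hiM := hi.isRepHom hθ
  have heM := he.isIntertwiner.isRepHom hθ
  have e1 : evalMap (convMap Q v D₁.act D₂.act i e) θ = evalMap i θ ∘ₗ
      (evalMap e θ).lTensor V ∘ₗ Q.assocHom D₁.act D₂.act (resAct v θ) :=
    LinearMap.ext (evalMap_convMap hθ i e)
  have hconv : IsRepHom (Q.tensorAct (Q.tensorAct D₁.act D₂.act) (resAct v θ)) (resAct v θ)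
      (evalMap (convMap Q v D₁.act D₂.act i e) θ) :=
    (hi.convMap he.isIntertwiner hV hW).isRepHom hθ
  let g := evalMap e θ ∘ₗ D₂.mul.rTensor M
  have hg : IsRepHom (Q.tensorAct (Q.tensorAct D₂.act D₂.act) (resAct v θ)) (resAct v θ) g :=
    heM.comp (Q.isRepHom_rTensor h₂.isRepHom_mul)
  have hg' : g = evalMap e θ ∘ₗ (evalMap e θ).lTensor W ∘ₗ
      Q.assocHom D₂.act D₂.act (resAct v θ) := LinearMap.ext (evalMap_mul hθ he')
  have inner : evalMap i θ ∘ₗ g.lTensor V ∘ₗ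
      Q.assocHom D₁.act (Q.tensorAct D₂.act D₂.act) (resAct v θ) ∘ₗ
      (ydSlide Q D₂.coact D₂.act D₁.act D₂.act).rTensor M =
      evalMap e θ ∘ₗ (evalMap (convMap Q v D₁.act D₂.act i e) θ).lTensor W ∘ₗ
        Q.assocHom D₂.act (Q.tensorAct D₁.act D₂.act) (resAct v θ) := by
    refine LinearMap.ext fun s => ?_
    simp only [LinearMap.comp_apply, hg', e1, LinearMap.lTensor_comp_apply]
    rw [assocHom_ydSlide_rTensor hV h₂.isYDModule hW hM,
      ← ydSlide_lTensor_lTensor Q heM hW hV hWM hM,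
      evalMap_lTensor_evalMap hθ hB hV hW hi he hr]
  have hinv : ∀ x, (Q.assocHom D₁.act D₁.act (Q.tensorAct D₂.act D₂.act)).rTensor M
      ((Q.assocInv D₁.act D₁.act (Q.tensorAct D₂.act D₂.act)).rTensor M x) = x := fun x => by
    have : Q.assocHom D₁.act D₁.act (Q.tensorAct D₂.act D₂.act) ∘ₗ
        Q.assocInv D₁.act D₁.act (Q.tensorAct D₂.act D₂.act) = LinearMap.id :=
      LinearMap.ext (Q.assocHom_assocInv hV hV hWW)
    rw [← LinearMap.rTensor_comp_apply, this, LinearMap.rTensor_id, LinearMap.id_apply]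
  have hmul : (D₁.braidedTensor Q D₂).mul = TensorProduct.map D₁.mul D₂.mul ∘ₗ
      Q.assocInv D₁.act D₁.act (Q.tensorAct D₂.act D₂.act) ∘ₗ
        (ydSlide Q D₂.coact D₂.act D₁.act D₂.act).lTensor V ∘ₗ
          Q.assocHom D₁.act D₂.act (Q.tensorAct D₁.act D₂.act) :=
    LinearMap.ext (YDAlgebraData.braidedTensor_mul D₁ D₂)
  have hmap : ∀ y, Q.assocHom D₁.act D₂.act (resAct v θ)
      ((TensorProduct.map D₁.mul D₂.mul).rTensor M y) =
      TensorProduct.map D₁.mul (D₂.mul.rTensor M)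
        (Q.assocHom (Q.tensorAct D₁.act D₁.act) (Q.tensorAct D₂.act D₂.act) (resAct v θ) y) :=
    Q.assocHom_map h₁.isRepHom_mul h₂.isRepHom_mul (IsRepHom.id _)
  have hsplit : ∀ y, (evalMap e θ).lTensor V (TensorProduct.map D₁.mul (D₂.mul.rTensor M) y) =
      D₁.mul.rTensor M (g.lTensor (V ⊗[k] V) y) := fun y =>
    TensorProduct.induction_on y (by simp) (fun a b => rfl)
      (fun x y hx hy => by simp only [map_add, hx, hy])
  have inner' := fun s => LinearMap.congr_fun (congrArg (LinearMap.lTensor V) inner) s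
  simp only [LinearMap.lTensor_comp_apply] at inner'
  rw [hmul, LinearMap.rTensor_comp_apply, LinearMap.rTensor_comp_apply,
    LinearMap.rTensor_comp_apply]
  conv_lhs => rw [e1]
  rw [LinearMap.comp_apply, LinearMap.comp_apply, hmap, hsplit, evalMap_mul hθ hi',
    Q.assocHom_l hg, ← Q.assocHom_pentagon hV hV hWW hM, hinv,
    Q.assocHom_rl (isRepHom_ydSlide Q hV hW h₂.isYDModule), inner',
    Q.assocHom_pentagon hV hW hVW hM, ← Q.assocHom_l hconv]
  exact (evalMap_convMap hθ i e _).symm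

variable {D : YDAlgebraData k H U} {E : U →ₗ[k] B} {F : V ⊗[k] W →ₗ[k] U}

theorem evalMap_comp_convMap {θ : B →ₗ[k] M →ₗ[k] M}
    (hE : ∀ w, E (F w) = convMap Q v D₁.act D₂.act i e w) (u : (V ⊗[k] W) ⊗[k] M) :
    evalMap E θ (F.rTensor M u) = evalMap (convMap Q v D₁.act D₂.act i e) θ u := by
  rw [evalMap_rTensor]
  congr 2
  exact LinearMap.ext hE

/-- An `H`-linear map from a braided tensor product that evaluates to `i ∗ e` is multiplicative. -/
theorem IsEndAlgebra.map_braidedTensor_mul (hD : IsEndAlgebra Q v ℓ D E)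
    (hB : IsComoduleAlgebra Q v ℓ) (h₁ : D₁.IsYDAlgebra Q) (h₂ : D₂.IsYDAlgebra Q)
    (hi : IsIntertwiner Q v D₁.act i) (he : IsBraidedIntertwiner Q v ℓ D₂.act D₂.coact e)
    (hr : ∀ y, ∃ h, e y = v h)
    (hi' : ∀ u, i (D₁.mul u) = convMap Q v D₁.act D₁.act i i u)
    (he' : ∀ u, e (D₂.mul u) = convMap Q v D₂.act D₂.act e e u)
    (hF : IsRepHom (Q.tensorAct D₁.act D₂.act) D.act F)
    (hE : ∀ w, E (F w) = convMap Q v D₁.act D₂.act i e w)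
    (u : (V ⊗[k] W) ⊗[k] (V ⊗[k] W)) :
    F ((D₁.braidedTensor Q D₂).mul u) = D.mul (TensorProduct.map F F u) := by
  have hBr : IsRep (LinearMap.mul k B) := IsRep.mulLeft
  have eval : ∀ u, E (F ((D₁.braidedTensor Q D₂).mul u)) =
      E (D.mul (TensorProduct.map F F u)) := by
    intro u
    have h3 := evalMap_braidedTensor_mul hBr hB h₁ h₂ hi he hr hi' he' (u ⊗ₜ 1)
    have h4 : (evalMap E (LinearMap.mul k B)).lTensor U ∘ₗ F.rTensor (U ⊗[k] B) ∘ₗ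
        (F.rTensor B).lTensor (V ⊗[k] W) = F.rTensor B ∘ₗ
        (evalMap (convMap Q v D₁.act D₂.act i e) (LinearMap.mul k B)).lTensor (V ⊗[k] W) := by
      have : evalMap (convMap Q v D₁.act D₂.act i e) (LinearMap.mul k B) =
          evalMap E (LinearMap.mul k B) ∘ₗ F.rTensor B :=
        LinearMap.ext fun u => (evalMap_comp_convMap hE u).symm
      rw [this]
      exact TensorProduct.ext' fun a b => rfl
    have h5 : TensorProduct.map F F u ⊗ₜ[k] (1 : B) =
        (F.rTensor U).rTensor B ((F.lTensor (V ⊗[k] W)).rTensor B (u ⊗ₜ 1)) := by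
      rw [LinearMap.rTensor_tmul, LinearMap.rTensor_tmul, ← LinearMap.comp_apply,
        LinearMap.rTensor_comp_lTensor]
    have h6 := LinearMap.congr_fun h4
    simp only [LinearMap.comp_apply] at h6
    have h7 : ∀ y, convMap Q v D.act D.act E E y = evalMap E (LinearMap.mul k B)
        ((evalMap E (LinearMap.mul k B)).lTensor U
          (Q.assocHom D.act D.act (resAct v (LinearMap.mul k B)) (y ⊗ₜ 1))) := fun _ => rfl
    rw [hD.eval_mul, hE, h7, h5, Q.assocHom_rr hF, Q.assocHom_rl hF, h6,
      evalMap_comp_convMap hE, ← h3, LinearMap.rTensor_tmul, evalMap_tmul]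
    simp
  refine hD.sep _ _ fun h => ?_
  rw [← hF, ← isRepHom_braidedTensor_mul h₁ h₂, ← hD.act_mul, ← Q.isRepHom_map hF hF, eval]

theorem IsEndAlgebra.map_braidedTensor_one (hD : IsEndAlgebra Q v ℓ D E)
    (h₁ : D₁.IsYDAlgebra Q) (h₂ : D₂.IsYDAlgebra Q) (hi : i D₁.one = 1) (he : e D₂.one = 1)
    (hF : IsRepHom (Q.tensorAct D₁.act D₂.act) D.act F)
    (hE : ∀ w, E (F w) = convMap Q v D₁.act D₂.act i e w) :
    F (D₁.one ⊗ₜ D₂.one) = D.one := by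
  refine hD.sep _ _ fun h => ?_
  have hr : IsRep (resAct v (LinearMap.mul k B)) := isRep_resAct IsRep.mulLeft
  rw [← hF, Q.tensorAct_counit_left h₁.act_one, h₂.act_one, hD.act_one, hE,
    TensorProduct.tmul_smul, map_smul, map_smul, hD.eval_one, convMap]
  simp [Q.assocHom_counit_left h₂.isYDModule.isRep hr h₁.act_one, hi, he]

/-- An `H`-linear map from a tensor product that evaluates to `i ∗ e` is colinear. -/
theorem IsEndAlgebra.map_tensorCoact (hD : IsEndAlgebra Q v ℓ D E)
    (hB : IsComoduleAlgebra Q v ℓ) (h₁ : D₁.IsYDAlgebra Q) (h₂ : D₂.IsYDAlgebra Q)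
    (hi : IsBraidedIntertwiner Q v ℓ D₁.act D₁.coact i)
    (he : IsBraidedIntertwiner Q v ℓ D₂.act D₂.coact e)
    (hF : IsRepHom (Q.tensorAct D₁.act D₂.act) D.act F)
    (hE : ∀ w, E (F w) = convMap Q v D₁.act D₂.act i e w) (u : V ⊗[k] W) :
    D.coact (F u) = F.lTensor H (tensorCoact Q D₁.act D₁.coact D₂.act D₂.coact u) := by
  have hH : IsRep (LinearMap.mul k H) := IsRep.mulLeft
  have hBr : IsRep (LinearMap.mul k B) := IsRep.mulLeft
  have hV := h₁.isYDModule
  have hW := h₂.isYDModule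
  have key := hD.hom_ext (ρP := Q.tensorAct (Q.tensorAct D₁.act D₂.act) (LinearMap.mul k H)) hH
    (F := ydBraid D.coact (LinearMap.mul k H) ∘ₗ F.rTensor H)
    (G := F.lTensor H ∘ₗ tensorBraid Q D₁.coact D₁.act D₂.coact D₂.act (LinearMap.mul k H))
    ((hD.isRepHom_ydBraid hH).comp (Q.isRepHom_rTensor hF))
    ((Q.isRepHom_lTensor hF).comp (isRepHom_tensorBraid Q hH hV hW))
    (fun y => ?_) (u ⊗ₜ 1)
  · rw [LinearMap.comp_apply, LinearMap.comp_apply, LinearMap.rTensor_tmul, ydBraid_tmul_one,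
      ← tensorCoact_eq] at key
    exact key
  · have e1 : F.rTensor H y ⊗ₜ[k] (1 : B) = (F.rTensor H).rTensor B (y ⊗ₜ 1) := rfl
    have e2 : ∀ w : H ⊗[k] (V ⊗[k] W), pairMap Q v (LinearMap.mul k H) D.act E
        (F.lTensor H w) = (evalMap (convMap Q v D₁.act D₂.act i e) (LinearMap.mul k B)).lTensor H
        (Q.assocHom (LinearMap.mul k H) (Q.tensorAct D₁.act D₂.act)
          (resAct v (LinearMap.mul k B)) (w ⊗ₜ 1)) := by
      intro w
      have e3 : evalMap (convMap Q v D₁.act D₂.act i e) (LinearMap.mul k B) =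
          evalMap E (LinearMap.mul k B) ∘ₗ F.rTensor B :=
        LinearMap.ext fun u => (evalMap_comp_convMap hE u).symm
      rw [e3, LinearMap.lTensor_comp_apply, ← Q.assocHom_rl hF]
      rfl
    have e4 := evalMap_convMap_tensorBraid hB hi he hV hW hH hBr (y ⊗ₜ[k] (1 : B))
    rw [LinearMap.rTensor_tmul] at e4
    rw [LinearMap.comp_apply, LinearMap.comp_apply, pairMap_ydBraid hD.braided hH, e2, e1,
      Q.assocHom_rr hF, evalMap_comp_convMap hE, e4]

end BraidedTensor

/-! ### Transport of structure -/

section Transport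

variable {k H : Type*} [Field k] [Ring H] [Algebra k H]
variable {V W V' W' X : Type*} [AddCommGroup V] [Module k V] [AddCommGroup W] [Module k W]
  [AddCommGroup V'] [Module k V'] [AddCommGroup W'] [Module k W'] [AddCommGroup X] [Module k X]
variable {lV : V →ₗ[k] H ⊗[k] V} {lV' : V' →ₗ[k] H ⊗[k] V'} {lW : W →ₗ[k] H ⊗[k] W}
  {lW' : W' →ₗ[k] H ⊗[k] W'} {ρV : H →ₗ[k] V →ₗ[k] V} {ρV' : H →ₗ[k] V' →ₗ[k] V'}
  {ρW : H →ₗ[k] W →ₗ[k] W} {ρW' : H →ₗ[k] W' →ₗ[k] W'} {ρX : H →ₗ[k] X →ₗ[k] X}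
variable {Q : QuasiBialgebra k H}

theorem ydSlide_map {f : V →ₗ[k] V'} {g : W →ₗ[k] W'} (hf : IsRepHom ρV ρV' f)
    (hf' : ∀ x, lV' (f x) = f.lTensor H (lV x)) (hg : IsRepHom ρW ρW' g) (hV : IsRep ρV)
    (hV' : IsRep ρV') (hW : IsRep ρW) (hW' : IsRep ρW') (hX : IsRep ρX) (u : V ⊗[k] (X ⊗[k] W)) :
    ydSlide Q lV' ρV' ρX ρW' (TensorProduct.map f (g.lTensor X) u) =
      (TensorProduct.map f g).lTensor X (ydSlide Q lV ρV ρX ρW u) := by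
  obtain ⟨z, rfl⟩ := Q.assocHom_surjective hV hX hW u
  have e : ∀ z, (ydBraid lV' ρX).rTensor W' (TensorProduct.map (f.rTensor X) g z) =
      TensorProduct.map (f.lTensor X) g ((ydBraid lV ρX).rTensor W z) := fun z =>
    TensorProduct.induction_on z (by simp)
      (fun a b => by simp [ydBraid_rTensor hf'])
      (fun x y hx hy => by simp only [map_add, hx, hy])
  have h1 := Q.assocHom_map hf (IsRepHom.id ρX) hg z
  have h2 := Q.assocHom_map (IsRepHom.id ρX) hf hg ((ydBraid lV ρX).rTensor W z)
  rw [ydSlide_assocHom Q hV hX hW]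
  refine (congrArg _ h1.symm).trans ((ydSlide_assocHom Q hV' hX hW' _).trans
    ((congrArg _ (e z)).trans h2))

theorem tensorCoact_map {f : V →ₗ[k] V'} {g : W →ₗ[k] W'} (hf : IsRepHom ρV ρV' f)
    (hf' : ∀ x, lV' (f x) = f.lTensor H (lV x)) (hg : IsRepHom ρW ρW' g)
    (hg' : ∀ x, lW' (g x) = g.lTensor H (lW x)) (hV : IsRep ρV) (hV' : IsRep ρV')
    (hW : IsRep ρW) (hW' : IsRep ρW') (u : V ⊗[k] W) :
    tensorCoact Q ρV' lV' ρW' lW' (TensorProduct.map f g u) =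
      (TensorProduct.map f g).lTensor H (tensorCoact Q ρV lV ρW lW u) := by
  have hH : IsRep (LinearMap.mul k H) := IsRep.mulLeft
  have e : ∀ z, (ydBraid lW' (LinearMap.mul k H)).lTensor V' (TensorProduct.map f (g.rTensor H) z) =
      TensorProduct.map f (g.lTensor H) ((ydBraid lW (LinearMap.mul k H)).lTensor V z) := fun z =>
    TensorProduct.induction_on z (by simp)
      (fun a b => by simp [ydBraid_rTensor hg'])
      (fun x y hx hy => by simp only [map_add, hx, hy])
  have h1 := Q.assocHom_map hf hg (IsRepHom.id (LinearMap.mul k H)) (u ⊗ₜ 1)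
  rw [tensorCoact_eq, tensorCoact_eq, tensorBraid, tensorBraid, LinearMap.comp_apply,
    LinearMap.comp_apply, LinearMap.comp_apply, LinearMap.comp_apply,
    ← ydSlide_map hf hf' hg hV hV' hW hW' hH, ← e]
  exact congrArg _ (congrArg _ h1)

/-- A vector space with the structure maps of a Yetter–Drinfeld algebra that is isomorphic to a
Yetter–Drinfeld algebra is one. -/
theorem YDAlgebraData.IsYDAlgebraIso.isYDAlgebra {D : YDAlgebraData k H V}
    {E : YDAlgebraData k H W} {f : V →ₗ[k] W} (hf : D.IsYDAlgebraIso E f)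
    (hE : E.IsYDAlgebra Q) (hD : IsRep D.act) : D.IsYDAlgebra Q := by
  have inj := hf.bijective.1
  have injH : Function.Injective (f.lTensor H) :=
    Module.Flat.lTensor_preserves_injective_linearMap f inj
  have injHH : Function.Injective ((f.lTensor H).lTensor H) :=
    Module.Flat.lTensor_preserves_injective_linearMap _ injH
  have hact : IsRepHom D.act E.act f := hf.map_act
  have hmul : ∀ u, f (D.mul u) = E.mul (TensorProduct.map f f u) := fun u =>
    TensorProduct.induction_on u (by simp) (fun a b => hf.map_mul a b)
      (fun x y hx hy => by simp only [map_add, hx, hy])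
  have hb : ∀ {X : Type _} [AddCommGroup X] [Module k X] (ρX : H →ₗ[k] X →ₗ[k] X)
      (u : V ⊗[k] X), f.lTensor X (ydBraid D.coact ρX u) = ydBraid E.coact ρX (f.rTensor X u) :=
    fun ρX u => (ydBraid_rTensor hf.map_coact u).symm
  refine ⟨⟨hD.one, hD.mul, fun m => injHH ?_, fun m => inj ?_, fun h m => injH ?_⟩,
    fun a => inj ?_, fun a => inj ?_, fun a b c => inj ?_, fun h a b => inj ?_, fun h => inj ?_,
    injH ?_, fun a b => injH ?_⟩
  · have e1 : f.lTensor H ∘ₗ ydBraid D.coact (LinearMap.mul k H) =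
      ydBraid E.coact (LinearMap.mul k H) ∘ₗ f.rTensor H := LinearMap.ext (hb _)
    have e2 : (f.lTensor H).rTensor H (D.coact m ⊗ₜ[k] (1 : H)) = E.coact (f m) ⊗ₜ 1 := by
      rw [hf.map_coact]
      rfl
    rw [← LinearMap.lTensor_comp_apply, e1, LinearMap.lTensor_comp_apply, ← Q.assocHom_rl hact, e2,
      hE.isYDModule.quasi_coassoc, ← Q.assocHom_l hact, hb, ← Q.assocHom_rr hact]
    rfl
  · have e : ∀ w : H ⊗[k] V, f (TensorProduct.lid k V (Q.ε.toLinearMap.rTensor V w)) =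
        TensorProduct.lid k W (Q.ε.toLinearMap.rTensor W (f.lTensor H w)) := fun w =>
      TensorProduct.induction_on w (by simp) (fun a b => by simp)
        (fun x y hx hy => by simp only [map_add, hx, hy])
    rw [e, ← hf.map_coact, hE.isYDModule.counit_coact]
  · rw [Q.isRepHom_lTensor hact, ← hf.map_coact, hE.isYDModule.compat, hb,
      Q.isRepHom_rTensor hact]
    rfl
  · rw [hf.map_mul, hf.map_one, hE.one_mul]
  · rw [hf.map_mul, hf.map_one, hE.mul_one]
  · have e1 : ∀ w, TensorProduct.map f f (D.mul.lTensor V w) =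
        E.mul.lTensor W (TensorProduct.map f (TensorProduct.map f f) w) := fun w =>
      TensorProduct.induction_on w (by simp) (fun a b => by simp [hmul])
        (fun x y hx hy => by simp only [map_add, hx, hy])
    rw [hf.map_mul, hf.map_mul, hE.mul_assoc, hmul, e1, ← Q.assocHom_map hact hact hact]
    rfl
  · rw [hf.map_act, hf.map_mul, hE.act_mul, hmul, Q.isRepHom_map hact hact]
    rfl
  · rw [hf.map_act, hf.map_one, hE.act_one, map_smul, hf.map_one]
  · rw [← hf.map_coact, hf.map_one, hE.coact_one, LinearMap.lTensor_tmul, hf.map_one]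
  · have e1 : f ∘ₗ D.mul = E.mul ∘ₗ TensorProduct.map f f := LinearMap.ext hmul
    rw [← hf.map_coact, hf.map_mul, hE.coact_mul, ← LinearMap.lTensor_comp_apply, e1,
      LinearMap.lTensor_comp_apply, ← tensorCoact_map hact hf.map_coact hact hf.map_coact hD hE.isRep
        hD hE.isRep]
    rfl

end Transport

/-! ### The map `Π` -/

section Push

variable {k H B W : Type*} [Field k] [Ring H] [Algebra k H] [Ring B] [Algebra k B]
  [AddCommGroup W] [Module k W]
variable {Q : QuasiBialgebra k H} {v : H →ₐ[k] B} {ℓ : B →ₐ[k] H ⊗[k] B}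

theorem isComoduleAlgebra_id : IsComoduleAlgebra Q (AlgHom.id k H) Q.Δ where
  coact_map h := by simp
  coassoc b := by
    simp only [Algebra.TensorProduct.map_id, AlgHom.id_apply]
    exact Q.ΔR_mul_Φ b
  counit := Q.counit_left

/-- A braided intertwiner with values in `H` gives one with values in any comodule algebra. -/
theorem IsBraidedIntertwiner.comp_algHom {ρW : H →ₗ[k] W →ₗ[k] W} {lW : W →ₗ[k] H ⊗[k] W}
    {f : W →ₗ[k] H} (hB : IsComoduleAlgebra Q v ℓ)
    (hf : IsBraidedIntertwiner Q (AlgHom.id k H) Q.Δ ρW lW f) :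
    IsBraidedIntertwiner Q v ℓ ρW lW (v.toLinearMap ∘ₗ f) := by
  have hr : IsRep (resAct v (LinearMap.mul k B)) := isRep_resAct IsRep.mulLeft
  have h0 := hf.isIntertwiner.isRepHom hr
  have hid : resAct (AlgHom.id k H) (resAct v (LinearMap.mul k B)) =
    resAct v (LinearMap.mul k B) := LinearMap.ext fun _ => rfl
  rw [hid] at h0
  refine ⟨h0, fun x => ?_⟩
  have h1 := hf.evalMap_ydBraid (IsRep.mulLeft (k := k) (R := H)) hr ((x ⊗ₜ 1) ⊗ₜ 1)
  have h2 : coactAct Q.Δ (LinearMap.mul k H) (resAct v (LinearMap.mul k B)) =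
      resAct v (coactAct ℓ (LinearMap.mul k H) (LinearMap.mul k B)) :=
    (resAct_coactAct hB).symm
  rw [LinearMap.rTensor_tmul, ydBraid_tmul_one, h2] at h1
  exact h1

theorem algHom_convMap {ρW : H →ₗ[k] W →ₗ[k] W} (f : W →ₗ[k] H) (u : W ⊗[k] W) :
    v (convMap Q (AlgHom.id k H) ρW ρW f f u) =
      convMap Q v ρW ρW (v.toLinearMap ∘ₗ f) (v.toLinearMap ∘ₗ f) u := by
  have hr : IsRep (resAct v (LinearMap.mul k B)) := isRep_resAct IsRep.mulLeft
  have h1 := evalMap_convMap (Q := Q) (v := AlgHom.id k H) (ρV := ρW) (ρW := ρW) hr f f (u ⊗ₜ 1)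
  rw [evalMap_tmul, resAct_mul_apply, mul_one] at h1
  exact h1

end Push

namespace QuasiHopfAlgebra

variable {k H A : Type*} [Field k] [Ring H] [Algebra k H] [AddCommGroup A] [Module k A]
variable (Q : QuasiHopfAlgebra k H) {D : YDAlgebraData k H A}

theorem H₀_eq_twisted : Q.H₀ = Q.twisted (AlgHom.id k H) Q.Δ := rfl

theorem isYDAlgebra_H₀ : Q.H₀.IsYDAlgebra Q.toQuasiBialgebra := by
  rw [H₀_eq_twisted]
  exact Q.isYDAlgebra_twisted isComoduleAlgebra_id

theorem mapPi_eq_adTensor : Q.mapPi D = Q.adTensor D.act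
    (resAct (AlgHom.id k H) (LinearMap.mul k H)) (resRight (AlgHom.id k H)) := by
  have : Q.sandwich = biAct (resAct (AlgHom.id k H) (LinearMap.mul k H))
      (resRight (AlgHom.id k H) ∘ₗ Q.S.toLinearMap) :=
    TensorProduct.ext' fun p q => LinearMap.ext fun h => mul_assoc p h (Q.S q)
  rw [mapPi, adTensor, this]

theorem smashTwisted_eq_twisted (hD : D.IsYDAlgebra Q.toQuasiBialgebra) :
    letI := hD.smashRing
    letI := hD.smashAlgebra
    Q.smashTwisted D = Q.twisted hD.smashJHom hD.smashCoactHom := by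
  let _ := hD.smashRing
  let _ := hD.smashAlgebra
  have : D.smashMul Q.toQuasiBialgebra = LinearMap.mul' k (A ⊗[k] H) :=
    TensorProduct.ext' fun a b => rfl
  rw [smashTwisted, this]
  rfl

theorem isYDAlgebra_smashTwisted (hD : D.IsYDAlgebra Q.toQuasiBialgebra) :
    (Q.smashTwisted D).IsYDAlgebra Q.toQuasiBialgebra := by
  let _ := hD.smashRing
  let _ := hD.smashAlgebra
  rw [Q.smashTwisted_eq_twisted hD]
  exact Q.isYDAlgebra_twisted hD.isComoduleAlgebra_smash

theorem resRight_smashJHom (hD : D.IsYDAlgebra Q.toQuasiBialgebra) :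
    letI := hD.smashRing
    letI := hD.smashAlgebra
    resRight hD.smashJHom = rightAct A (resRight (AlgHom.id k H)) := by
  let _ := hD.smashRing
  let _ := hD.smashAlgebra
  exact LinearMap.ext fun h => TensorProduct.ext' fun a g => hD.smashMul_smashJ_right a g h

/-- In `(A # H)^j`, the endomorphism `Π(a ⊗ h)` is the product of the ones given by `a` and
`h`. -/
theorem twistedEval_mapPi (hD : D.IsYDAlgebra Q.toQuasiBialgebra) (w : A ⊗[k] H) :
    letI := hD.smashRing
    letI := hD.smashAlgebra
    Q.twistedEval hD.smashJHom (Q.mapPi D w) = convMap Q.toQuasiBialgebra hD.smashJHom D.act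
      Q.H₀.act ((TensorProduct.mk k A H).flip 1)
      (hD.smashJHom.toLinearMap ∘ₗ Q.twistedEval (AlgHom.id k H)) w := by
  let _ := hD.smashRing
  let _ := hD.smashAlgebra
  have hH : IsRep (LinearMap.mul k H) := IsRep.mulLeft
  have hj : IsRepHom (LinearMap.mul k H) (resAct hD.smashJHom (LinearMap.mul k (A ⊗[k] H)))
      hD.smashJHom.toLinearMap := fun g h => map_mul hD.smashJHom g h
  have h1 : evalMap (hD.smashJHom.toLinearMap ∘ₗ Q.twistedEval (AlgHom.id k H))
      (LinearMap.mul k (A ⊗[k] H)) ∘ₗ hD.smashJHom.toLinearMap.lTensor H =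
      hD.smashJHom.toLinearMap ∘ₗ evalMap (Q.twistedEval (AlgHom.id k H)) (LinearMap.mul k H) :=
    LinearMap.ext (evalMap_lTensor hj (Q.twistedEval (AlgHom.id k H)))
  have h2 : ∀ x : A ⊗[k] H, evalMap ((TensorProduct.mk k A H).flip 1)
      (LinearMap.mul k (A ⊗[k] H)) (hD.smashJHom.toLinearMap.lTensor A x) = x := by
    intro x
    refine TensorProduct.induction_on x (by simp) (fun a h => ?_)
      (fun x y hx hy => by simp only [map_add, hx, hy])
    have := hD.smashMul_smashJ_right a 1 h
    rw [one_mul] at this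
    exact this
  have h3 : w ⊗ₜ[k] (1 : A ⊗[k] H) = hD.smashJHom.toLinearMap.lTensor (A ⊗[k] H) (w ⊗ₜ 1) := by
    rw [LinearMap.lTensor_tmul, AlgHom.toLinearMap_apply, map_one]
  rw [convMap, LinearMap.comp_apply, LinearMap.comp_apply, LinearMap.comp_apply,
    LinearMap.flip_apply, TensorProduct.mk_apply, h3, Q.assocHom_l hj,
    ← LinearMap.lTensor_comp_apply, h1, LinearMap.lTensor_comp_apply, h2, twistedEval,
    mapPi_eq_adTensor, hD.resAct_smashJHom, Q.resRight_smashJHom hD]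
  refine (Q.evalOne_adTensor (isBimodule_res (AlgHom.id k H)) hD.isRep w).trans ?_
  exact Q.evalPair_eq_pairMap (ℓ := Q.Δ) D.act w

theorem bijective_mapPi (hD : D.IsYDAlgebra Q.toQuasiBialgebra) :
    Function.Bijective (Q.mapPi D) := by
  rw [mapPi_eq_adTensor]
  exact Q.bijective_adTensor (isBimodule_res (AlgHom.id k H)) hD.isRep

theorem isRepHom_mapPi (hD : D.IsYDAlgebra Q.toQuasiBialgebra) :
    IsRepHom (Q.tensorAct D.act Q.H₀.act) (Q.smashTwisted D).act (Q.mapPi D) := by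
  let _ := hD.smashRing
  let _ := hD.smashAlgebra
  rw [Q.smashTwisted_eq_twisted hD, twisted_act, hD.resAct_smashJHom, Q.resRight_smashJHom hD,
    mapPi_eq_adTensor, H₀_eq_twisted, twisted_act]
  exact Q.isRepHom_adTensor (isBimodule_res (AlgHom.id k H)) hD.isRep

/-- The inclusion of `A` and `j` after the evaluation of `H₀` are multiplicative braided
intertwiners with values in `A # H`, and `Π` evaluates to their convolution. -/
theorem isYDAlgebraIso_mapPi (hD : D.IsYDAlgebra Q.toQuasiBialgebra) :
    YDAlgebraData.IsYDAlgebraIso (D.braidedTensor Q.toQuasiBialgebra Q.H₀) (Q.smashTwisted D)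
      (Q.mapPi D) := by
  let _ := hD.smashRing
  let _ := hD.smashAlgebra
  have hB := hD.isComoduleAlgebra_smash
  have hE := Q.isEndAlgebra_twisted hB
  have hid := Q.isEndAlgebra_twisted (isComoduleAlgebra_id (Q := Q.toQuasiBialgebra))
  have h₂ := Q.isYDAlgebra_H₀
  have hi := hD.isBraidedIntertwiner_smashIncl
  have he := hid.braided.comp_algHom hB
  have he' : ∀ u, hD.smashJHom (Q.twistedEval (AlgHom.id k H) (Q.H₀.mul u)) = _ := fun u =>
    (congrArg hD.smashJHom (hid.eval_mul u)).trans (algHom_convMap _ u)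
  have hF := Q.isRepHom_mapPi hD
  have hF' := Q.twistedEval_mapPi hD
  rw [Q.smashTwisted_eq_twisted hD] at hF ⊢
  refine ⟨Q.bijective_mapPi hD, hF, ?_, ?_, ?_⟩
  · exact hE.map_tensorCoact hB hD h₂ hi he hF hF'
  · exact fun m m' => hE.map_braidedTensor_mul hB hD h₂ hi.isIntertwiner he (fun y => ⟨_, rfl⟩)
      hD.smashIncl_mul he' hF hF' (m ⊗ₜ m')
  · refine hE.map_braidedTensor_one hD h₂ rfl ?_ hF hF'
    exact (congrArg hD.smashJHom hid.eval_one).trans (map_one _)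

/-- The axioms for `A ⊗ H₀` are transported from `(A # H)^j` along `Π`. -/
theorem isYDAlgebra_braidedTensor_H₀ (hD : D.IsYDAlgebra Q.toQuasiBialgebra) :
    (D.braidedTensor Q.toQuasiBialgebra Q.H₀).IsYDAlgebra Q.toQuasiBialgebra :=
  (Q.isYDAlgebraIso_mapPi hD).isYDAlgebra (Q.isYDAlgebra_smashTwisted hD)
    (Q.isRep_tensorAct hD.isRep Q.isYDAlgebra_H₀.isRep)

end QuasiHopfAlgebra

end

theorem theorem4p6 {k H A : Type*} [Field k] [Ring H] [Algebra k H]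
    [AddCommGroup A] [Module k A] (Q : QuasiHopfAlgebra k H)
    (D : YDAlgebraData k H A) (hD : D.IsYDAlgebra Q.toQuasiBialgebra) :
    Q.H₀.IsYDAlgebra Q.toQuasiBialgebra ∧
    (D.braidedTensor Q.toQuasiBialgebra Q.H₀).IsYDAlgebra Q.toQuasiBialgebra ∧
    (Q.smashTwisted D).IsYDAlgebra Q.toQuasiBialgebra ∧
    YDAlgebraData.IsYDAlgebraIso (D.braidedTensor Q.toQuasiBialgebra Q.H₀) (Q.smashTwisted D)
      (Q.mapPi D) :=
  ⟨Q.isYDAlgebra_H₀, Q.isYDAlgebra_braidedTensor_H₀ hD, Q.isYDAlgebra_smashTwisted hD,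
    Q.isYDAlgebraIso_mapPi hD⟩
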